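/- Fix a field $\kappa$ and an integer $r\ge 0$; $H_r$ is singular homology with coefficients in $\kappa$. **Tame maps.** For $f:X\to\mathbb R$ write $X_t=f^{-1}(t)$ and $X_{a,b}=f^{-1}([a,b])$. A continuous map $f$ is *tame with critical values* $t_0<t_1<\dots<t_N$ if $X$ is a compact ANR, $t_0=\min f(X)$, $t_N=\max f(X)$, and * for every $t\ne t_0,\dots,t_N$ there is $\epsilon>0$ such that $f: f^{-1}(t-\epsilon,t+\epsilon)\to\mathbb R$ and the projection $X_t\times(t-\epsilon,t+\epsilon)\to\mathbb R$ to the second factor are fiberwise homotopy equivalent; * for every $t_i$ there is $\epsilon>0$ such that the inclusions $X_{t_i}\hookrightarrow X_{t_i,t_i+\epsilon}$ and $X_{t_i}\hookrightarrow X_{t_i-\epsilon,t_i}$ are deformation retractions. **Relevant level persistence numbers.** For $t''\le t\le t'$ let $L_r^+(t;t')=\ker(H_r(X_t)\to H_r(X_{t,t'}))$, $L_r^-(t;t'')=\ker(H_r(X_t)\to H_r(X_{t'',t}))$, and $$l_r(t)=\dim H_r(X_t),\quad l_r^+(t;t')=\dim L_r^+(t;t'),\quad l_r^-(t;t'')=\dim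 L_r^-(t;t''),$$ $$e_r(t;t',t'')=\dim\big(L_r^+(t;t')\cap L_r^-(t;t'')\big),$$ $$i_r(t,t')=\dim\big(\operatorname{im}(H_r(X_t)\to H_r(X_{t,t'}))\cap\operatorname{im}(H_r(X_{t'})\to H_r(X_{t,t'}))\big).$$ Dimensions and numbers of bars take values in $\mathbb N\cup\{\infty\}$. **Bar codes.** A class $0\neq c\in H_r(X_t)$ *dies upward at* $t'>t$ if it maps to $0$ in $H_r(X_{t,t'})$ but not in $H_r(X_{t,s})$ for any $t<s<t'$; it is *detectable at* $t'\ge t$ if its image in $H_r(X_{t,t'})$ is nonzero and lies in the image of $H_r(X_{t'})$. Dying downward and detectability at levels below $t$ are defined symmetrically. A *system of $r$-bar codes for level persistence* of $f$ is a family $BL_r(f)$ of nonempty intervals $[a,b]$, $[a,b)$, $(a,b]$, $(a,b)$ with end points among the $t_i$, each bar $I$ carrying classes $x_I(t)\in H_r(X_t)$, $t\in I$, such that: for every $t\in\mathbb R$ the classes $x_I(t)$ with $I\ni t$ form a basis of $H_r(X_t)$; for $t\le t'$ in $I$ the classes $x_I(t)$ and $x_I(t')$ have the same nonzero image in $H_r(X_{t,t'})$;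 at an open end of $I$ every $x_I(t)$ dies; and beyond a closed end of $I$ no $x_I(t)$ is detectable. Write $N_r(t_i,t_j)$, $N_r(t_i,t_j]$, $N_r[t_i,t_j)$, $N_r[t_i,t_j]$ for the number of bars equal to the respective interval. **Statement.** Let $f$ be tame with critical values $t_0<\dots<t_N$. Then a system of $r$-bar codes for level persistence of $f$ exists, and for every such system and all real $t''\le t\le t'$: 1. $i_r(t,t')$ is the number of bars in $BL_r(f)$ which contain $[t,t']$; 2. $l_r(t)$ is the number of bars in $BL_r(f)$ which contain $t$; 3. $\displaystyle l_r^+(t;t')=\sum_{t_i\le t<t_j\le t'}N_r[t_i,t_j)+\sum_{t_i<t<t_j\le t'}N_r(t_i,t_j)$; 4. $\displaystyle l_r^-(t;t'')=\sum_{t''\le t_i<t\le t_j}N_r(t_i,t_j]+\sum_{t''\le t_i<t<t_j}N_r(t_i,t_j)$; 5. $\displaystyle e_r(t;t',t'')=\sum_{t''\le t_i<t<t_j\le t'}N_r(t_i,t_j)$. -/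

import Mathlib

universe u v w

open Set

namespace LevelPersistence

/-! ### Tame maps -/

/-- Absolute neighbourhood retracts (for metrizable spaces): a metrizable space which is a retract
of an open neighbourhood whenever it is embedded as a closed subspace of a metrizable space. -/
def IsANR (X : Type v) [TopologicalSpace X] : Prop :=
  TopologicalSpace.MetrizableSpace X ∧
    ∀ (Y : Type v) [TopologicalSpace Y] [TopologicalSpace.MetrizableSpace Y] (e : X → Y),
      Topology.IsClosedEmbedding e →
        ∃ (U : Set Y) (hU : ∀ x, e x ∈ U), IsOpen U ∧
          ∃ ρ : C(U, X), ∀ x, ρ ⟨e x, hU x⟩ = x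

/-- `p : E → M` and `q : F → M` are fiberwise homotopy equivalent over `M`. -/
def FiberwiseHomotopyEquivalent {E F M : Type*} [TopologicalSpace E] [TopologicalSpace F]
    (p : E → M) (q : F → M) : Prop :=
  ∃ (g : C(E, F)) (h : C(F, E)), (∀ e, q (g e) = p e) ∧ (∀ y, p (h y) = q y) ∧
    ContinuousMap.HomotopicWith (h.comp g) (ContinuousMap.id E) (fun φ => ∀ e, p (φ e) = p e) ∧
    ContinuousMap.HomotopicWith (g.comp h) (ContinuousMap.id F) (fun φ => ∀ y, q (φ y) = q y)

/-- For subspaces `A ⊆ B`, the inclusion of `A` in `B` is a deformation retraction: there is a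
retraction of `B` onto `A` which, as a self-map of `B`, is homotopic to the identity. -/
def IsDeformationRetractIn {X : Type*} [TopologicalSpace X] (A B : Set X) : Prop :=
  ∃ (h : A ⊆ B) (ρ : C(B, A)), (∀ a : A, ρ (inclusion h a) = a) ∧
    ContinuousMap.Homotopic
      ((⟨inclusion h, continuous_inclusion h⟩ : C(A, B)).comp ρ) (ContinuousMap.id B)

/-- `f : X → ℝ` is a tame map with critical values `t 0 < t 1 < ⋯ < t N`. -/
structure IsTame {X : Type v} [TopologicalSpace X] (f : X → ℝ) {N : ℕ}
    (t : Fin (N + 1) → ℝ) : Prop where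
  continuous : Continuous f
  compact : CompactSpace X
  anr : IsANR X
  strictMono : StrictMono t
  isLeast : IsLeast (range f) (t 0)
  isGreatest : IsGreatest (range f) (t (Fin.last N))
  regular : ∀ s : ℝ, s ∉ range t → ∃ ε > 0,
    FiberwiseHomotopyEquivalent
      (fun x : f ⁻¹' Ioo (s - ε) (s + ε) => f x)
      (fun y : (f ⁻¹' {s}) × Ioo (s - ε) (s + ε) => (y.2 : ℝ))
  critical : ∀ i, ∃ ε > 0,
    IsDeformationRetractIn (f ⁻¹' {t i}) (f ⁻¹' Icc (t i) (t i + ε)) ∧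
    IsDeformationRetractIn (f ⁻¹' {t i}) (f ⁻¹' Icc (t i - ε) (t i))

/-! ### Homology of levels and the relevant level persistence numbers

`X_t` is `f ⁻¹' {t}` and `X_{a,b}` is `f ⁻¹' Icc a b`. -/

section Homology

variable (k : Type u) [Field k] (r : ℕ) {X : Type v} [TopologicalSpace X] (f : X → ℝ)

/-- `H_r (f ⁻¹' S)`: singular homology with coefficients in the field `k`. -/
noncomputable abbrev H (S : Set ℝ) : ModuleCat.{max u v} k :=
  ((AlgebraicTopology.singularHomologyFunctor (ModuleCat.{max u v} k) r).obj
    (ModuleCat.of k (ULift.{v} k))).obj (TopCat.of (f ⁻¹' S))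

/-- The map `H_r (f ⁻¹' S) → H_r (f ⁻¹' T)` induced by the inclusion, for `S ⊆ T`. -/
noncomputable def inclH {S T : Set ℝ} (h : S ⊆ T) : H k r f S →ₗ[k] H k r f T :=
  (((AlgebraicTopology.singularHomologyFunctor (ModuleCat.{max u v} k) r).obj
    (ModuleCat.of k (ULift.{v} k))).map
      (TopCat.ofHom ⟨inclusion (preimage_mono h : f ⁻¹' S ⊆ f ⁻¹' T),
        continuous_inclusion _⟩)).hom

/-- `H_r (X_s) → H_r (X_{s,s'})` for `s ≤ s'`. -/
noncomputable def up {s s' : ℝ} (h : s ≤ s') : H k r f {s} →ₗ[k] H k r f (Icc s s') :=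
  inclH k r f (singleton_subset_iff.2 (left_mem_Icc.2 h))

/-- `H_r (X_{s'}) → H_r (X_{s,s'})` for `s ≤ s'`. -/
noncomputable def down {s s' : ℝ} (h : s ≤ s') : H k r f {s'} →ₗ[k] H k r f (Icc s s') :=
  inclH k r f (singleton_subset_iff.2 (right_mem_Icc.2 h))

/-- The dimension of a vector space, as an extended natural number. -/
noncomputable def dim (V : Type w) [AddCommGroup V] [Module k V] : ℕ∞ :=
  Cardinal.toENat (Module.rank k V)

/-- `L_r^+(s; s')`, where `s ≤ s'`. -/
noncomputable def Lplus {s s' : ℝ} (h : s ≤ s') : Submodule k (H k r f {s}) :=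
  LinearMap.ker (up k r f h)

/-- `L_r^-(s; s'')`, where `s'' ≤ s`. -/
noncomputable def Lminus {s'' s : ℝ} (h : s'' ≤ s) : Submodule k (H k r f {s}) :=
  LinearMap.ker (down k r f h)

/-- `l_r(s)` -/
noncomputable def lNum (s : ℝ) : ℕ∞ := dim k (H k r f {s})

/-- `l_r^+(s; s')` -/
noncomputable def lPlusNum {s s' : ℝ} (h : s ≤ s') : ℕ∞ := dim k (Lplus k r f h)

/-- `l_r^-(s; s'')` -/
noncomputable def lMinusNum {s'' s : ℝ} (h : s'' ≤ s) : ℕ∞ := dim k (Lminus k r f h)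

/-- `e_r(s; s', s'')`, where `s'' ≤ s ≤ s'`. -/
noncomputable def eNum {s'' s s' : ℝ} (h' : s'' ≤ s) (h : s ≤ s') : ℕ∞ :=
  dim k (Lplus k r f h ⊓ Lminus k r f h' : Submodule k (H k r f {s}))

/-- `i_r(s, s')` -/
noncomputable def iNum {s s' : ℝ} (h : s ≤ s') : ℕ∞ :=
  dim k (LinearMap.range (up k r f h) ⊓ LinearMap.range (down k r f h) :
    Submodule k (H k r f (Icc s s')))

/-! ### Death and detectability -/

variable {k r f}

/-- The class `c ∈ H_r (X_s)` dies upward at `s' > s`. -/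
def DiesUpwardAt {s : ℝ} (c : H k r f {s}) (s' : ℝ) : Prop :=
  ∃ h : s < s', up k r f h.le c = 0 ∧ ∀ (q : ℝ) (hq : s < q), q < s' → up k r f hq.le c ≠ 0

/-- The class `c ∈ H_r (X_s)` dies downward at `s'' < s`. -/
def DiesDownwardAt {s : ℝ} (c : H k r f {s}) (s'' : ℝ) : Prop :=
  ∃ h : s'' < s, down k r f h.le c = 0 ∧ ∀ (q : ℝ) (hq : q < s), s'' < q → down k r f hq.le c ≠ 0

/-- The class `c ∈ H_r (X_s)` can be detected at the level `s' ≥ s`. -/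
def DetectableAbove {s s' : ℝ} (h : s ≤ s') (c : H k r f {s}) : Prop :=
  up k r f h c ≠ 0 ∧ up k r f h c ∈ LinearMap.range (down k r f h)

/-- The class `c ∈ H_r (X_s)` can be detected at the level `s'' ≤ s`. -/
def DetectableBelow {s'' s : ℝ} (h : s'' ≤ s) (c : H k r f {s}) : Prop :=
  down k r f h c ≠ 0 ∧ down k r f h c ∈ LinearMap.range (up k r f h)

end Homology

/-! ### Bar codes -/

/-- The four types of intervals `[a, b]`, `[a, b)`, `(a, b]`, `(a, b)`. -/
inductive Bar : Type
  | cc (a b : ℝ)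
  | co (a b : ℝ)
  | oc (a b : ℝ)
  | oo (a b : ℝ)

namespace Bar

def toSet : Bar → Set ℝ
  | cc a b => Icc a b
  | co a b => Ico a b
  | oc a b => Ioc a b
  | oo a b => Ioo a b

def left : Bar → ℝ
  | cc a _ => a
  | co a _ => a
  | oc a _ => a
  | oo a _ => a

def right : Bar → ℝ
  | cc _ b => b
  | co _ b => b
  | oc _ b => b
  | oo _ b => b

def LeftClosed : Bar → Prop
  | cc _ _ => True
  | co _ _ => True
  | oc _ _ => False
  | oo _ _ => False

def RightClosed : Bar → Prop
  | cc _ _ => True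
  | co _ _ => False
  | oc _ _ => True
  | oo _ _ => False

end Bar

/-- A system of `r`-bar codes for the level persistence of `f`, with end points in the set of
values of `t`: a family, indexed by `ι`, of nonempty intervals of the four types, each bar `b`
carrying a homology class `cls b s ∈ H_r (X_s)` at every level `s` it contains (the values at other
levels are irrelevant), such that

* at each level `s` the classes of the bars containing `s` form a basis of `H_r (X_s)`;
* the classes of one bar at two levels `s ≤ s'` have the same nonzero image in `H_r (X_{s,s'})`,
  so that each is detected at the other level by the other one;
* at an open end the classes of the bar die;
* beyond a closed end the classes of the bar cannot be detected. -/
structure LevelBarcode (k : Type u) [Field k] (r : ℕ) {X : Type v} [TopologicalSpace X]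
    (f : X → ℝ) {N : ℕ} (t : Fin (N + 1) → ℝ) (ι : Type w) where
  bar : ι → Bar
  nonempty : ∀ b, (bar b).toSet.Nonempty
  left_mem : ∀ b, (bar b).left ∈ range t
  right_mem : ∀ b, (bar b).right ∈ range t
  cls : ι → ∀ s : ℝ, H k r f {s}
  linearIndependent : ∀ s : ℝ,
    LinearIndependent k (fun b : {b : ι // s ∈ (bar b).toSet} => cls b s)
  span_eq_top : ∀ s : ℝ,
    Submodule.span k (range (fun b : {b : ι // s ∈ (bar b).toSet} => cls b s)) = ⊤
  detect : ∀ (b : ι) (s s' : ℝ) (h : s ≤ s'), s ∈ (bar b).toSet → s' ∈ (bar b).toSet →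
    up k r f h (cls b s) = down k r f h (cls b s') ∧ up k r f h (cls b s) ≠ 0
  dies_left : ∀ b, ¬ (bar b).LeftClosed → ∀ s ∈ (bar b).toSet,
    DiesDownwardAt (cls b s) (bar b).left
  dies_right : ∀ b, ¬ (bar b).RightClosed → ∀ s ∈ (bar b).toSet,
    DiesUpwardAt (cls b s) (bar b).right
  not_detectable_left : ∀ b, (bar b).LeftClosed → ∀ s ∈ (bar b).toSet,
    ∀ (s'' : ℝ) (h : s'' ≤ s), s'' < (bar b).left → ¬ DetectableBelow h (cls b s)
  not_detectable_right : ∀ b, (bar b).RightClosed → ∀ s ∈ (bar b).toSet,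
    ∀ (s' : ℝ) (h : s ≤ s'), (bar b).right < s' → ¬ DetectableAbove h (cls b s)

namespace LevelBarcode

variable {k : Type u} [Field k] {r : ℕ} {X : Type v} [TopologicalSpace X]
  {f : X → ℝ} {N : ℕ} {t : Fin (N + 1) → ℝ} {ι : Type w} (B : LevelBarcode k r f t ι)

/-- The number of bars equal to the interval `J`; thus `B.mult (.oo a b)` is `N_r(a,b)`,
`B.mult (.co a b)` is `N_r[a,b)`, and so on. -/
noncomputable def mult (J : Bar) : ℕ∞ := ENat.card {b : ι // B.bar b = J}

/-- The number of bars which contain the set `S`. -/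
noncomputable def numContaining (S : Set ℝ) : ℕ∞ := ENat.card {b : ι // S ⊆ (B.bar b).toSet}

end LevelBarcode

end LevelPersistence

/-!
The homology of the levels of a tame map is controlled by three facts. If there is no critical value
in `(s, s']`, the inclusion of the level `s` in the slab over `[s, s']` is an isomorphism on
homology (`IsTame.hIso_up`), symmetrically for `[s, s')` and the level `s'` (`IsTame.hIso_down`),
and classes of the slabs over `[s, d]` and `[d, s']` with the same image over `[s, s']` come from a
common class of the level `d` (`IsTame.exists_level`).

These facts are proved with singular chains. Iterated barycentric subdivision makes the simplices of
a cycle small, which gives Mayer-Vietoris exactness and excision for interior covers by preimages of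
intervals (`exists_of_inclH_eq`, `HIso.excision`). Over a regular interval the fiberwise homotopy
equivalence moves the levels into each other. At a critical level only a retraction onto the level
is given, with no control on its tracks. Since `X` is an ANR, sufficiently close maps to `X` are
joined by a short homotopy, so near the critical level the retraction is homotopic to the inclusion
by a homotopy staying in a thin slab, and this yields the isomorphisms there. The retractions from
the two sides glue to collapses of slabs, which provide the common class of `IsTame.exists_level`.

*Counting.* The key property of a system of bar codes is `PreBarcode.separates`: if linear
combinations of bar classes at the levels `s` and `s'` have the same image over `[s, s']`, their
coefficients agree along all bars containing both levels, and every other bar involved is killed at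
an open end inside the slab. For slabs without critical values in `(s, s']` or in `[s, s')` this is
injectivity of one inclusion, and the property can be concatenated by `IsTame.exists_level`. It
shows which bar classes form bases of the kernels and of the intersections of images whose
dimensions are the relevant persistence numbers, and that death and detectability are determined by
the bars (`PreBarcode.toLevelBarcode`).

*Existence.* Pick one level in each cell of the line cut at the critical values. Agreement over the
slab between consecutive levels is a linear relation between their homologies, and every finite
sequence of linear relations decomposes into strands supported on intervals of indices
(`exists_isStrandBasis`). The strands are built from left to right, keeping the basis at each index
adapted to the flag of the vectors that can be related to zero in a given number of further steps
and of those from which a given number of further steps is possible; no finiteness of dimension is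
needed. A strand becomes a bar by transporting its classes within the cells
(`IsTame.exists_preBarcode`); since classes of open cells always extend to the adjacent critical
levels, ends at critical levels are closed and ends at open cells are open.
-/

namespace LevelPersistence

/-! ### Singular chains as finitely supported functions -/

section Chains

/-- Singular `n`-simplices of `X`. -/
abbrev Simp (n : ℕ) (X : Type v) [TopologicalSpace X] : Type v :=
  C(stdSimplex ℝ (Fin (n + 1)), X)

/-- Singular `n`-chains of `X` with coefficients in `k`. -/
abbrev Chain (k : Type u) [Field k] (n : ℕ) (X : Type v) [TopologicalSpace X] : Type (max u v) :=
  Simp n X →₀ k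

/-- The inclusion of the `i`-th face of the standard simplex. -/
noncomputable def faceMap (n : ℕ) (i : Fin (n + 2)) :
    C(stdSimplex ℝ (Fin (n + 1)), stdSimplex ℝ (Fin (n + 1 + 1))) :=
  ⟨stdSimplex.map (Fin.succAbove i), stdSimplex.continuous_map _⟩

variable (k : Type u) [Field k] {X : Type v} [TopologicalSpace X]
  {Y : Type v} [TopologicalSpace Y]

/-- The boundary of singular chains; on `0`-chains it is the zero map to `Chain k (0 - 1) X`. -/
noncomputable def bd : ∀ n : ℕ, Chain k n X →ₗ[k] Chain k (n - 1) X
  | 0 => 0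
  | n + 1 => ∑ i : Fin (n + 2),
      (-1 : k) ^ (i : ℕ) • Finsupp.lmapDomain k k (fun σ : Simp (n + 1) X => σ.comp (faceMap n i))

/-- The map of singular chains induced by a continuous map. -/
noncomputable def chainMap (g : C(X, Y)) (n : ℕ) : Chain k n X →ₗ[k] Chain k n Y :=
  Finsupp.lmapDomain k k g.comp

variable {k}

lemma bd_succ_single (n : ℕ) (σ : Simp (n + 1) X) (a : k) :
    bd k (n + 1) (Finsupp.single σ a) =
      ∑ i : Fin (n + 2), (-1 : k) ^ (i : ℕ) • Finsupp.single (σ.comp (faceMap n i)) a := by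
  simp [bd, LinearMap.sum_apply, Finsupp.mapDomain_single]

@[simp]
lemma chainMap_single (g : C(X, Y)) (n : ℕ) (σ : Simp n X) (a : k) :
    chainMap k g n (Finsupp.single σ a) = Finsupp.single (g.comp σ) a := by
  simp [chainMap, Finsupp.mapDomain_single]

lemma bd_chainMap (g : C(X, Y)) (n : ℕ) (z : Chain k n X) :
    bd k n (chainMap k g n z) = chainMap k g (n - 1) (bd k n z) := by
  cases n with
  | zero => simp [bd]
  | succ n =>
    induction z using Finsupp.induction_linear with
    | zero => simp
    | add a b ha hb => rw [map_add, map_add, ha, hb, map_add, map_add]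
    | single σ a =>
      rw [chainMap_single, bd_succ_single, bd_succ_single, map_sum]
      refine Finset.sum_congr rfl fun i _ => ?_
      rw [map_smul]
      erw [chainMap_single]
      rfl

lemma chainMap_injective (g : C(X, Y)) (hg : Function.Injective g) (n : ℕ) :
    Function.Injective (chainMap k g n) := by
  apply Finsupp.mapDomain_injective
  intro σ τ h
  ext p
  exact hg (congrArg (fun ρ : Simp n Y => ρ p) h)

end Chains

/-! ### Comparison with Mathlib's singular chain complex -/

section Comparison

open CategoryTheory Limits AlgebraicTopology Simplicial

variable {k : Type u} [Field k]

/-- Mathlib's singular chain complex with coefficients in `k`. -/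
noncomputable abbrev singComplex (k : Type u) [Field k] (Y : TopCat.{v}) :
    ChainComplex (ModuleCat.{max u v} k) ℕ :=
  ((singularChainComplexFunctor (ModuleCat.{max u v} k)).obj (ModuleCat.of k (ULift.{v} k))).obj Y

/-- The chain map between Mathlib's singular chain complexes induced by a continuous map. -/
noncomputable abbrev singComplexMap (k : Type u) [Field k] {Y Z : TopCat.{v}} (g : Y ⟶ Z) :
    singComplex k Y ⟶ singComplex k Z :=
  ((singularChainComplexFunctor (ModuleCat.{max u v} k)).obj (ModuleCat.of k (ULift.{v} k))).map g

/-- The generator of Mathlib's singular chain module given by a simplex, scaled by `a`. -/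
noncomputable def genSimp (k : Type u) [Field k] (Y : TopCat.{v}) (n : ℕ) (σ : Simp n Y) :
    k →ₗ[k] (singComplex k Y).X n :=
  ((TopCat.toSSet.obj Y).ιChainComplex (R := ModuleCat.of k (ULift.{v} k))
    ((Y.toSSetObjEquiv (.op ⦋n⦌)).symm σ)).hom ∘ₗ ULift.moduleEquiv.symm.toLinearMap

/-- Mathlib's module of singular chains is the module of finitely supported functions on the
singular simplices. -/
noncomputable def toChain (k : Type u) [Field k] (Y : TopCat.{v}) (n : ℕ) :
    (singComplex k Y).X n →ₗ[k] Chain k n Y :=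
  (Sigma.desc (f := fun (_ : (TopCat.toSSet.obj Y) _⦋n⦌) => ModuleCat.of k (ULift.{v} k))
    (P := ModuleCat.of k (Chain k n Y))
    (fun x => ModuleCat.ofHom ((Finsupp.lsingle (Y.toSSetObjEquiv (.op ⦋n⦌) x)) ∘ₗ
      ULift.moduleEquiv.toLinearMap))).hom

lemma toChain_genSimp (Y : TopCat.{v}) (n : ℕ) (σ : Simp n Y) (a : k) :
    toChain k Y n (genSimp k Y n σ a) = Finsupp.single σ a := by
  have h := Sigma.ι_desc (f := fun (_ : (TopCat.toSSet.obj Y) _⦋n⦌) => ModuleCat.of k (ULift.{v} k))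
    (P := ModuleCat.of k (Chain k n Y))
    (fun x => ModuleCat.ofHom ((Finsupp.lsingle (Y.toSSetObjEquiv (.op ⦋n⦌) x)) ∘ₗ
      ULift.moduleEquiv.toLinearMap)) ((Y.toSSetObjEquiv (.op ⦋n⦌)).symm σ)
  have h2 := congrArg (fun φ => φ.hom (ULift.up a)) h
  simp only [Equiv.apply_symm_apply] at h2
  exact h2

/-- Maps out of the singular chains are determined on the simplices. -/
lemma singComplex_hom_ext (Y : TopCat.{v}) (n : ℕ) {M : Type (max u v)} [AddCommGroup M]
    [Module k M] {φ ψ : (singComplex k Y).X n →ₗ[k] M}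
    (h : ∀ σ a, φ (genSimp k Y n σ a) = ψ (genSimp k Y n σ a)) : φ = ψ := by
  have : ModuleCat.ofHom φ = ModuleCat.ofHom ψ := by
    refine SSet.chainComplex_hom_ext (X := TopCat.toSSet.obj Y)
      (R := ModuleCat.of k (ULift.{v} k)) (T := ModuleCat.of k M) (n := n) fun x => ?_
    ext a
    have := h ((Y.toSSetObjEquiv (.op ⦋n⦌)) x) a.down
    exact this
  exact congrArg (fun φ => φ.hom) this

/-- The inverse of `toChain`. -/
noncomputable def ofChain (k : Type u) [Field k] (Y : TopCat.{v}) (n : ℕ) :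
    Chain k n Y →ₗ[k] (singComplex k Y).X n :=
  Finsupp.lsum k fun σ => genSimp k Y n σ

lemma ofChain_single (Y : TopCat.{v}) (n : ℕ) (σ : Simp n Y) (a : k) :
    ofChain k Y n (Finsupp.single σ a) = genSimp k Y n σ a := by
  simp [ofChain]

lemma toChain_ofChain (Y : TopCat.{v}) (n : ℕ) (z : Chain k n Y) :
    toChain k Y n (ofChain k Y n z) = z := by
  induction z using Finsupp.induction_linear with
  | zero => simp
  | add a b ha hb => rw [map_add, map_add, ha, hb]
  | single σ a => rw [ofChain_single, toChain_genSimp]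

lemma ofChain_toChain (Y : TopCat.{v}) (n : ℕ) (z : (singComplex k Y).X n) :
    ofChain k Y n (toChain k Y n z) = z := by
  have : ofChain k Y n ∘ₗ toChain k Y n = LinearMap.id :=
    singComplex_hom_ext Y n fun σ a => by simp [toChain_genSimp, ofChain_single]
  exact LinearMap.congr_fun this z

lemma toChain_injective (Y : TopCat.{v}) (n : ℕ) : Function.Injective (toChain k Y n) :=
  Function.LeftInverse.injective (ofChain_toChain Y n)

lemma hom_neg_one_pow_smul {M N : ModuleCat.{max u v} k} (φ : M ⟶ N) (i : ℕ) (a : M) :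
    ((-1 : ℤ) ^ i • φ).hom a = (-1 : k) ^ i • φ.hom a := by
  rcases Nat.even_or_odd i with h | h <;> simp [h.neg_one_pow]

lemma toChain_d (Y : TopCat.{v}) (n : ℕ) (z : (singComplex k Y).X n) :
    toChain k Y (n - 1) (((singComplex k Y).d n (n - 1)).hom z) = bd k n (toChain k Y n z) := by
  cases n with
  | zero =>
    have : (singComplex k Y).d 0 (0 - 1) = 0 := HomologicalComplex.shape _ _ _ (by simp)
    rw [this]
    simp [bd]
  | succ n =>
    suffices toChain k Y n ∘ₗ ((singComplex k Y).d (n + 1) n).hom =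
      bd k (n + 1) ∘ₗ toChain k Y (n + 1) from LinearMap.congr_fun this z
    refine singComplex_hom_ext Y (n + 1) fun σ a => ?_
    rw [LinearMap.comp_apply, LinearMap.comp_apply, toChain_genSimp, bd_succ_single]
    have h := SSet.ιChainComplex_d (TopCat.toSSet.obj Y) (ModuleCat.of k (ULift.{v} k))
      ((Y.toSSetObjEquiv (.op ⦋n + 1⦌)).symm σ)
    have h2 := congrArg (fun φ => φ.hom (ULift.up a)) h
    have h3 : ((singComplex k Y).d (n + 1) n).hom (genSimp k Y (n + 1) σ a) =
      ∑ i : Fin (n + 2), (-1 : k) ^ (i : ℕ) • genSimp k Y n (σ.comp (faceMap n i)) a := by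
      refine Eq.trans h2 ?_
      simp only [ModuleCat.hom_sum, LinearMap.sum_apply]
      refine Finset.sum_congr rfl fun i _ => ?_
      exact hom_neg_one_pow_smul _ _ _
    rw [h3, map_sum]
    refine Finset.sum_congr rfl fun i _ => ?_
    rw [map_smul, toChain_genSimp]

lemma toChain_map {Y Z : TopCat.{v}} (g : Y ⟶ Z) (n : ℕ) (z : (singComplex k Y).X n) :
    toChain k Z n (((singComplexMap k g).f n).hom z) = chainMap k g.hom n (toChain k Y n z) := by
  suffices toChain k Z n ∘ₗ ((singComplexMap k g).f n).hom = chainMap k g.hom n ∘ₗ toChain k Y n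
    from LinearMap.congr_fun this z
  refine singComplex_hom_ext Y n fun σ a => ?_
  rw [LinearMap.comp_apply, LinearMap.comp_apply, toChain_genSimp, chainMap_single]
  have h := SSet.ι_chainComplexMap_f _ _ (TopCat.toSSet.map g) (ModuleCat.of k (ULift.{v} k))
      ((Y.toSSetObjEquiv (.op ⦋n⦌)).symm σ)
  have h2 := congrArg (fun φ => φ.hom (ULift.up a)) h
  rw [← toChain_genSimp]
  exact congrArg _ h2

end Comparison

section HomologyClasses

open CategoryTheory Limits AlgebraicTopology

variable (k : Type u) [Field k]

/-- Singular homology of a space, with coefficients in the field `k`. -/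
noncomputable abbrev SH (n : ℕ) (Z : Type v) [TopologicalSpace Z] : ModuleCat.{max u v} k :=
  ((AlgebraicTopology.singularHomologyFunctor (ModuleCat.{max u v} k) n).obj
    (ModuleCat.of k (ULift.{v} k))).obj (TopCat.of Z)

/-- The map in singular homology induced by a continuous map. -/
noncomputable def SHmap (n : ℕ) {Z W : Type v} [TopologicalSpace Z] [TopologicalSpace W]
    (g : C(Z, W)) : SH k n Z →ₗ[k] SH k n W :=
  (((AlgebraicTopology.singularHomologyFunctor (ModuleCat.{max u v} k) n).obj
    (ModuleCat.of k (ULift.{v} k))).map (TopCat.ofHom g)).hom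

variable {Z W V : Type v} [TopologicalSpace Z] [TopologicalSpace W] [TopologicalSpace V]

lemma SHmap_id (n : ℕ) (c : SH k n Z) : SHmap k n (ContinuousMap.id Z) c = c := by
  have h := ((AlgebraicTopology.singularHomologyFunctor (ModuleCat.{max u v} k) n).obj
    (ModuleCat.of k (ULift.{v} k))).map_id (TopCat.of Z)
  exact congrArg (fun φ => φ.hom c) h

lemma SHmap_comp (n : ℕ) (g : C(W, V)) (h : C(Z, W)) (c : SH k n Z) :
    SHmap k n (g.comp h) c = SHmap k n g (SHmap k n h c) := by
  have h := ((AlgebraicTopology.singularHomologyFunctor (ModuleCat.{max u v} k) n).obj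
    (ModuleCat.of k (ULift.{v} k))).map_comp (TopCat.ofHom h) (TopCat.ofHom g)
  exact congrArg (fun φ => φ.hom c) h

/-- Homotopic maps induce the same map in singular homology. -/
lemma SHmap_eq_of_homotopic (n : ℕ) {g h : C(Z, W)} (H : g.Homotopic h) :
    SHmap k n g = SHmap k n h := by
  obtain ⟨F⟩ := H
  have := TopCat.Homotopy.congr_homologyMap_singularChainComplexFunctor
    (C := ModuleCat.{max u v} k) (f := TopCat.ofHom g) (g := TopCat.ofHom h) F
    (ModuleCat.of k (ULift.{v} k)) n
  exact congrArg (fun φ => φ.hom) this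

variable {k} {X : Type v} [TopologicalSpace X]

/-- The inclusion of a subspace. -/
def subtypeMap (A : Set X) : C(A, X) := ⟨Subtype.val, continuous_subtype_val⟩

/-- The inclusion of a subspace in a larger one. -/
def inclMap {A B : Set X} (h : A ⊆ B) : C(A, B) := ⟨inclusion h, continuous_inclusion h⟩

variable (k) in
/-- The singular chains of `X` all of whose simplices lie in `A`. -/
noncomputable def chainsIn (n : ℕ) (A : Set X) : Submodule k (Chain k n X) :=
  Finsupp.supported k k {σ : Simp n X | ∀ p, σ p ∈ A}

lemma single_mem_chainsIn {n : ℕ} {A : Set X} {σ : Simp n X} (h : ∀ p, σ p ∈ A) (a : k) :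
    Finsupp.single σ a ∈ chainsIn k n A :=
  Finsupp.single_mem_supported k a h

lemma chainsIn_mono {n : ℕ} {A B : Set X} (h : A ⊆ B) : chainsIn k n A ≤ chainsIn k n B :=
  Finsupp.supported_mono fun _ hσ p => h (hσ p)

lemma chainsIn_inter {n : ℕ} {A B : Set X} {z : Chain k n X} (hA : z ∈ chainsIn k n A)
    (hB : z ∈ chainsIn k n B) : z ∈ chainsIn k n (A ∩ B) := by
  have : ({σ : Simp n X | ∀ p, σ p ∈ A ∩ B}) = {σ | ∀ p, σ p ∈ A} ∩ {σ | ∀ p, σ p ∈ B} := by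
    ext σ; exact forall_and
  rw [chainsIn, this, Finsupp.supported_inter]
  exact ⟨hA, hB⟩

/-- To check that a linear map respects chains in given subsets it suffices to consider
simplices. -/
lemma map_mem_of_mem_chainsIn {n : ℕ} {A : Set X} {M : Type*} [AddCommGroup M] [Module k M]
    (φ : Chain k n X →ₗ[k] M) (N : Submodule k M)
    (h : ∀ σ : Simp n X, (∀ p, σ p ∈ A) → ∀ a, φ (Finsupp.single σ a) ∈ N) {z : Chain k n X}
    (hz : z ∈ chainsIn k n A) : φ z ∈ N := by
  have : chainsIn k n A ≤ N.comap φ := by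
    rw [chainsIn, Finsupp.supported_eq_span_single, Submodule.span_le]
    rintro _ ⟨σ, hσ, rfl⟩
    exact h σ hσ 1
  exact this hz

lemma bd_mem_chainsIn {n : ℕ} {A : Set X} {z : Chain k n X} (hz : z ∈ chainsIn k n A) :
    bd k n z ∈ chainsIn k (n - 1) A := by
  refine map_mem_of_mem_chainsIn (bd k n) _ (fun σ hσ a => ?_) hz
  cases n with
  | zero => simp [bd]
  | succ n =>
    rw [bd_succ_single]
    exact Submodule.sum_mem _ fun i _ => Submodule.smul_mem _ _
      (single_mem_chainsIn (n := n) (σ := σ.comp (faceMap n i)) (fun p => hσ _) a)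

lemma chainMap_subtype_mem {n : ℕ} {A : Set X} (z : Chain k n A) :
    chainMap k (subtypeMap A) n z ∈ chainsIn k n A := by
  induction z using Finsupp.induction_linear with
  | zero => simp
  | add a b ha hb => rw [map_add]; exact add_mem ha hb
  | single σ a =>
    rw [chainMap_single]
    exact single_mem_chainsIn (fun p => (σ p).2) a

lemma exists_chainMap_subtype_eq {n : ℕ} {A : Set X} {z : Chain k n X}
    (hz : z ∈ chainsIn k n A) : ∃ y : Chain k n A, chainMap k (subtypeMap A) n y = z := by
  refine map_mem_of_mem_chainsIn LinearMap.id (LinearMap.range (chainMap k (subtypeMap A) n))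
    (fun σ hσ a => ?_) hz
  refine ⟨Finsupp.single ⟨fun p => ⟨σ p, hσ p⟩, by fun_prop⟩ a, ?_⟩
  rw [chainMap_single]
  rfl

/-- The cycle `z` of `X` lies in `A` and represents the class `c` in the homology of `A`. -/
def Rep {n : ℕ} (A : Set X) (z : Chain k n X) (c : SH k n A) : Prop :=
  ∃ y : (singComplex k (TopCat.of A)).cycles n,
    chainMap k (subtypeMap A) n (toChain k (TopCat.of A) n
      (((singComplex k (TopCat.of A)).iCycles n).hom y)) = z ∧
    ((singComplex k (TopCat.of A)).homologyπ n).hom y = c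

lemma Rep.mem {n : ℕ} {A : Set X} {z : Chain k n X} {c : SH k n A} (h : Rep A z c) :
    z ∈ chainsIn k n A := by
  obtain ⟨y, rfl, -⟩ := h
  exact chainMap_subtype_mem _

lemma Rep.bd_eq {n : ℕ} {A : Set X} {z : Chain k n X} {c : SH k n A} (h : Rep A z c) :
    bd k n z = 0 := by
  obtain ⟨y, rfl, -⟩ := h
  have h1 := congrArg (fun φ => φ.hom y) ((singComplex k (TopCat.of A)).iCycles_d n (n - 1))
  have h2 : (((singComplex k (TopCat.of A)).d n (n - 1)).hom
    (((singComplex k (TopCat.of A)).iCycles n).hom y)) = 0 := h1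
  have h3 := toChain_d (TopCat.of A) n (((singComplex k (TopCat.of A)).iCycles n).hom y)
  rw [h2, map_zero] at h3
  rw [bd_chainMap]
  exact (congrArg _ h3.symm).trans (map_zero _)

lemma exists_rep {n : ℕ} {A : Set X} (c : SH k n A) : ∃ z : Chain k n X, Rep A z c := by
  obtain ⟨y, hy⟩ := (ModuleCat.epi_iff_surjective
    ((singComplex k (TopCat.of A)).homologyπ n)).1 inferInstance c
  exact ⟨_, y, rfl, hy⟩

lemma exists_rep_of_cycle {n : ℕ} {A : Set X} {z : Chain k n X} (hz : z ∈ chainsIn k n A)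
    (hd : bd k n z = 0) : ∃ c : SH k n A, Rep A z c := by
  obtain ⟨y, rfl⟩ := exists_chainMap_subtype_eq hz
  rw [bd_chainMap] at hd
  have hd' : bd k n y = 0 := chainMap_injective (subtypeMap A) Subtype.val_injective _
    (hd.trans (map_zero _).symm)
  set K := singComplex k (TopCat.of A)
  have hdy : (K.d n (n - 1)).hom (ofChain k (TopCat.of A) n y) = 0 := by
    apply toChain_injective
    rw [toChain_d, toChain_ofChain, map_zero]
    exact hd'
  have hex := (ShortComplex.moduleCat_exact_iff (ShortComplex.mk (K.iCycles n) (K.d n (n - 1))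
    (K.iCycles_d n (n - 1)))).1 (ShortComplex.exact_of_f_is_kernel _
      (K.cyclesIsKernel n (n - 1) (by cases n <;> simp)))
  obtain ⟨w, hw⟩ := hex _ hdy
  refine ⟨(K.homologyπ n).hom w, w, ?_, rfl⟩
  have hw' : (K.iCycles n).hom w = ofChain k (TopCat.of A) n y := hw
  rw [hw', toChain_ofChain]

lemma Rep.sub {n : ℕ} {A : Set X} {z z' : Chain k n X} {c c' : SH k n A} (h : Rep A z c)
    (h' : Rep A z' c') : Rep A (z - z') (c - c') := by
  obtain ⟨y, rfl, rfl⟩ := h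
  obtain ⟨y', rfl, rfl⟩ := h'
  exact ⟨y - y', by simp only [map_sub], map_sub _ _ _⟩

lemma Rep.eq_zero_iff {n : ℕ} {A : Set X} {z : Chain k n X} {c : SH k n A} (h : Rep A z c) :
    c = 0 ↔ ∃ w ∈ chainsIn k (n + 1) A, bd k (n + 1) w = z := by
  obtain ⟨y, rfl, rfl⟩ := h
  set K := singComplex k (TopCat.of A)
  have hex := (ShortComplex.moduleCat_exact_iff (ShortComplex.mk (K.toCycles (n + 1) n)
    (K.homologyπ n) (K.toCycles_comp_homologyπ (n + 1) n))).1
      (ShortComplex.exact_of_g_is_cokernel _ (K.homologyIsCokernel (n + 1) n (by simp)))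
  have hi : ∀ x, (K.iCycles n).hom ((K.toCycles (n + 1) n).hom x) = (K.d (n + 1) n).hom x :=
    fun x => congrArg (fun φ => φ.hom x) (K.toCycles_i (n + 1) n)
  have hd : ∀ x, toChain k (TopCat.of A) n ((K.d (n + 1) n).hom x) =
      bd k (n + 1) (toChain k (TopCat.of A) (n + 1) x) := toChain_d (TopCat.of A) (n + 1)
  constructor
  · intro h0
    obtain ⟨x, hx⟩ := hex y h0
    refine ⟨chainMap k (subtypeMap A) (n + 1) (toChain k (TopCat.of A) (n + 1) x),
      chainMap_subtype_mem _, ?_⟩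
    have hx' : (K.toCycles (n + 1) n).hom x = y := hx
    rw [bd_chainMap, ← hx', hi, hd]
    rfl
  · rintro ⟨w, hw, hwz⟩
    obtain ⟨v, rfl⟩ := exists_chainMap_subtype_eq hw
    rw [bd_chainMap] at hwz
    have h1 := chainMap_injective (subtypeMap A) Subtype.val_injective n hwz
    have h2 : (K.iCycles n).hom ((K.toCycles (n + 1) n).hom (ofChain k (TopCat.of A) (n + 1) v)) =
        (K.iCycles n).hom y := by
      apply toChain_injective
      rw [hi, hd, toChain_ofChain]
      exact h1
    have h3 := (ModuleCat.mono_iff_injective (K.iCycles n)).1 inferInstance h2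
    rw [← h3]
    exact congrArg (fun φ => φ.hom (ofChain k (TopCat.of A) (n + 1) v))
      (K.toCycles_comp_homologyπ (n + 1) n)

lemma Rep.incl {n : ℕ} {A B : Set X} (hAB : A ⊆ B) {z : Chain k n X} {c : SH k n A}
    (h : Rep A z c) : Rep B z (SHmap k n (inclMap hAB) c) := by
  obtain ⟨y, rfl, rfl⟩ := h
  let φ := singComplexMap k (TopCat.ofHom (inclMap hAB))
  refine ⟨(HomologicalComplex.cyclesMap φ n).hom y, ?_, ?_⟩
  · have h1 : ((singComplex k (TopCat.of B)).iCycles n).hom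
      ((HomologicalComplex.cyclesMap φ n).hom y) =
        (φ.f n).hom (((singComplex k (TopCat.of A)).iCycles n).hom y) :=
      congrArg (fun ψ => ψ.hom y) (HomologicalComplex.cyclesMap_i φ n)
    rw [h1, toChain_map]
    simp only [chainMap, Finsupp.lmapDomain_apply]
    rw [← Finsupp.mapDomain_comp]
    rfl
  · exact (congrArg (fun ψ => ψ.hom y) (HomologicalComplex.homologyπ_naturality φ n)).symm

end HomologyClasses

/-! ### Chains of tuples, cones and subdivision -/

section Tuples

/-- Ordered simplicial chains on a set `K`: formal combinations of `(n + 1)`-tuples. -/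
abbrev Tup (k : Type u) [Field k] (n : ℕ) (K : Type w) : Type (max u w) := (Fin (n + 1) → K) →₀ k

variable {k : Type u} [Field k] {K L : Type w}

/-- The boundary of chains of tuples. -/
noncomputable def tbd (n : ℕ) : Tup k (n + 1) K →ₗ[k] Tup k n K :=
  ∑ i : Fin (n + 2),
    (-1 : k) ^ (i : ℕ) • Finsupp.lmapDomain k k (fun v : Fin (n + 1 + 1) → K => v ∘ i.succAbove)

/-- The cone with apex `b`. -/
noncomputable def cone (b : K) (n : ℕ) : Tup k n K →ₗ[k] Tup k (n + 1) K :=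
  Finsupp.lmapDomain k k (fun v : Fin (n + 1) → K => (Fin.cons b v : Fin (n + 2) → K))

/-- The map of chains of tuples induced by a map of sets. -/
noncomputable def tmap (φ : K → L) (n : ℕ) : Tup k n K →ₗ[k] Tup k n L :=
  Finsupp.lmapDomain k k (fun v : Fin (n + 1) → K => φ ∘ v)

lemma tbd_single (n : ℕ) (v : Fin (n + 2) → K) (a : k) :
    tbd n (Finsupp.single v a) =
      ∑ i : Fin (n + 2), (-1 : k) ^ (i : ℕ) • Finsupp.single (v ∘ i.succAbove) a := by
  simp [tbd, LinearMap.sum_apply, Finsupp.mapDomain_single]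

@[simp]
lemma cone_single (b : K) (n : ℕ) (v : Fin (n + 1) → K) (a : k) :
    cone b n (Finsupp.single v a) = Finsupp.single (Fin.cons b v) a := by
  simp [cone, Finsupp.mapDomain_single]

@[simp]
lemma tmap_single (φ : K → L) (n : ℕ) (v : Fin (n + 1) → K) (a : k) :
    tmap φ n (Finsupp.single v a) = Finsupp.single (φ ∘ v) a := by
  simp [tmap, Finsupp.mapDomain_single]

/-- Linear maps out of chains agree when they agree on generators. -/
lemma finsupp_map_ext {α M : Type*} [AddCommGroup M] [Module k M] {φ ψ : (α →₀ k) →ₗ[k] M}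
    (h : ∀ v a, φ (Finsupp.single v a) = ψ (Finsupp.single v a)) (z : α →₀ k) : φ z = ψ z :=
  LinearMap.congr_fun (Finsupp.lhom_ext h) z

lemma tbd_tmap (φ : K → L) (n : ℕ) (z : Tup k (n + 1) K) :
    tbd n (tmap φ (n + 1) z) = tmap φ n (tbd n z) := by
  refine finsupp_map_ext (φ := tbd n ∘ₗ tmap φ (n + 1)) (ψ := tmap φ n ∘ₗ tbd n) (fun v a => ?_) z
  simp only [LinearMap.comp_apply, tmap_single, tbd_single, map_sum, map_smul]
  rfl

lemma tmap_cone (φ : K → L) (b : K) (n : ℕ) (z : Tup k n K) :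
    tmap φ (n + 1) (cone b n z) = cone (φ b) n (tmap φ n z) := by
  refine finsupp_map_ext (φ := tmap φ (n + 1) ∘ₗ cone b n) (ψ := cone (φ b) n ∘ₗ tmap φ n)
    (fun v a => ?_) z
  simp only [LinearMap.comp_apply, tmap_single, cone_single]
  congr 1
  ext i
  refine Fin.cases ?_ (fun i => ?_) i <;> simp

lemma cons_comp_succAbove_succ (b : K) (n : ℕ) (v : Fin (n + 2) → K) (i : Fin (n + 2)) :
    (Fin.cons b v : Fin (n + 3) → K) ∘ (i.succ).succAbove =
      (Fin.cons b (v ∘ i.succAbove) : Fin (n + 2) → K) := by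
  ext j
  refine Fin.cases ?_ (fun j => ?_) j <;> simp

/-- The cone is a contraction in positive degrees. -/
lemma tbd_cone (b : K) (n : ℕ) (z : Tup k (n + 1) K) :
    tbd (n + 1) (cone b (n + 1) z) = z - cone b n (tbd n z) := by
  refine finsupp_map_ext (φ := tbd (n + 1) ∘ₗ cone b (n + 1))
    (ψ := LinearMap.id - cone b n ∘ₗ tbd n) (fun v a => ?_) z
  simp only [LinearMap.comp_apply, LinearMap.sub_apply, LinearMap.id_apply, cone_single,
    tbd_single, map_sum, map_smul]
  rw [Fin.sum_univ_succ]
  simp only [cons_comp_succAbove_succ, Fin.val_succ, pow_succ, mul_neg, mul_one, neg_smul,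
    Finset.sum_neg_distrib, Fin.val_zero, pow_zero, one_smul, ← sub_eq_add_neg]
  congr 2

lemma tbd_zero_single (v : Fin 2 → K) (a : k) :
    tbd 0 (Finsupp.single v a) =
      Finsupp.single (v ∘ Fin.succAbove 0) a - Finsupp.single (v ∘ Fin.succAbove 1) a := by
  rw [tbd_single]
  refine (Fin.sum_univ_two _).trans ?_
  simp [sub_eq_add_neg]

lemma tbd_cone_tbd_zero (b : K) (z : Tup k 1 K) : tbd 0 (cone b 0 (tbd 0 z)) = tbd 0 z := by
  refine finsupp_map_ext (φ := tbd 0 ∘ₗ cone b 0 ∘ₗ tbd 0) (ψ := tbd 0) (fun v a => ?_) z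
  have h0 : ∀ w : Fin 1 → K, (Fin.cons b w : Fin 2 → K) ∘ Fin.succAbove 0 = w := fun w => by
    ext j; simp
  have h1 : ∀ w w' : Fin 1 → K, (Fin.cons b w : Fin 2 → K) ∘ Fin.succAbove 1 =
      (Fin.cons b w' : Fin 2 → K) ∘ Fin.succAbove 1 := fun w w' => by
    ext j
    have : j = 0 := Subsingleton.elim _ _
    subst this
    rfl
  rw [LinearMap.comp_apply, LinearMap.comp_apply, tbd_zero_single, map_sub, map_sub, cone_single,
    cone_single, tbd_zero_single, tbd_zero_single, h0, h0,
    h1 (v ∘ Fin.succAbove 0) (v ∘ Fin.succAbove 1), sub_sub_sub_cancel_right]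

lemma tbd_tbd (n : ℕ) (z : Tup k (n + 2) K) : tbd n (tbd (n + 1) z) = 0 := by
  induction n with
  | zero =>
    refine finsupp_map_ext (φ := tbd 0 ∘ₗ tbd 1) (ψ := 0) (fun v a => ?_) z
    rw [show Finsupp.single v a = cone (v 0) 1 (Finsupp.single (Fin.tail v) a) by
      rw [cone_single, Fin.cons_self_tail], LinearMap.comp_apply, tbd_cone, map_sub,
      tbd_cone_tbd_zero, sub_self, LinearMap.zero_apply]
  | succ n ih =>
    refine finsupp_map_ext (φ := tbd (n + 1) ∘ₗ tbd (n + 2)) (ψ := 0) (fun v a => ?_) z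
    rw [show Finsupp.single v a = cone (v 0) (n + 2) (Finsupp.single (Fin.tail v) a) by
      rw [cone_single, Fin.cons_self_tail], LinearMap.comp_apply, tbd_cone, map_sub,
      tbd_cone, ih, map_zero, sub_zero, sub_self, LinearMap.zero_apply]

lemma tbd_cone_tbd (b : K) (n : ℕ) (z : Tup k (n + 1) K) :
    tbd n (cone b n (tbd n z)) = tbd n z := by
  cases n with
  | zero => exact tbd_cone_tbd_zero b z
  | succ n => rw [tbd_cone, tbd_tbd, map_zero, sub_zero]

/-- Barycentric subdivision of chains of tuples, for a given choice `β` of barycentres. -/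
noncomputable def sd (β : ∀ n, (Fin (n + 1) → K) → K) : ∀ n : ℕ, Tup k n K →ₗ[k] Tup k n K
  | 0 => LinearMap.id
  | n + 1 => Finsupp.lsum k fun v =>
      cone (β (n + 1) v) n ∘ₗ sd β n ∘ₗ tbd n ∘ₗ Finsupp.lsingle v

/-- The chain homotopy between the identity and the subdivision. -/
noncomputable def sdHtpy (β : ∀ n, (Fin (n + 1) → K) → K) :
    ∀ n : ℕ, Tup k n K →ₗ[k] Tup k (n + 1) K
  | 0 => 0
  | n + 1 => Finsupp.lsum k fun v => cone (β (n + 1) v) (n + 1) ∘ₗ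
      (LinearMap.id - sd β (n + 1) - sdHtpy β n ∘ₗ tbd n) ∘ₗ Finsupp.lsingle v

variable (β : ∀ n, (Fin (n + 1) → K) → K)

lemma sd_succ_single (n : ℕ) (v : Fin (n + 2) → K) (a : k) :
    sd β (n + 1) (Finsupp.single v a) =
      cone (β (n + 1) v) n (sd β n (tbd n (Finsupp.single v a))) := by
  simp [sd]

lemma sdHtpy_succ_single (n : ℕ) (v : Fin (n + 2) → K) (a : k) :
    sdHtpy β (n + 1) (Finsupp.single v a) = cone (β (n + 1) v) (n + 1)
      (Finsupp.single v a - sd β (n + 1) (Finsupp.single v a) -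
        sdHtpy β n (tbd n (Finsupp.single v a))) := by
  simp [sdHtpy]

lemma tbd_sd (n : ℕ) (z : Tup k (n + 1) K) : tbd n (sd β (n + 1) z) = sd β n (tbd n z) := by
  induction n with
  | zero =>
    refine finsupp_map_ext (φ := tbd 0 ∘ₗ sd β 1) (ψ := sd β 0 ∘ₗ tbd 0) (fun v a => ?_) z
    rw [LinearMap.comp_apply, sd_succ_single]
    exact tbd_cone_tbd _ _ _
  | succ n ih =>
    refine finsupp_map_ext (φ := tbd (n + 1) ∘ₗ sd β (n + 2)) (ψ := sd β (n + 1) ∘ₗ tbd (n + 1))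
      (fun v a => ?_) z
    rw [LinearMap.comp_apply, sd_succ_single, tbd_cone, ih, tbd_tbd, map_zero, map_zero, sub_zero]
    rfl

lemma tbd_sdHtpy (n : ℕ) (z : Tup k (n + 1) K) :
    tbd (n + 1) (sdHtpy β (n + 1) z) = z - sd β (n + 1) z - sdHtpy β n (tbd n z) := by
  induction n with
  | zero =>
    refine finsupp_map_ext (φ := tbd 1 ∘ₗ sdHtpy β 1)
      (ψ := LinearMap.id - sd β 1 - sdHtpy β 0 ∘ₗ tbd 0) (fun v a => ?_) z
    rw [LinearMap.comp_apply, sdHtpy_succ_single, tbd_cone]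
    simp only [map_sub, tbd_sd]
    simp [sdHtpy, sd]
  | succ n ih =>
    refine finsupp_map_ext (φ := tbd (n + 2) ∘ₗ sdHtpy β (n + 2))
      (ψ := LinearMap.id - sd β (n + 2) - sdHtpy β (n + 1) ∘ₗ tbd (n + 1)) (fun v a => ?_) z
    rw [LinearMap.comp_apply, sdHtpy_succ_single, tbd_cone]
    simp only [map_sub, tbd_sd, ih, tbd_tbd]
    simp

section Naturality

variable {β} {β' : ∀ n, (Fin (n + 1) → L) → L} {φ : K → L}

lemma tmap_sd (h : ∀ n v, φ (β n v) = β' n (φ ∘ v)) (n : ℕ) (z : Tup k n K) :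
    tmap φ n (sd β n z) = sd β' n (tmap φ n z) := by
  induction n with
  | zero => simp [sd]
  | succ n ih =>
    refine finsupp_map_ext (φ := tmap φ (n + 1) ∘ₗ sd β (n + 1))
      (ψ := sd β' (n + 1) ∘ₗ tmap φ (n + 1)) (fun v a => ?_) z
    rw [LinearMap.comp_apply, sd_succ_single, tmap_cone, ih, LinearMap.comp_apply, tmap_single,
      sd_succ_single, h, ← tbd_tmap, tmap_single]

lemma tmap_sdHtpy (h : ∀ n v, φ (β n v) = β' n (φ ∘ v)) (n : ℕ) (z : Tup k n K) :
    tmap φ (n + 1) (sdHtpy β n z) = sdHtpy β' n (tmap φ n z) := by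
  induction n with
  | zero => simp [sdHtpy]
  | succ n ih =>
    refine finsupp_map_ext (φ := tmap φ (n + 2) ∘ₗ sdHtpy β (n + 1))
      (ψ := sdHtpy β' (n + 1) ∘ₗ tmap φ (n + 1)) (fun v a => ?_) z
    rw [LinearMap.comp_apply, sdHtpy_succ_single, tmap_cone, map_sub, map_sub, map_sub, map_sub,
      tmap_sd h, ih, LinearMap.comp_apply, tmap_single, sdHtpy_succ_single, h, ← tbd_tmap,
      tmap_single, map_sub, map_sub]

end Naturality

end Tuples

/-! ### Affine simplices -/

section Affine

/-- The affine singular simplex with given vertices in a standard simplex. -/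
noncomputable def aff {n m : ℕ} (v : Fin (n + 1) → stdSimplex ℝ (Fin (m + 1))) :
    C(stdSimplex ℝ (Fin (n + 1)), stdSimplex ℝ (Fin (m + 1))) where
  toFun t := ⟨∑ i, t.1 i • (v i).1,
    (convex_stdSimplex ℝ _).sum_mem (fun i _ => t.2.1 i) t.2.2 (fun i _ => (v i).2)⟩
  continuous_toFun := by
    refine Continuous.subtype_mk (continuous_finsetSum _ fun i _ => ?_) _
    exact ((continuous_apply i).comp continuous_subtype_val).smul continuous_const

lemma aff_coe {n m : ℕ} (v : Fin (n + 1) → stdSimplex ℝ (Fin (m + 1)))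
    (t : stdSimplex ℝ (Fin (n + 1))) :
    (aff v t).1 = ∑ i, t.1 i • (v i).1 := rfl

lemma aff_aff {n m l : ℕ} (w : Fin (m + 1) → stdSimplex ℝ (Fin (l + 1)))
    (v : Fin (n + 1) → stdSimplex ℝ (Fin (m + 1))) (t : stdSimplex ℝ (Fin (n + 1))) :
    aff w (aff v t) = aff (fun i => aff w (v i)) t := by
  apply Subtype.ext
  simp only [aff_coe, Finset.sum_apply, Pi.smul_apply, smul_eq_mul, Finset.sum_smul,
    Finset.smul_sum, smul_smul]
  rw [Finset.sum_comm]

lemma aff_vertex {n m : ℕ} (v : Fin (n + 1) → stdSimplex ℝ (Fin (m + 1))) (i : Fin (n + 1)) :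
    aff v (stdSimplex.vertex i) = v i := by
  apply Subtype.ext
  rw [aff_coe, Finset.sum_eq_single i]
  · simp
  · intro j _ hj; simp [hj]
  · simp

lemma aff_vertices (n : ℕ) :
    aff (fun i : Fin (n + 1) => stdSimplex.vertex (S := ℝ) i) = ContinuousMap.id _ := by
  ext t j
  change (aff _ t).1 j = _
  rw [aff_coe, Finset.sum_apply, Finset.sum_eq_single j]
  · simp; rfl
  · intro i _ hi; simp [hi.symm]
  · simp

lemma aff_comp_faceMap {n m : ℕ} (v : Fin (n + 2) → stdSimplex ℝ (Fin (m + 1)))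
    (i : Fin (n + 2)) : (aff v).comp (faceMap n i) = aff (v ∘ i.succAbove) := by
  have h : ∀ t, faceMap n i t = aff (fun j => stdSimplex.vertex (i.succAbove j)) t := by
    intro t
    apply Subtype.ext
    ext l
    change (FunOnFinite.linearMap ℝ ℝ i.succAbove t.1) l = _
    rw [aff_coe, FunOnFinite.linearMap_apply_apply, Finset.sum_apply, Finset.sum_filter]
    refine Finset.sum_congr rfl fun j _ => ?_
    by_cases hj : i.succAbove j = l
    · subst hj; simp
    · simp [hj, Ne.symm hj]
  refine ContinuousMap.ext fun t => ?_
  rw [ContinuousMap.comp_apply, h, aff_aff]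
  simp only [aff_vertex]
  rfl

/-- The barycentre of a tuple of points of a standard simplex. -/
noncomputable def bary (m n : ℕ) (v : Fin (n + 1) → stdSimplex ℝ (Fin (m + 1))) :
    stdSimplex ℝ (Fin (m + 1)) :=
  aff v stdSimplex.barycenter

lemma aff_bary {m l : ℕ} (w : Fin (m + 1) → stdSimplex ℝ (Fin (l + 1))) (n : ℕ)
    (v : Fin (n + 1) → stdSimplex ℝ (Fin (m + 1))) :
    aff w (bary m n v) = bary l n (aff w ∘ v) :=
  aff_aff w v _

end Affine

/-! ### Subdivision of singular chains -/

section SingularSubdivision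

variable {k : Type u} [Field k] {X : Type v} [TopologicalSpace X]

/-- The singular chain obtained by composing the affine simplices of a chain of tuples of points
of the standard simplex with a singular simplex. -/
noncomputable def real {m : ℕ} (σ : Simp m X) (n : ℕ) :
    Tup k n (stdSimplex ℝ (Fin (m + 1))) →ₗ[k] Chain k n X :=
  Finsupp.lmapDomain k k (fun v => σ.comp (aff v))

@[simp]
lemma real_single {m : ℕ} (σ : Simp m X) (n : ℕ)
    (v : Fin (n + 1) → stdSimplex ℝ (Fin (m + 1))) (a : k) :
    real σ n (Finsupp.single v a) = Finsupp.single (σ.comp (aff v)) a := by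
  simp [real, Finsupp.mapDomain_single]

lemma bd_real {m : ℕ} (σ : Simp m X) (n : ℕ)
    (z : Tup k (n + 1) (stdSimplex ℝ (Fin (m + 1)))) :
    bd k (n + 1) (real σ (n + 1) z) = real σ n (tbd n z) := by
  refine finsupp_map_ext (φ := bd k (n + 1) ∘ₗ real σ (n + 1)) (ψ := real σ n ∘ₗ tbd n)
    (fun v a => ?_) z
  rw [LinearMap.comp_apply, LinearMap.comp_apply, real_single, bd_succ_single, tbd_single, map_sum]
  refine Finset.sum_congr rfl fun i _ => ?_
  rw [map_smul, real_single, ContinuousMap.comp_assoc, aff_comp_faceMap]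

lemma real_comp_aff {m l : ℕ} (σ : Simp l X) (w : Fin (m + 1) → stdSimplex ℝ (Fin (l + 1)))
    (n : ℕ) (z : Tup k n (stdSimplex ℝ (Fin (m + 1)))) :
    real (σ.comp (aff w)) n z = real σ n (tmap (aff w) n z) := by
  refine finsupp_map_ext (φ := real (σ.comp (aff w)) n) (ψ := real σ n ∘ₗ tmap (aff w) n)
    (fun v a => ?_) z
  rw [LinearMap.comp_apply, real_single, tmap_single, real_single, ContinuousMap.comp_assoc]
  congr 2
  ext1 t
  exact aff_aff w v t

/-- The tuple of vertices of the standard simplex. -/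
noncomputable def vert (n : ℕ) : Fin (n + 1) → stdSimplex ℝ (Fin (n + 1)) :=
  fun i => stdSimplex.vertex i

lemma real_vert {n : ℕ} (σ : Simp n X) (a : k) :
    real σ n (Finsupp.single (vert n) a) = Finsupp.single σ a := by
  rw [real_single]
  unfold vert
  rw [aff_vertices, ContinuousMap.comp_id]

lemma bd_bd (n : ℕ) (z : Chain k (n + 1) X) : bd k n (bd k (n + 1) z) = 0 := by
  cases n with
  | zero => simp [bd]
  | succ n =>
    refine finsupp_map_ext (φ := bd k (n + 1) ∘ₗ bd k (n + 2)) (ψ := 0) (fun σ a => ?_) z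
    rw [LinearMap.comp_apply, ← real_vert, bd_real, bd_real, tbd_tbd, map_zero,
      LinearMap.zero_apply]

lemma aff_comp_vert {n m : ℕ} (v : Fin (n + 1) → stdSimplex ℝ (Fin (m + 1))) :
    aff v ∘ vert n = v :=
  funext fun i => aff_vertex v i

/-- A natural operator on singular chains, given by chains of tuples in the standard simplices. -/
noncomputable def natOp (n l : ℕ)
    (T : Tup k n (stdSimplex ℝ (Fin (n + 1))) →ₗ[k] Tup k l (stdSimplex ℝ (Fin (n + 1)))) :
    Chain k n X →ₗ[k] Chain k l X :=
  Finsupp.lsum k fun σ => real σ l ∘ₗ T ∘ₗ Finsupp.lsingle (vert n)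

@[simp]
lemma natOp_single (n l : ℕ)
    (T : Tup k n (stdSimplex ℝ (Fin (n + 1))) →ₗ[k] Tup k l (stdSimplex ℝ (Fin (n + 1))))
    (σ : Simp n X) (a : k) :
    natOp n l T (Finsupp.single σ a) = real σ l (T (Finsupp.single (vert n) a)) := by
  simp [natOp]

lemma real_mem_chainsIn {m n : ℕ} {A : Set X} {σ : Simp m X} (hσ : ∀ p, σ p ∈ A)
    (z : Tup k n (stdSimplex ℝ (Fin (m + 1)))) : real σ n z ∈ chainsIn k n A := by
  induction z using Finsupp.induction_linear with
  | zero => simp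
  | add a b ha hb => rw [map_add]; exact add_mem ha hb
  | single v a =>
    rw [real_single]
    exact single_mem_chainsIn (σ := σ.comp (aff v)) (fun p => hσ _) a

lemma natOp_mem_chainsIn {n l : ℕ} {A : Set X}
    (T : Tup k n (stdSimplex ℝ (Fin (n + 1))) →ₗ[k] Tup k l (stdSimplex ℝ (Fin (n + 1))))
    {z : Chain k n X} (hz : z ∈ chainsIn k n A) : natOp n l T z ∈ chainsIn k l A :=
  map_mem_of_mem_chainsIn _ _ (fun σ hσ a => by
    rw [natOp_single]; exact real_mem_chainsIn hσ _) hz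

/-- Barycentric subdivision of singular chains. -/
noncomputable def sdC (n : ℕ) : Chain k n X →ₗ[k] Chain k n X := natOp n n (sd (bary n) n)

/-- The chain homotopy between the identity and barycentric subdivision. -/
noncomputable def sdHtpyC (n : ℕ) : Chain k n X →ₗ[k] Chain k (n + 1) X :=
  natOp n (n + 1) (sdHtpy (bary n) n)

lemma sdC_real {m n : ℕ} (σ : Simp m X) (z : Tup k n (stdSimplex ℝ (Fin (m + 1)))) :
    sdC n (real σ n z) = real σ n (sd (bary m) n z) := by
  refine finsupp_map_ext (φ := sdC n ∘ₗ real σ n) (ψ := real σ n ∘ₗ sd (bary m) n)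
    (fun v a => ?_) z
  rw [LinearMap.comp_apply, LinearMap.comp_apply, real_single, sdC, natOp_single, real_comp_aff,
    tmap_sd (β' := bary m) (aff_bary v), tmap_single, aff_comp_vert]

lemma sdHtpyC_real {m n : ℕ} (σ : Simp m X) (z : Tup k n (stdSimplex ℝ (Fin (m + 1)))) :
    sdHtpyC n (real σ n z) = real σ (n + 1) (sdHtpy (bary m) n z) := by
  refine finsupp_map_ext (φ := sdHtpyC n ∘ₗ real σ n) (ψ := real σ (n + 1) ∘ₗ sdHtpy (bary m) n)
    (fun v a => ?_) z
  rw [LinearMap.comp_apply, LinearMap.comp_apply, real_single, sdHtpyC, natOp_single,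
    real_comp_aff, tmap_sdHtpy (β' := bary m) (aff_bary v), tmap_single, aff_comp_vert]

lemma bd_sdC (n : ℕ) (z : Chain k n X) : bd k n (sdC n z) = sdC (n - 1) (bd k n z) := by
  cases n with
  | zero => simp [bd]
  | succ n =>
    refine finsupp_map_ext (φ := bd k (n + 1) ∘ₗ sdC (n + 1)) (ψ := sdC n ∘ₗ bd k (n + 1))
      (fun σ a => ?_) z
    rw [LinearMap.comp_apply, LinearMap.comp_apply, ← real_vert, sdC_real, bd_real, bd_real,
      tbd_sd, sdC_real]

lemma bd_sdHtpyC (n : ℕ) (z : Chain k n X) (hz : bd k n z = 0) :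
    bd k (n + 1) (sdHtpyC n z) = z - sdC n z := by
  cases n with
  | zero =>
    refine finsupp_map_ext (φ := bd k 1 ∘ₗ sdHtpyC 0) (ψ := LinearMap.id - sdC 0)
      (fun σ a => ?_) z
    rw [LinearMap.comp_apply, LinearMap.sub_apply, ← real_vert, sdHtpyC_real, sdC_real]
    simp [sd, sdHtpy]
  | succ n =>
    have key : ∀ y : Chain k (n + 1) X, bd k (n + 2) (sdHtpyC (n + 1) y) =
        y - sdC (n + 1) y - sdHtpyC n (bd k (n + 1) y) := fun y => by
      refine finsupp_map_ext (φ := bd k (n + 2) ∘ₗ sdHtpyC (n + 1))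
        (ψ := LinearMap.id - sdC (n + 1) - sdHtpyC n ∘ₗ bd k (n + 1)) (fun σ a => ?_) y
      rw [LinearMap.comp_apply, LinearMap.sub_apply, LinearMap.sub_apply, LinearMap.comp_apply,
        ← real_vert, sdHtpyC_real, bd_real, sdC_real, bd_real, tbd_sdHtpy, sdHtpyC_real, map_sub,
        map_sub, LinearMap.id_apply]
    rw [key, hz]
    exact (congrArg _ (map_zero _)).trans (sub_zero _)

lemma sdC_pow_mem_chainsIn {n : ℕ} {A : Set X} {z : Chain k n X} (hz : z ∈ chainsIn k n A)
    (N : ℕ) : (sdC n ^ N) z ∈ chainsIn k n A := by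
  induction N with
  | zero => exact hz
  | succ N ih => rw [pow_succ', Module.End.mul_apply]; exact natOp_mem_chainsIn _ ih

lemma bd_sdC_pow (n : ℕ) (z : Chain k n X) (N : ℕ) :
    bd k n ((sdC n ^ N) z) = (sdC (n - 1) ^ N) (bd k n z) := by
  induction N with
  | zero => rfl
  | succ N ih =>
    rw [pow_succ', Module.End.mul_apply, bd_sdC, ih, pow_succ', Module.End.mul_apply]

/-- A cycle is homologous to its iterated subdivisions, inside any subset which contains it. -/
lemma exists_bd_eq_sub_sdC_pow {n : ℕ} {A : Set X} {z : Chain k n X} (hz : z ∈ chainsIn k n A)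
    (hd : bd k n z = 0) (N : ℕ) :
    ∃ w ∈ chainsIn k (n + 1) A, bd k (n + 1) w = z - (sdC n ^ N) z := by
  induction N with
  | zero => exact ⟨0, zero_mem _, by simp⟩
  | succ N ih =>
    obtain ⟨w, hw, hwd⟩ := ih
    refine ⟨w + sdHtpyC n ((sdC n ^ N) z),
      add_mem hw (natOp_mem_chainsIn _ (sdC_pow_mem_chainsIn hz N)), ?_⟩
    rw [map_add, hwd, bd_sdHtpyC _ _ (by rw [bd_sdC_pow, hd, map_zero]), pow_succ',
      Module.End.mul_apply]
    exact sub_add_sub_cancel _ _ _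

lemma sdC_pow_single {n : ℕ} (σ : Simp n X) (a : k) (N : ℕ) :
    (sdC n ^ N) (Finsupp.single σ a) =
      real σ n ((sd (bary n) n ^ N) (Finsupp.single (vert n) a)) := by
  induction N with
  | zero => exact (real_vert σ a).symm
  | succ N ih =>
    rw [pow_succ', Module.End.mul_apply, ih, sdC_real, pow_succ', Module.End.mul_apply]

end SingularSubdivision

/-! ### The mesh of iterated subdivisions -/

section Mesh

variable {k : Type u} [Field k]

variable (k) in
/-- The chains of tuples which satisfy a predicate. -/
noncomputable def tupIn {K : Type w} (n : ℕ) (P : (Fin (n + 1) → K) → Prop) :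
    Submodule k (Tup k n K) := Finsupp.supported k k {v | P v}

lemma map_mem_of_mem_tupIn {K : Type w} {n : ℕ} {P : (Fin (n + 1) → K) → Prop} {M : Type*}
    [AddCommGroup M] [Module k M] (φ : Tup k n K →ₗ[k] M) (N : Submodule k M)
    (h : ∀ v, P v → ∀ a, φ (Finsupp.single v a) ∈ N) {z : Tup k n K} (hz : z ∈ tupIn k n P) :
    φ z ∈ N := by
  have : tupIn k n P ≤ N.comap φ := by
    rw [tupIn, Finsupp.supported_eq_span_single, Submodule.span_le]
    rintro _ ⟨v, hv, rfl⟩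
    exact h v hv 1
  exact this hz

/-- The entries of `u` lie in the convex hull of the entries of `v` and have distance at most
`δ`. -/
def Within {m n l : ℕ} (v : Fin (l + 1) → stdSimplex ℝ (Fin (m + 1))) (δ : ℝ)
    (u : Fin (n + 1) → stdSimplex ℝ (Fin (m + 1))) : Prop :=
  (∀ i, (u i).1 ∈ convexHull ℝ (range fun j => (v j).1)) ∧ ∀ i j, dist (u i) (u j) ≤ δ

lemma aff_mem_convexHull {m n : ℕ} (v : Fin (n + 1) → stdSimplex ℝ (Fin (m + 1)))
    (t : stdSimplex ℝ (Fin (n + 1))) :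
    (aff v t).1 ∈ convexHull ℝ (range fun j => (v j).1) := by
  rw [aff_coe]
  exact (convex_convexHull ℝ _).sum_mem (fun i _ => t.2.1 i) t.2.2
    (fun i _ => subset_convexHull ℝ _ (mem_range_self i))

lemma dist_le_of_mem_convexHull {m n : ℕ} {v : Fin (n + 1) → stdSimplex ℝ (Fin (m + 1))}
    {x y : stdSimplex ℝ (Fin (m + 1))} {δ : ℝ} (h : ∀ j, dist (v j) y ≤ δ)
    (hx : x.1 ∈ convexHull ℝ (range fun j => (v j).1)) : dist x y ≤ δ := by
  have : convexHull ℝ (range fun j => (v j).1) ⊆ Metric.closedBall y.1 δ := by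
    refine convexHull_min ?_ (convex_closedBall _ _)
    rintro _ ⟨j, rfl⟩
    exact h j
  exact this hx

lemma dist_bary_le {m n : ℕ} {v : Fin (n + 1) → stdSimplex ℝ (Fin (m + 1))} {δ : ℝ}
    (h : ∀ i j, dist (v i) (v j) ≤ δ) (j : Fin (n + 1)) :
    dist (v j) (bary m n v) ≤ n / (n + 1) * δ := by
  have hn : (0 : ℝ) < n + 1 := by positivity
  have e : (v j).1 - (bary m n v).1 = ((n : ℝ) + 1)⁻¹ • ∑ i, ((v j).1 - (v i).1) := by
    rw [bary, aff_coe, Finset.sum_sub_distrib, Finset.sum_const, smul_sub, Finset.smul_sum]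
    congr 1
    · rw [Finset.card_univ, Fintype.card_fin, ← Nat.cast_smul_eq_nsmul ℝ, smul_smul]
      push_cast
      rw [inv_mul_cancel₀ hn.ne', one_smul]
    · simp
  change dist (v j).1 (bary m n v).1 ≤ _
  rw [dist_eq_norm, e, norm_smul, Real.norm_of_nonneg (by positivity), Fin.sum_univ_succAbove _ j,
    sub_self, zero_add, div_mul_eq_mul_div, inv_mul_eq_div]
  gcongr
  refine (norm_sum_le _ _).trans ((Finset.sum_le_sum fun i _ => ?_).trans_eq
    (by rw [Finset.sum_const, Finset.card_univ, Fintype.card_fin, nsmul_eq_mul]))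
  rw [← dist_eq_norm]
  exact h _ _

/-- Subdivision of an `n`-simplex scales the diameter by at most `n / (n + 1)`. -/
lemma sd_single_mem {m n : ℕ} {v : Fin (n + 1) → stdSimplex ℝ (Fin (m + 1))} {δ : ℝ}
    (h : ∀ i j, dist (v i) (v j) ≤ δ) (a : k) :
    sd (bary m) n (Finsupp.single v a) ∈ tupIn k n (Within v (n / (n + 1) * δ)) := by
  induction n generalizing a with
  | zero =>
    refine Finsupp.single_mem_supported k a ⟨fun i => subset_convexHull ℝ _ (mem_range_self i),
      fun i j => ?_⟩
    rw [Subsingleton.elim (α := Fin 1) i j]; simp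
  | succ n ih =>
    have hδ : 0 ≤ δ := dist_nonneg.trans (h 0 0)
    rw [sd_succ_single, tbd_single, map_sum, map_sum]
    refine Submodule.sum_mem _ fun i _ => ?_
    rw [map_smul, map_smul]
    refine Submodule.smul_mem _ _ ?_
    refine map_mem_of_mem_tupIn (cone (bary m (n + 1) v) n) _ (fun u hu b => ?_)
      (ih (v := v ∘ i.succAbove) (fun _ _ => h _ _) a)
    rw [cone_single]
    have hu1 : ∀ j, (u j).1 ∈ convexHull ℝ (range fun j => (v j).1) := fun j =>
      convexHull_mono (by rintro _ ⟨l, rfl⟩; exact mem_range_self (i.succAbove l)) (hu.1 j)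
    have hu2 : ∀ j, dist (u j) (bary m (n + 1) v) ≤ ((n + 1 : ℕ) : ℝ) / ((n + 1 : ℕ) + 1) * δ :=
      fun j => dist_le_of_mem_convexHull (dist_bary_le h) (hu1 j)
    refine Finsupp.single_mem_supported k b ⟨fun j => ?_, fun j l => ?_⟩
    · refine Fin.cases ?_ (fun j => ?_) j
      · exact aff_mem_convexHull v _
      · exact hu1 j
    · refine Fin.cases ?_ (fun j => ?_) j <;> refine Fin.cases ?_ (fun l => ?_) l
      · simp only [dist_self]; positivity
      · simp only [Fin.cons_zero, Fin.cons_succ]; rw [dist_comm]; exact hu2 l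
      · simp only [Fin.cons_zero, Fin.cons_succ]; exact hu2 j
      · simp only [Fin.cons_succ]
        refine (hu.2 j l).trans (mul_le_mul_of_nonneg_right ?_ hδ)
        rw [div_le_div_iff₀ (by positivity) (by positivity)]
        push_cast
        nlinarith

lemma sd_pow_mem {m n : ℕ} {v : Fin (n + 1) → stdSimplex ℝ (Fin (m + 1))} {δ : ℝ}
    (h : ∀ i j, dist (v i) (v j) ≤ δ) (a : k) (N : ℕ) :
    (sd (bary m) n ^ N) (Finsupp.single v a) ∈
      tupIn k n (fun u => ∀ i j, dist (u i) (u j) ≤ ((n : ℝ) / (n + 1)) ^ N * δ) := by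
  induction N with
  | zero =>
    refine Finsupp.single_mem_supported k a fun i j => ?_
    rw [pow_zero, one_mul]; exact h i j
  | succ N ih =>
    rw [pow_succ' (sd (bary m) n), Module.End.mul_apply]
    refine map_mem_of_mem_tupIn (sd (bary m) n) _ (fun u hu b => ?_) ih
    refine Finsupp.supported_mono (fun x hx => ?_) (sd_single_mem hu b)
    intro i j
    rw [pow_succ' ((n : ℝ) / (n + 1)), mul_assoc]
    exact hx.2 i j

end Mesh

/-! ### Small simplices -/

section Small

variable {k : Type u} [Field k] {X : Type v} [TopologicalSpace X]

/-- Sufficiently fine subdivisions of a simplex covered by two open sets consist of simplices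
inside one of these. -/
lemma exists_sdC_pow_single_mem {n : ℕ} {P O₁ O₂ : Set X} (h₁ : IsOpen O₁) (h₂ : IsOpen O₂)
    (hP : P ⊆ O₁ ∪ O₂) (σ : Simp n X) (hσ : ∀ p, σ p ∈ P) :
    ∃ N₀, ∀ N ≥ N₀, ∀ a : k, (sdC n ^ N) (Finsupp.single σ a) ∈
      chainsIn k n (P ∩ O₁) ⊔ chainsIn k n (P ∩ O₂) := by
  obtain ⟨η, hη, hleb⟩ := lebesgue_number_lemma_of_metric (s := univ)
    (c := fun b : Bool => σ ⁻¹' (if b then O₁ else O₂)) isCompact_univ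
    (fun b => by cases b <;> simp [h₁.preimage, h₂.preimage, σ.continuous])
    (fun p _ => by
      rcases hP (hσ p) with h | h
      · exact mem_iUnion.2 ⟨true, h⟩
      · exact mem_iUnion.2 ⟨false, h⟩)
  set D := Metric.diam (univ : Set (stdSimplex ℝ (Fin (n + 1))))
  have hD : 0 ≤ D := Metric.diam_nonneg
  have hv : ∀ i j, dist (vert n i) (vert n j) ≤ D := fun i j =>
    Metric.dist_le_diam_of_mem isCompact_univ.isBounded (mem_univ _) (mem_univ _)
  have hr0 : (0 : ℝ) ≤ (n : ℝ) / (n + 1) := by positivity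
  have hr1 : (n : ℝ) / (n + 1) < 1 := by rw [div_lt_one (by positivity)]; linarith
  obtain ⟨N₀, hN₀⟩ := exists_pow_lt_of_lt_one (show 0 < η / (D + 1) by positivity) hr1
  refine ⟨N₀, fun N hN a => ?_⟩
  rw [sdC_pow_single]
  refine map_mem_of_mem_tupIn (real σ n) _ (fun u hu b => ?_) (sd_pow_mem hv a N)
  have hsmall : ((n : ℝ) / (n + 1)) ^ N * D < η := by
    have h1 := (pow_le_pow_of_le_one hr0 hr1.le hN).trans_lt hN₀
    rw [lt_div_iff₀ (by positivity)] at h1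
    have h2 : 0 ≤ ((n : ℝ) / (n + 1)) ^ N := by positivity
    nlinarith
  obtain ⟨c, hc⟩ := hleb (u 0) (mem_univ _)
  have hin : ∀ t, aff u t ∈ Metric.ball (u 0) η := fun t =>
    (dist_le_of_mem_convexHull (fun j => hu j 0) (aff_mem_convexHull u t)).trans_lt hsmall
  rw [real_single]
  cases c with
  | true =>
    exact Submodule.mem_sup_left (single_mem_chainsIn (A := P ∩ O₁) (σ := σ.comp (aff u))
      (fun t => ⟨hσ _, hc (hin t)⟩) b)
  | false =>
    exact Submodule.mem_sup_right (single_mem_chainsIn (A := P ∩ O₂) (σ := σ.comp (aff u))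
      (fun t => ⟨hσ _, hc (hin t)⟩) b)

/-- Every chain covered by two open sets becomes, after sufficiently many subdivisions, a sum of
chains inside these. -/
lemma exists_sdC_pow_mem {n : ℕ} {P O₁ O₂ : Set X} (h₁ : IsOpen O₁) (h₂ : IsOpen O₂)
    (hP : P ⊆ O₁ ∪ O₂) {z : Chain k n X} (hz : z ∈ chainsIn k n P) :
    ∃ N, (sdC n ^ N) z ∈ chainsIn k n (P ∩ O₁) ⊔ chainsIn k n (P ∩ O₂) := by
  suffices ∃ N₀, ∀ N ≥ N₀, (sdC n ^ N) z ∈ chainsIn k n (P ∩ O₁) ⊔ chainsIn k n (P ∩ O₂) by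
    obtain ⟨N, hN⟩ := this
    exact ⟨N, hN N le_rfl⟩
  rw [chainsIn, Finsupp.supported_eq_span_single] at hz
  induction hz using Submodule.span_induction with
  | mem x hx =>
    obtain ⟨σ, hσ, rfl⟩ := hx
    obtain ⟨N₀, h⟩ := exists_sdC_pow_single_mem (k := k) h₁ h₂ hP σ hσ
    exact ⟨N₀, fun N hN => h N hN 1⟩
  | zero => exact ⟨0, fun N _ => by rw [map_zero]; exact zero_mem _⟩
  | add x y _ _ hx hy =>
    obtain ⟨N₁, h1⟩ := hx
    obtain ⟨N₂, h2⟩ := hy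
    refine ⟨max N₁ N₂, fun N hN => ?_⟩
    rw [map_add]
    exact add_mem (h1 N (le_of_max_le_left hN)) (h2 N (le_of_max_le_right hN))
  | smul a x _ hx =>
    obtain ⟨N₁, h1⟩ := hx
    refine ⟨N₁, fun N hN => ?_⟩
    rw [map_smul]
    exact Submodule.smul_mem _ _ (h1 N hN)

end Small

/-! ### Mayer-Vietoris exactness and excision -/

section MayerVietoris

variable (k : Type u) [Field k] {X : Type v} [TopologicalSpace X] {A B P O₁ O₂ : Set X}

lemma Rep.eq_iff {k : Type u} [Field k] {n : ℕ} {A : Set X} {z z' : Chain k n X} {c c' : SH k n A}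
    (h : Rep A z c) (h' : Rep A z' c') :
    c = c' ↔ ∃ w ∈ chainsIn k (n + 1) A, bd k (n + 1) w = z - z' := by
  rw [← sub_eq_zero]
  exact (h.sub h').eq_zero_iff

/-- Mayer-Vietoris: classes of `A` and `B` which agree in `A ∪ B` come from `A ∩ B`. -/
theorem exists_inter_of_SHmap_eq (h₁ : IsOpen O₁) (h₂ : IsOpen O₂) (hP : P ⊆ O₁ ∪ O₂)
    (hA : P ∩ O₁ ⊆ A) (hB : P ∩ O₂ ⊆ B) (hAP : A ⊆ P) (hBP : B ⊆ P) (n : ℕ)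
    (x : SH k n A) (y : SH k n B)
    (hxy : SHmap k n (inclMap hAP) x = SHmap k n (inclMap hBP) y) :
    ∃ e : SH k n (A ∩ B : Set X), SHmap k n (inclMap inter_subset_left) e = x ∧
      SHmap k n (inclMap inter_subset_right) e = y := by
  obtain ⟨α, hα⟩ := exists_rep x
  obtain ⟨β, hβ⟩ := exists_rep y
  obtain ⟨w, hw, hwd⟩ := ((hα.incl hAP).eq_iff (hβ.incl hBP)).1 hxy
  obtain ⟨N, hN⟩ := exists_sdC_pow_mem h₁ h₂ hP hw
  obtain ⟨wA, hwA, wB, hwB, hsum⟩ := Submodule.mem_sup.1 hN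
  replace hwA := chainsIn_mono hA hwA
  replace hwB := chainsIn_mono hB hwB
  let dA : Chain k n X := bd k (n + 1) wA
  let dB : Chain k n X := bd k (n + 1) wB
  have hdA : dA ∈ chainsIn k n A := bd_mem_chainsIn hwA
  have hdB : dB ∈ chainsIn k n B := bd_mem_chainsIn hwB
  have hbd : dA + dB = (sdC n ^ N) α - (sdC n ^ N) β := by
    refine (map_add (bd k (n + 1)) wA wB).symm.trans ?_
    rw [hsum, bd_sdC_pow, hwd]
    exact map_sub _ _ _
  set ε : Chain k n X := (sdC n ^ N) α - dA with hε
  have hε' : ε = (sdC n ^ N) β + dB := by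
    rw [hε, sub_eq_iff_eq_add, add_assoc, add_comm dB, hbd, add_sub_cancel]
  have hεA : ε ∈ chainsIn k n A := sub_mem (sdC_pow_mem_chainsIn hα.mem N) hdA
  have hεB : ε ∈ chainsIn k n B := by
    rw [hε']; exact add_mem (sdC_pow_mem_chainsIn hβ.mem N) hdB
  obtain ⟨u, hu, hud⟩ := exists_bd_eq_sub_sdC_pow hα.mem hα.bd_eq N
  obtain ⟨v, hv, hvd⟩ := exists_bd_eq_sub_sdC_pow hβ.mem hβ.bd_eq N
  have h1 : bd k (n + 1) (u + wA) = α - ε := by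
    rw [map_add, hud]
    change α - (sdC n ^ N) α + dA = _
    rw [hε]; abel
  have h2 : bd k (n + 1) (v - wB) = β - ε := by
    rw [map_sub, hvd]
    change β - (sdC n ^ N) β - dB = _
    rw [hε']; abel
  have hεd : bd k n ε = 0 := by
    rw [hε, map_sub, bd_sdC_pow, hα.bd_eq, map_zero, zero_sub, neg_eq_zero]
    exact bd_bd n wA
  obtain ⟨e, he⟩ := exists_rep_of_cycle (chainsIn_inter hεA hεB) hεd
  refine ⟨e, ?_, ?_⟩
  · exact (((he.incl _).eq_iff hα).2 ⟨-(u + wA), neg_mem (add_mem hu hwA), by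
      rw [map_neg, h1, neg_sub]⟩)
  · exact (((he.incl _).eq_iff hβ).2 ⟨-(v - wB), neg_mem (sub_mem hv hwB), by
      rw [map_neg, h2, neg_sub]⟩)

/-- Excision, surjectivity: if `A ∩ B → B` is injective on homology in degree `n - 1` and
surjective in degree `n`, then `A → A ∪ B` is surjective in degree `n`. -/
theorem SHmap_surjective_of_inter (h₁ : IsOpen O₁) (h₂ : IsOpen O₂) (hP : P ⊆ O₁ ∪ O₂)
    (hA : P ∩ O₁ ⊆ A) (hB : P ∩ O₂ ⊆ B) (hAP : A ⊆ P) (hBP : B ⊆ P) (n : ℕ)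
    (hinj : Function.Injective
      (SHmap k (n - 1) (inclMap (inter_subset_right : (A ∩ B : Set X) ⊆ B))))
    (hsurj : Function.Surjective
      (SHmap k n (inclMap (inter_subset_right : (A ∩ B : Set X) ⊆ B)))) :
    Function.Surjective (SHmap k n (inclMap hAP)) := by
  intro c
  obtain ⟨z, hz⟩ := exists_rep c
  obtain ⟨N, hN⟩ := exists_sdC_pow_mem h₁ h₂ hP hz.mem
  obtain ⟨a, ha, b, hb, hsum⟩ := Submodule.mem_sup.1 hN
  replace ha := chainsIn_mono hA ha
  replace hb := chainsIn_mono hB hb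
  have hd0 : bd k n a + bd k n b = 0 := by
    rw [← map_add, hsum, bd_sdC_pow, hz.bd_eq, map_zero]
  -- the boundary of `b` is a cycle of `A ∩ B` which bounds in `B`, hence in `A ∩ B`
  obtain ⟨γ, hγ, hγd⟩ : ∃ γ ∈ chainsIn k n (A ∩ B), bd k n γ = bd k n b := by
    cases n with
    | zero => exact ⟨0, zero_mem _, by simp [bd]⟩
    | succ n =>
      have hbA : bd k (n + 1) b ∈ chainsIn k n A := by
        rw [← eq_neg_of_add_eq_zero_right hd0 |>.symm]
        exact neg_mem (bd_mem_chainsIn ha)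
      have hbb : bd k n (bd k (n + 1) b) = 0 := bd_bd n b
      obtain ⟨e, he⟩ := exists_rep_of_cycle (chainsIn_inter hbA (bd_mem_chainsIn hb)) hbb
      have he0 : e = 0 := hinj (((he.incl inter_subset_right).eq_zero_iff.2
        ⟨b, hb, rfl⟩).trans (map_zero _).symm)
      exact he.eq_zero_iff.1 he0
  obtain ⟨s, hs⟩ := exists_rep_of_cycle (A := B) (z := b - γ)
    (sub_mem hb (chainsIn_mono inter_subset_right hγ)) (by rw [map_sub, hγd, sub_self])
  obtain ⟨t, ht⟩ := hsurj s
  obtain ⟨δ, hδ⟩ := exists_rep t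
  obtain ⟨w, hw, hwd⟩ := ((hδ.incl inter_subset_right).eq_iff hs).1 ht
  obtain ⟨q, hq⟩ := exists_rep_of_cycle (A := A) (z := a + γ + δ)
    (add_mem (add_mem ha (chainsIn_mono inter_subset_left hγ))
      (chainsIn_mono inter_subset_left hδ.mem))
    (by rw [map_add, map_add, hγd, hd0, hδ.bd_eq, add_zero])
  obtain ⟨u, hu, hud⟩ := exists_bd_eq_sub_sdC_pow hz.mem hz.bd_eq N
  refine ⟨q, ((hq.incl hAP).eq_iff hz).2 ⟨w - u, sub_mem (chainsIn_mono hBP hw) hu, ?_⟩⟩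
  rw [map_sub, hwd, hud, ← hsum]
  abel

/-- Excision. -/
theorem SHmap_bijective_of_inter (h₁ : IsOpen O₁) (h₂ : IsOpen O₂) (hP : P ⊆ O₁ ∪ O₂)
    (hA : P ∩ O₁ ⊆ A) (hB : P ∩ O₂ ⊆ B) (hAP : A ⊆ P) (hBP : B ⊆ P)
    (h : ∀ n, Function.Bijective
      (SHmap k n (inclMap (inter_subset_right : (A ∩ B : Set X) ⊆ B)))) (n : ℕ) :
    Function.Bijective (SHmap k n (inclMap hAP)) := by
  refine ⟨(injective_iff_map_eq_zero _).2 fun x hx => ?_,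
    SHmap_surjective_of_inter k h₁ h₂ hP hA hB hAP hBP n (h _).1 (h n).2⟩
  obtain ⟨e, rfl, he⟩ := exists_inter_of_SHmap_eq k h₁ h₂ hP hA hB hAP hBP n x 0
    (hx.trans (map_zero _).symm)
  rw [(h n).1 (he.trans (map_zero _).symm), map_zero]

end MayerVietoris

/-! ### Inclusions of preimages of intervals -/

section Inclusions

variable (k : Type u) [Field k] {X : Type v} [TopologicalSpace X] (f : X → ℝ)

lemma inclH_eq (n : ℕ) {S T : Set ℝ} (h : S ⊆ T) :
    inclH k n f h = SHmap k n (inclMap (preimage_mono h : f ⁻¹' S ⊆ f ⁻¹' T)) := rfl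

lemma inclH_inclH (n : ℕ) {S T U : Set ℝ} (h : S ⊆ T) (h' : T ⊆ U) (c : H k n f S) :
    inclH k n f h' (inclH k n f h c) = inclH k n f (h.trans h') c :=
  (SHmap_comp k n _ _ c).symm

lemma inclH_self (n : ℕ) {S : Set ℝ} (h : S ⊆ S) (c : H k n f S) : inclH k n f h c = c :=
  SHmap_id k n c

/-- The inclusion of `f ⁻¹' S` in `f ⁻¹' T` is an isomorphism on homology in all degrees. -/
def HIso (S T : Set ℝ) : Prop :=
  ∃ h : S ⊆ T, ∀ n, Function.Bijective (inclH k n f h)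

variable {k f}

lemma HIso.trans {S T U : Set ℝ} (h : HIso k f S T) (h' : HIso k f T U) : HIso k f S U := by
  obtain ⟨h1, h2⟩ := h
  obtain ⟨h3, h4⟩ := h'
  refine ⟨h1.trans h3, fun n => ?_⟩
  have : ⇑(inclH k n f (h1.trans h3)) = inclH k n f h3 ∘ inclH k n f h1 :=
    funext fun c => (inclH_inclH k f n h1 h3 c).symm
  rw [this]
  exact (h4 n).comp (h2 n)

lemma HIso.of_left {S T U : Set ℝ} (h : HIso k f S T) (h' : HIso k f S U) (hTU : T ⊆ U) :
    HIso k f T U := by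
  obtain ⟨h1, h2⟩ := h
  obtain ⟨h3, h4⟩ := h'
  refine ⟨hTU, fun n => ?_⟩
  have : ⇑(inclH k n f h3) = inclH k n f hTU ∘ inclH k n f h1 :=
    funext fun c => (inclH_inclH k f n h1 hTU c).symm
  refine (Function.Bijective.of_comp_iff _ (h2 n)).1 ?_
  rw [← this]
  exact h4 n

/-- Excision for preimages of subsets of the line. -/
lemma HIso.excision (hf : Continuous f) {A B T O₁ O₂ : Set ℝ} (h₁ : IsOpen O₁) (h₂ : IsOpen O₂)
    (hT : T ⊆ O₁ ∪ O₂) (hA : T ∩ O₁ ⊆ A) (hB : T ∩ O₂ ⊆ B) (hAT : A ⊆ T) (hBT : B ⊆ T)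
    (h : HIso k f (A ∩ B) B) : HIso k f A T := by
  obtain ⟨h1, h2⟩ := h
  exact ⟨hAT, SHmap_bijective_of_inter k (h₁.preimage hf) (h₂.preimage hf)
    (A := f ⁻¹' A) (B := f ⁻¹' B) (P := f ⁻¹' T) (preimage_mono hT) (preimage_mono hA)
    (preimage_mono hB) (preimage_mono hAT) (preimage_mono hBT) h2⟩

/-- Mayer-Vietoris exactness for preimages of subsets of the line. -/
lemma exists_of_inclH_eq (hf : Continuous f) {A B T O₁ O₂ : Set ℝ} (h₁ : IsOpen O₁)
    (h₂ : IsOpen O₂) (hT : T ⊆ O₁ ∪ O₂) (hA : T ∩ O₁ ⊆ A) (hB : T ∩ O₂ ⊆ B) (hAT : A ⊆ T)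
    (hBT : B ⊆ T) (n : ℕ) (x : H k n f A) (y : H k n f B)
    (hxy : inclH k n f hAT x = inclH k n f hBT y) :
    ∃ e : H k n f (A ∩ B), inclH k n f inter_subset_left e = x ∧
      inclH k n f inter_subset_right e = y :=
  exists_inter_of_SHmap_eq k (h₁.preimage hf) (h₂.preimage hf)
    (A := f ⁻¹' A) (B := f ⁻¹' B) (P := f ⁻¹' T) (preimage_mono hT) (preimage_mono hA)
    (preimage_mono hB) (preimage_mono hAT) (preimage_mono hBT) n x y hxy

/-- A map with a two-sided homotopy inverse induces bijections in homology. -/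
lemma SHmap_bijective_of_homotopy_inverse {Z W : Type v} [TopologicalSpace Z] [TopologicalSpace W]
    (i : C(Z, W)) (j : C(W, Z)) (h1 : (j.comp i).Homotopic (ContinuousMap.id Z))
    (h2 : (i.comp j).Homotopic (ContinuousMap.id W)) (n : ℕ) :
    Function.Bijective (SHmap k n i) := by
  refine Function.bijective_iff_has_inverse.2 ⟨SHmap k n j, fun c => ?_, fun c => ?_⟩
  · rw [← SHmap_comp, SHmap_eq_of_homotopic k n h1, SHmap_id]
  · rw [← SHmap_comp, SHmap_eq_of_homotopic k n h2, SHmap_id]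

end Inclusions

/-! ### Regular levels -/

section Regular

variable {k : Type u} [Field k] {X : Type v} [TopologicalSpace X] {f : X → ℝ}

variable (k f) in
/-- All inclusions between preimages of nonempty subintervals of `U` are isomorphisms on
homology. -/
def HTrivialOn (U : Set ℝ) : Prop :=
  ∀ S T : Set ℝ, S ⊆ T → T ⊆ U → S.Nonempty → S.OrdConnected → T.OrdConnected → HIso k f S T

lemma HTrivialOn.mono {U V : Set ℝ} (h : HTrivialOn k f U) (hVU : V ⊆ U) : HTrivialOn k f V :=
  fun S T hST hT => h S T hST (hT.trans hVU)

/-- A map which is fiberwise homotopy equivalent to a projection over `U` is homologically trivial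
over `U`. Moving along the second factor of the product retracts the preimage of an interval to
the preimage of a point. -/
lemma hTrivialOn_of_fiberwise {U : Set ℝ} {F : Type v} [TopologicalSpace F]
    (h : FiberwiseHomotopyEquivalent (fun x : f ⁻¹' U => f x) (fun y : F × U => (y.2 : ℝ)))
    (hf : Continuous f) : HTrivialOn k f U := by
  obtain ⟨g, h, hg, hh, ⟨K⟩, -⟩ := h
  have point : ∀ (T : Set ℝ) (q : ℝ) (hq : q ∈ T), T ⊆ U → T.OrdConnected → HIso k f {q} T := by
    intro T q hq hTU hT
    refine ⟨singleton_subset_iff.2 hq, fun n => ?_⟩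
    let inc : C(f ⁻¹' T, f ⁻¹' U) := inclMap (preimage_mono hTU)
    let j : C(f ⁻¹' T, f ⁻¹' {q}) :=
      ⟨fun x => ⟨h ((g (inc x)).1, ⟨q, hTU hq⟩), hh _⟩, by fun_prop⟩
    refine SHmap_bijective_of_homotopy_inverse _ j ?_ ?_ n
    · let inc' : C(f ⁻¹' {q}, f ⁻¹' U) :=
        inclMap (preimage_mono (singleton_subset_iff.2 (hTU hq)))
      have hK : ∀ τ x, f (K (τ, inc' x)) = q := fun τ x => (K.prop τ (inc' x)).trans x.2
      refine ⟨⟨⟨fun p => ⟨K (p.1, inc' p.2), hK _ _⟩, by fun_prop⟩, fun x => ?_, fun x => ?_⟩⟩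
      · apply Subtype.ext
        have h1 := K.apply_zero (inc' x)
        change (K (0, inc' x) : X) = _
        rw [h1]
        change (h (g (inc' x)) : X) = h ((g (inc' x)).1, _)
        congr 2
        refine Prod.ext rfl (Subtype.ext ?_)
        exact (hg (inc' x)).trans x.2
      · apply Subtype.ext
        change (K (1, inc' x) : X) = x
        rw [K.apply_one]
        rfl
    · have hseg : ∀ (τ : unitInterval) (x : f ⁻¹' T),
          (1 - (τ : ℝ)) * q + τ * f x ∈ T := fun τ x => by
        have := hT.uIcc_subset hq x.2
        refine this ?_
        rw [← segment_eq_uIcc]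
        exact ⟨1 - τ, τ, by linarith [τ.2.2], τ.2.1, by ring, rfl⟩
      have hmid : ∀ x : f ⁻¹' T, (h (g (inc x)) : X) ∈ f ⁻¹' T := fun x => by
        have : f (h (g (inc x))) = f x := (hh _).trans (hg _)
        rw [mem_preimage, this]; exact x.2
      let mid : C(f ⁻¹' T, f ⁻¹' T) := ⟨fun x => ⟨h (g (inc x)), hmid x⟩, by fun_prop⟩
      refine ContinuousMap.Homotopic.trans (g := mid) ?_ ?_
      · refine ⟨⟨⟨fun p => ⟨h ((g (inc p.2)).1, ⟨(1 - (p.1 : ℝ)) * q + p.1 * f p.2,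
          hTU (hseg p.1 p.2)⟩), ?_⟩, ?_⟩, fun x => ?_, fun x => ?_⟩⟩
        · rw [mem_preimage, show f (h ((g (inc p.2)).1, ⟨(1 - (p.1 : ℝ)) * q + p.1 * f p.2,
            hTU (hseg p.1 p.2)⟩)) = _ from hh _]
          exact hseg _ _
        · fun_prop
        · apply Subtype.ext
          change (h ((g (inc x)).1, _) : X) = h ((g (inc x)).1, _)
          congr 3
          simp
        · apply Subtype.ext
          change (h ((g (inc x)).1, _) : X) = h (g (inc x))
          congr 2
          refine Prod.ext rfl (Subtype.ext ?_)
          refine Eq.trans ?_ (hg (inc x)).symm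
          simp [inc, inclMap]
      · have hK : ∀ τ x, f (K (τ, inc x)) ∈ T := fun τ x => by
          have := (K.prop τ (inc x)).trans (rfl : _ = f x)
          have h2 : f (K (τ, inc x)) = f x := this
          rw [h2]; exact x.2
        refine ⟨⟨⟨fun p => ⟨K (p.1, inc p.2), hK _ _⟩, by fun_prop⟩, fun x => ?_, fun x => ?_⟩⟩
        · apply Subtype.ext
          change (K (0, inc x) : X) = _
          rw [K.apply_zero]
          rfl
        · apply Subtype.ext
          change (K (1, inc x) : X) = x
          rw [K.apply_one]
          rfl
  rintro S T hST hTU ⟨q, hq⟩ hS hT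
  exact (point S q hq (hST.trans hTU) hS).of_left (point T q (hST hq) hTU hT) hST

/-- If all levels in `[a, b]` are locally homologically trivial, the levels `a` and `b` have the
homology of the preimage of `[a, b]`. -/
lemma hIso_Icc_of_locally (hf : Continuous f) {a b : ℝ} (hab : a ≤ b)
    (h : ∀ p ∈ Icc a b, ∃ ε > 0, HTrivialOn k f (Ioo (p - ε) (p + ε))) :
    HIso k f {a} (Icc a b) ∧ HIso k f {b} (Icc a b) := by
  choose! ε hε htriv using h
  obtain ⟨η, hη, hleb⟩ := lebesgue_number_lemma_of_metric (s := Icc a b)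
    (c := fun p : Icc a b => Ioo ((p : ℝ) - ε p) (p + ε p)) isCompact_Icc
    (fun p => isOpen_Ioo) (fun p hp => mem_iUnion.2 ⟨⟨p, hp⟩, by
      have := hε p hp
      constructor <;> simp only <;> linarith⟩)
  have hη' : ∀ p ∈ Icc a b, HTrivialOn k f (Ioo (p - η) (p + η)) := by
    intro p hp
    obtain ⟨c, hc⟩ := hleb p hp
    rw [Real.ball_eq_Ioo] at hc
    exact (htriv c c.2).mono hc
  have main : ∀ m : ℕ, ∀ c ∈ Icc a b, c ≤ a + m * (η / 2) →
      HIso k f {a} (Icc a c) ∧ HIso k f {c} (Icc a c) := by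
    intro m
    induction m with
    | zero =>
      intro c hc hca
      have : c = a := le_antisymm (by simpa using hca) hc.1
      subst this
      have h1 := hη' c hc {c} (Icc c c) (by simp) (by
        rw [Icc_self, singleton_subset_iff]; constructor <;> linarith) (singleton_nonempty c)
        ordConnected_singleton ordConnected_Icc
      exact ⟨h1, h1⟩
    | succ m ih =>
      intro c' hc' hle
      by_cases hcm : c' ≤ a + m * (η / 2)
      · exact ih c' hc' hcm
      push Not at hcm
      set c := a + m * (η / 2) with hc
      have hac : a ≤ c := by rw [hc]; have : 0 ≤ m * (η / 2) := by positivity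
                             linarith
      have hcb : c ∈ Icc a b := ⟨hac, hcm.le.trans hc'.2⟩
      have hc'c : c' ≤ c + η / 2 := by rw [hc]; push_cast at hle; linarith
      obtain ⟨i1, i2⟩ := ih c hcb le_rfl
      have i3 : HIso k f (Icc a c) (Icc a c') := by
        refine HIso.excision hf (B := Icc a c' ∩ Ioi (c - η / 2)) (isOpen_Iio (a := c))
          (isOpen_Ioi (a := c - η / 2)) (fun x _ => ?_) (fun x hx => ⟨hx.1.1, hx.2.le⟩)
          subset_rfl (Icc_subset_Icc_right hcm.le) inter_subset_left ?_
        · rcases lt_or_ge x c with h | h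
          · exact Or.inl h
          · exact Or.inr (show c - η / 2 < x by linarith)
        · refine hη' c hcb _ _ inter_subset_right ?_ ⟨c, ⟨hac, le_rfl⟩, ⟨hac, hcm.le⟩, ?_⟩ ?_ ?_
          · rintro x ⟨hx1, hx2⟩
            have hx2' : c - η / 2 < x := hx2
            have := hx1.2
            constructor <;> linarith
          · change c - η / 2 < c; linarith
          · exact ordConnected_Icc.inter (ordConnected_Icc.inter ordConnected_Ioi)
          · exact ordConnected_Icc.inter ordConnected_Ioi
      have loc : Icc c c' ⊆ Ioo (c - η) (c + η) := fun x hx => by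
        constructor <;> linarith [hx.1, hx.2]
      have i4 := hη' c hcb {c} (Icc c c') (by simpa using hcm.le) loc (singleton_nonempty c)
        ordConnected_singleton ordConnected_Icc
      have i5 := hη' c hcb {c'} (Icc c c') (by simpa using hcm.le) loc (singleton_nonempty c')
        ordConnected_singleton ordConnected_Icc
      exact ⟨i1.trans i3, i5.trans (i4.of_left (i2.trans i3) (Icc_subset_Icc_left hac))⟩
  obtain ⟨m, hm⟩ := exists_nat_ge ((b - a) / (η / 2))
  refine main m b (right_mem_Icc.2 hab) ?_
  rw [div_le_iff₀ (by positivity)] at hm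
  linarith

end Regular

/-! ### Critical levels -/

section ANR

/-- In a compact absolute neighbourhood retract, points which are close to each other are joined by
paths which depend continuously on them, stay close, and are constant on the diagonal: embed the
space in a normed space and retract straight segments. -/
lemma IsANR.exists_short_paths {X : Type v} [TopologicalSpace X] [CompactSpace X] (hX : IsANR X)
    {f : X → ℝ} (hf : Continuous f) {δ : ℝ} (hδ : 0 < δ) :
    ∃ (N : Set (X × X)) (G : unitInterval × (X × X) → X), IsOpen N ∧ (∀ x, (x, x) ∈ N) ∧
      ContinuousOn G {p | p.2 ∈ N} ∧
      (∀ q ∈ N, G (0, q) = q.1 ∧ G (1, q) = q.2 ∧ ∀ τ, |f (G (τ, q)) - f q.1| < δ) := by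
  classical
  obtain ⟨hmet, hX⟩ := hX
  let _ : MetricSpace X := TopologicalSpace.metrizableSpaceMetric X
  let e : C(X, C(X, ℝ)) := ContinuousMap.curry ⟨fun p : X × X => dist p.1 p.2, continuous_dist⟩
  have einj : Function.Injective e := fun x y hxy => by
    have := congrArg (fun φ : C(X, ℝ) => φ y) hxy
    exact dist_eq_zero.1 (this.trans (dist_self y))
  obtain ⟨U, hU, hUo, ρ, hρ⟩ := hX C(X, ℝ) e (e.continuous.isClosedEmbedding einj)
  let seg : unitInterval × (X × X) → C(X, ℝ) := fun p =>
    (1 - (p.1 : ℝ)) • e p.2.1 + (p.1 : ℝ) • e p.2.2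
  have hseg : Continuous seg := by fun_prop
  let O : Set (unitInterval × (X × X)) := seg ⁻¹' U
  have hO : IsOpen O := hUo.preimage hseg
  let G : unitInterval × (X × X) → X := fun p => if h : seg p ∈ U then ρ ⟨seg p, h⟩ else p.2.1
  have hGeq : ∀ (p) (x : X), seg p = e x → G p = x := fun p x h => by
    have hp : seg p ∈ U := h ▸ hU x
    refine ((dif_pos hp : G p = _).trans ?_).trans (hρ x)
    congr 2
  have hG : ContinuousOn G O := by
    rw [continuousOn_iff_continuous_domRestrict]
    have : O.domRestrict G = fun p : O => ρ ⟨seg p, p.2⟩ := by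
      ext p
      exact dif_pos p.2
    rw [this]
    fun_prop
  let W : Set (unitInterval × (X × X)) := O ∩ {p | |f (G p) - f p.2.1| < δ}
  have hW : IsOpen W := by
    have h1 : ContinuousOn (fun p : unitInterval × (X × X) => |f (G p) - f p.2.1|) O :=
      ((hf.comp_continuousOn hG).sub (by fun_prop)).abs
    exact h1.isOpen_inter_preimage hO isOpen_Iio
  refine ⟨{q | ∀ τ, (τ, q) ∈ W}, G, ?_, fun x τ => ?_, hG.mono fun p hp => (hp p.1).1, ?_⟩
  · have : {q | ∀ τ, (τ, q) ∈ W} = (Prod.snd '' Wᶜ)ᶜ := by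
      ext q; simp
    rw [this, isOpen_compl_iff]
    exact isClosedMap_snd_of_compactSpace _ hW.isClosed_compl
  · have h1 : seg (τ, (x, x)) = e x := by
      simp only [seg]; rw [← add_smul]; simp
    refine ⟨?_, ?_⟩
    · change seg _ ∈ U
      rw [h1]; exact hU x
    · change |f (G (τ, (x, x))) - f x| < δ
      rw [hGeq _ _ h1]; simpa using hδ
  · intro q hq
    refine ⟨hGeq _ _ (by simp [seg]), hGeq _ _ (by simp [seg]), fun τ => (hq τ).2⟩

end ANR

section Critical

variable {k : Type u} [Field k] {X : Type v} [TopologicalSpace X] {f : X → ℝ}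

/-- `P` collapses the part of the space at levels between `d` and `d + ε` to the level `d`, and
fixes the part below. -/
structure CollapsesAbove (f : X → ℝ) (d ε : ℝ) (P : X → X) : Prop where
  continuousOn : ContinuousOn P (f ⁻¹' Iic (d + ε))
  eq_self : ∀ x, f x ≤ d → P x = x
  level : ∀ x, d ≤ f x → f x ≤ d + ε → f (P x) = d

/-- `P` collapses the part of the space at levels between `d - ε` and `d` to the level `d`, and
fixes the part above. -/
structure CollapsesBelow (f : X → ℝ) (d ε : ℝ) (P : X → X) : Prop where
  continuousOn : ContinuousOn P (f ⁻¹' Ici (d - ε))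
  eq_self : ∀ x, d ≤ f x → P x = x
  level : ∀ x, d - ε ≤ f x → f x ≤ d → f (P x) = d

lemma exists_collapsesAbove (hf : Continuous f) {d ε : ℝ} (hε : 0 < ε)
    (h : IsDeformationRetractIn (f ⁻¹' {d}) (f ⁻¹' Icc d (d + ε))) :
    ∃ P, CollapsesAbove f d ε P := by
  classical
  obtain ⟨hAB, ρ, hρ, -⟩ := h
  let P : X → X := fun x => if h : f x ∈ Icc d (d + ε) then ρ ⟨x, h⟩ else x
  have hfix : ∀ x, f x ≤ d → P x = x := fun x hx => by
    by_cases h : f x ∈ Icc d (d + ε)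
    · have hx' : f x = d := le_antisymm hx h.1
      simp only [P, dif_pos h]
      exact congrArg Subtype.val (hρ ⟨x, hx'⟩)
    · exact dif_neg h
  refine ⟨P, ?_, hfix, fun x h1 h2 => ?_⟩
  · have : f ⁻¹' Iic (d + ε) = f ⁻¹' Iic d ∪ f ⁻¹' Icc d (d + ε) := by
      rw [← preimage_union, Iic_union_Icc_eq_Iic (by linarith)]
    rw [this]
    refine ContinuousOn.union_of_isClosed ?_ ?_ (isClosed_Iic.preimage hf)
      (isClosed_Icc.preimage hf)
    · exact continuousOn_id.congr fun x hx => hfix x hx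
    · rw [continuousOn_iff_continuous_domRestrict]
      have : (f ⁻¹' Icc d (d + ε)).domRestrict P = fun x => (ρ x : X) := by
        ext x
        exact dif_pos x.2
      rw [this]
      fun_prop
  · have h : f x ∈ Icc d (d + ε) := ⟨h1, h2⟩
    simp only [P, dif_pos h]
    exact (ρ ⟨x, h⟩).2

lemma CollapsesAbove.neg {d ε : ℝ} {P : X → X} (h : CollapsesAbove (fun x => -f x) (-d) ε P) :
    CollapsesBelow f d ε P := by
  refine ⟨h.continuousOn.mono fun x hx => ?_, fun x hx => h.eq_self x (by simpa using hx),
    fun x h1 h2 => ?_⟩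
  · have : d - ε ≤ f x := hx
    change -f x ≤ -d + ε
    linarith
  · have := h.level x (by simpa using h2) (by linarith)
    linarith

lemma CollapsesBelow.neg {d ε : ℝ} {P : X → X} (h : CollapsesBelow f d ε P) :
    CollapsesAbove (fun x => -f x) (-d) ε P := by
  refine ⟨h.continuousOn.mono fun x hx => ?_, fun x hx => h.eq_self x (by simpa using hx),
    fun x h1 h2 => ?_⟩
  · have : -f x ≤ -d + ε := hx
    change d - ε ≤ f x
    linarith
  · have := h.level x (by linarith) (by simpa using h1)
    linarith

lemma CollapsesAbove.neg' {d ε : ℝ} {P : X → X} (h : CollapsesAbove f d ε P) :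
    CollapsesBelow (fun x => -f x) (-d) ε P := by
  refine ⟨h.continuousOn.mono fun x hx => ?_, fun x hx => h.eq_self x (by simpa using hx),
    fun x h1 h2 => ?_⟩
  · have : -d - ε ≤ -f x := hx
    change f x ≤ d + ε
    linarith
  · have := h.level x (by linarith) (by linarith)
    linarith

lemma exists_collapsesBelow (hf : Continuous f) {d ε : ℝ} (hε : 0 < ε)
    (h : IsDeformationRetractIn (f ⁻¹' {d}) (f ⁻¹' Icc (d - ε) d)) :
    ∃ P, CollapsesBelow f d ε P := by
  have h1 : f ⁻¹' {d} = (fun x => -f x) ⁻¹' {-d} := by ext x; simp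
  have h2 : f ⁻¹' Icc (d - ε) d = (fun x => -f x) ⁻¹' Icc (-d) (-d + ε) := by
    ext x
    simp only [mem_preimage, mem_Icc]
    constructor <;> rintro ⟨h3, h4⟩ <;> constructor <;> linarith
  rw [h1, h2] at h
  obtain ⟨P, hP⟩ := exists_collapsesAbove hf.neg hε h
  exact ⟨P, hP.neg⟩

/-- The map between preimages of subsets of the line given by a partially continuous map. -/
def levelMap (P : X → X) {S T : Set ℝ} (hP : ContinuousOn P (f ⁻¹' S))
    (hST : ∀ x, f x ∈ S → f (P x) ∈ T) : C(f ⁻¹' S, f ⁻¹' T) :=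
  ⟨fun x => ⟨P x, hST x x.2⟩, by
    refine Continuous.subtype_mk ?_ _
    exact hP.comp_continuous continuous_subtype_val fun x => x.2⟩

/-- If `P` collapses `[d, d + ε]` to `d`, then close enough to `d` the graph of `P` is close to
the diagonal. -/
lemma CollapsesAbove.exists_mem [CompactSpace X] (hf : Continuous f) {d ε : ℝ}
    {P : X → X} (hP : CollapsesAbove f d ε P) {N : Set (X × X)} (hN : IsOpen N)
    (hdiag : ∀ x, (x, x) ∈ N) {δ : ℝ} (hδ : 0 < δ) :
    ∃ s > 0, s ≤ δ ∧ ∀ x, d ≤ f x → f x ≤ d + s → f x ≤ d + ε → (x, P x) ∈ N := by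
  let Bad : Set X := f ⁻¹' Icc d (d + ε) ∩ (fun x => (x, P x)) ⁻¹' Nᶜ
  have hBad : IsClosed Bad := by
    refine ContinuousOn.preimage_isClosed_of_isClosed ?_ (isClosed_Icc.preimage hf)
      hN.isClosed_compl
    exact continuousOn_id.prodMk (hP.continuousOn.mono (preimage_mono Icc_subset_Iic_self))
  rcases Bad.eq_empty_or_nonempty with h | h
  · refine ⟨δ, hδ, le_rfl, fun x h1 _ h2 => ?_⟩
    by_contra hx
    exact (h ▸ (⟨⟨h1, h2⟩, hx⟩ : x ∈ Bad) : x ∈ (∅ : Set X))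
  · obtain ⟨m, hm, hmin⟩ := hBad.isCompact.exists_isMinOn h hf.continuousOn
    have hmd : d < f m := by
      refine lt_of_le_of_ne hm.1.1 fun h => hm.2 ?_
      change (m, P m) ∈ N
      rw [hP.eq_self m h.ge]
      exact hdiag m
    refine ⟨min δ ((f m - d) / 2), lt_min hδ (by linarith), min_le_left _ _,
      fun x h1 h2 h3 => ?_⟩
    by_contra hx
    have h4 : f m ≤ f x := hmin (show x ∈ Bad from ⟨⟨h1, h3⟩, hx⟩)
    have := min_le_right δ ((f m - d) / 2)
    linarith

/-- Just above a critical level the homology is that of the critical level: the inclusion of a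
thinner slab in a thicker one is homotopic to the collapsing map. -/
lemma hIso_Icc_right [CompactSpace X] (hX : IsANR X) (hf : Continuous f) {d ε δ : ℝ}
    {P Q : X → X} (hP : CollapsesAbove f d ε P) (hQ : CollapsesBelow f d ε Q) (hδ : 0 < δ)
    (hδε : δ ≤ ε)
    (hreg : ∀ a b, d < a → a ≤ b → b ≤ d + δ →
      HIso k f {a} (Icc a b) ∧ HIso k f {b} (Icc a b)) :
    HIso k f {d} (Icc d (d + δ)) := by
  obtain ⟨N, G, hN, hdiag, hG, hGN⟩ := hX.exists_short_paths hf (half_pos hδ)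
  obtain ⟨s, hs, hsδ, hsN⟩ := hP.exists_mem hf hN hdiag (half_pos hδ)
  have hsub : Icc d (d + s) ⊆ Icc d (d + δ) := Icc_subset_Icc_right (by linarith)
  -- shrinking the slab does not change its homology, by excision
  have hshrink : HIso k f (Icc d (d + s)) (Icc d (d + δ)) := by
    refine HIso.excision hf (B := Icc (d + s / 2) (d + δ)) (isOpen_Iio (a := d + s))
      (isOpen_Ioi (a := d + s / 2)) (fun x _ => ?_)
      (fun x hx => ⟨hx.1.1, hx.2.le⟩) (fun x hx => ⟨hx.2.le, hx.1.2⟩) hsub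
      (Icc_subset_Icc_left (by linarith)) ?_
    · rcases lt_or_ge x (d + s) with h | h
      · exact Or.inl h
      · exact Or.inr (show d + s / 2 < x by linarith)
    · have : Icc d (d + s) ∩ Icc (d + s / 2) (d + δ) = Icc (d + s / 2) (d + s) := by
        rw [Icc_inter_Icc, sup_of_le_right (by linarith), inf_of_le_left (by linarith)]
      rw [this]
      exact (hreg (d + s / 2) (d + s) (by linarith) (by linarith) (by linarith)).1.of_left
        (hreg (d + s / 2) (d + δ) (by linarith) (by linarith) le_rfl).1
        (Icc_subset_Icc_right (by linarith))
  have hd : ({d} : Set ℝ) ⊆ Icc d (d + δ) := singleton_subset_iff.2 ⟨le_rfl, by linarith⟩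
  have hPc : ∀ b, b ≤ d + ε → ContinuousOn P (f ⁻¹' Icc d b) := fun b hb =>
    hP.continuousOn.mono fun x hx => show f x ≤ d + ε from hx.2.trans hb
  let r : C(f ⁻¹' Icc d (d + δ), f ⁻¹' {d}) := levelMap P (hPc _ (by linarith))
    fun x hx => hP.level x hx.1 (by linarith [hx.2])
  let r' : C(f ⁻¹' Icc d (d + s), f ⁻¹' {d}) := levelMap P (hPc _ (by linarith))
    fun x hx => hP.level x hx.1 (by linarith [hx.2])
  refine ⟨hd, fun n => ⟨fun x y hxy => ?_, fun c => ?_⟩⟩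
  · have h1 : r.comp (inclMap (preimage_mono hd)) = ContinuousMap.id _ := by
      refine ContinuousMap.ext fun x => Subtype.ext ?_
      exact hP.eq_self x (le_of_eq x.2)
    have h2 : ∀ z : H k n f {d}, SHmap k n r (inclH k n f hd z) = z := fun z => by
      rw [inclH_eq, ← SHmap_comp, h1, SHmap_id]
    rw [← h2 x, ← h2 y, hxy]
  · obtain ⟨c', rfl⟩ := (hshrink.2 n).2 c
    refine ⟨SHmap k n r' c', ?_⟩
    rw [inclH_eq, inclH_eq, ← SHmap_comp]
    refine LinearMap.congr_fun (SHmap_eq_of_homotopic k n (ContinuousMap.Homotopic.symm ?_)) c'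
    have hxN : ∀ x : f ⁻¹' Icc d (d + s), ((x : X), P x) ∈ N := fun x =>
      hsN x x.2.1 x.2.2 (by linarith [x.2.2])
    have hlow : ∀ p : unitInterval × f ⁻¹' Icc d (d + s),
        |f (G (p.1, (↑p.2, P p.2))) - f p.2| < δ / 2 := fun p => (hGN _ (hxN p.2)).2.2 p.1
    have hpos : ∀ p : unitInterval × f ⁻¹' Icc d (d + s),
        f (Q (G (p.1, (↑p.2, P p.2)))) ∈ Icc d (d + δ) := by
      intro p
      have h1 := abs_lt.1 (hlow p)
      have h2 := p.2.2
      rcases le_total d (f (G (p.1, (↑p.2, P p.2)))) with h | h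
      · rw [hQ.eq_self _ h]
        exact ⟨h, by linarith [h2.2, h1.2]⟩
      · rw [hQ.level _ (by linarith [h2.1, h1.1]) h]
        exact ⟨le_rfl, by linarith⟩
    refine ⟨⟨⟨fun p => ⟨Q (G (p.1, (↑p.2, P p.2))), hpos p⟩, ?_⟩, fun x => ?_, fun x => ?_⟩⟩
    · refine Continuous.subtype_mk ?_ _
      refine hQ.continuousOn.comp_continuous ?_ fun p => ?_
      · refine hG.comp_continuous ?_ fun p => hxN p.2
        have : Continuous fun x : f ⁻¹' Icc d (d + s) => P x :=
          (hPc (d + s) (by linarith)).comp_continuous continuous_subtype_val fun x => x.2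
        exact continuous_fst.prodMk ((continuous_subtype_val.comp continuous_snd).prodMk
          (this.comp continuous_snd))
      · have h1 := abs_lt.1 (hlow p)
        have h2 := p.2.2
        change d - ε ≤ _
        linarith [h2.1, h1.1]
    · apply Subtype.ext
      change Q (G (0, (↑x, P x))) = x
      rw [(hGN _ (hxN x)).1, hQ.eq_self _ x.2.1]
    · apply Subtype.ext
      change Q (G (1, (↑x, P x))) = P x
      rw [(hGN _ (hxN x)).2.1, hQ.eq_self _ (hP.level x x.2.1 (by linarith [x.2.2])).ge]

end Critical

section Gluing

variable {k : Type u} [Field k] {X : Type v} [TopologicalSpace X] {f : X → ℝ}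

variable (k) in
/-- The map in homology induced by a continuous map between preimages of subsets of the line. -/
noncomputable def levelH (n : ℕ) {S T : Set ℝ} (r : C(f ⁻¹' S, f ⁻¹' T)) :
    H k n f S →ₗ[k] H k n f T := SHmap k n r

lemma levelH_levelH (n : ℕ) {S T U : Set ℝ} (r : C(f ⁻¹' S, f ⁻¹' T)) (q : C(f ⁻¹' T, f ⁻¹' U))
    (c : H k n f S) : levelH k n q (levelH k n r c) = levelH k n (q.comp r) c :=
  (SHmap_comp k n q r c).symm

lemma levelH_id (n : ℕ) {S : Set ℝ} (c : H k n f S) :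
    levelH k n (ContinuousMap.id (f ⁻¹' S)) c = c := SHmap_id k n c

lemma inclH_eq_levelH (n : ℕ) {S T : Set ℝ} (h : S ⊆ T) :
    inclH k n f h = levelH k n (inclMap (preimage_mono h : f ⁻¹' S ⊆ f ⁻¹' T)) := rfl

/-- A class below `d` which extends across the critical level `d` comes from the level `d`. -/
lemma inclH_collapse_below {d ε δ s : ℝ} {P Q : X → X} (hP : CollapsesAbove f d ε P)
    (hQ : CollapsesBelow f d ε Q) (hδ : 0 < δ) (hδε : δ ≤ ε) (hs : s ≤ d - δ)
    (hiso : HIso k f {d} (Icc (d - δ) d)) (r : C(f ⁻¹' Icc (d - δ) (d + δ), f ⁻¹' {d}))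
    (hr : ∀ x, (r x : X) = Q (P x)) (n : ℕ) (x : H k n f (Icc s d))
    (e : H k n f (Icc (d - δ) (d + δ))) (h1 : Icc s d ⊆ Icc s (d + δ))
    (h2 : Icc (d - δ) (d + δ) ⊆ Icc s (d + δ)) (h : inclH k n f h1 x = inclH k n f h2 e)
    (h3 : ({d} : Set ℝ) ⊆ Icc s d) : inclH k n f h3
      (levelH k n (S := Icc (d - δ) (d + δ)) (T := {d}) r e) = x := by
  have hPc : ∀ a, ContinuousOn P (f ⁻¹' Icc a (d + δ)) := fun a =>
    hP.continuousOn.mono fun x hx => show f x ≤ d + ε from hx.2.trans (by linarith)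
  have hPm : ∀ a, a ≤ d → ∀ x, f x ∈ Icc a (d + δ) → f (P x) ∈ Icc a d := fun a ha x hx => by
    rcases le_total (f x) d with hxd | hxd
    · rw [hP.eq_self x hxd]; exact ⟨hx.1, hxd⟩
    · rw [hP.level x hxd (hx.2.trans (by linarith))]; exact ⟨ha, le_rfl⟩
  let L : C(f ⁻¹' Icc s (d + δ), f ⁻¹' Icc s d) := levelMap P (hPc s) (hPm s (by linarith))
  let l : C(f ⁻¹' Icc (d - δ) (d + δ), f ⁻¹' Icc (d - δ) d) :=
    levelMap P (hPc (d - δ)) (hPm (d - δ) (by linarith))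
  let q : C(f ⁻¹' Icc (d - δ) d, f ⁻¹' {d}) := levelMap Q
    (hQ.continuousOn.mono fun x hx => show d - ε ≤ f x from le_trans (by linarith) hx.1)
    (fun x hx => hQ.level x (le_trans (by linarith) hx.1) hx.2)
  obtain ⟨h4, hbij⟩ := hiso
  have h5 : Icc (d - δ) d ⊆ Icc s d := Icc_subset_Icc_left hs
  have eL : L.comp (inclMap (preimage_mono h1)) = ContinuousMap.id _ := by
    refine ContinuousMap.ext fun x => Subtype.ext ?_
    exact hP.eq_self x x.2.2
  have el : L.comp (inclMap (preimage_mono h2)) = (inclMap (preimage_mono h5)).comp l := rfl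
  have eq1 : q.comp (inclMap (preimage_mono h4)) = ContinuousMap.id _ := by
    refine ContinuousMap.ext fun x => Subtype.ext ?_
    exact hQ.eq_self x (le_of_eq x.2.symm)
  have eq2 : q.comp l = r := ContinuousMap.ext fun x => Subtype.ext (hr x).symm
  obtain ⟨c, hc⟩ := (hbij n).2 (levelH k n l e)
  have hcr : levelH k n r e = c := by
    rw [← eq2, ← levelH_levelH, ← hc, inclH_eq_levelH, levelH_levelH, eq1, levelH_id]
  have hx : x = inclH k n f h5 (levelH k n l e) := by
    calc x = levelH k n L (inclH k n f h1 x) := by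
            rw [inclH_eq_levelH, levelH_levelH, eL, levelH_id]
      _ = _ := by rw [h, inclH_eq_levelH, levelH_levelH, el, ← levelH_levelH, inclH_eq_levelH]
  rw [hcr, hx, ← hc, inclH_inclH]

/-- A class above `d` which extends across the critical level `d` comes from the level `d`. -/
lemma inclH_collapse_above {d ε δ s : ℝ} {P Q : X → X} (hP : CollapsesAbove f d ε P)
    (hQ : CollapsesBelow f d ε Q) (hδ : 0 < δ) (hδε : δ ≤ ε) (hs : d + δ ≤ s)
    (hiso : HIso k f {d} (Icc d (d + δ))) (r : C(f ⁻¹' Icc (d - δ) (d + δ), f ⁻¹' {d}))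
    (hr : ∀ x, (r x : X) = P (Q x)) (n : ℕ) (x : H k n f (Icc d s))
    (e : H k n f (Icc (d - δ) (d + δ))) (h1 : Icc d s ⊆ Icc (d - δ) s)
    (h2 : Icc (d - δ) (d + δ) ⊆ Icc (d - δ) s) (h : inclH k n f h1 x = inclH k n f h2 e)
    (h3 : ({d} : Set ℝ) ⊆ Icc d s) : inclH k n f h3
      (levelH k n (S := Icc (d - δ) (d + δ)) (T := {d}) r e) = x := by
  have hQc : ∀ a, ContinuousOn Q (f ⁻¹' Icc (d - δ) a) := fun a =>
    hQ.continuousOn.mono fun x hx => show d - ε ≤ f x from le_trans (by linarith) hx.1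
  have hQm : ∀ a, d ≤ a → ∀ x, f x ∈ Icc (d - δ) a → f (Q x) ∈ Icc d a := fun a ha x hx => by
    rcases le_total d (f x) with hxd | hxd
    · rw [hQ.eq_self x hxd]; exact ⟨hxd, hx.2⟩
    · rw [hQ.level x (le_trans (by linarith) hx.1) hxd]; exact ⟨le_rfl, ha⟩
  let L : C(f ⁻¹' Icc (d - δ) s, f ⁻¹' Icc d s) := levelMap Q (hQc s) (hQm s (by linarith))
  let l : C(f ⁻¹' Icc (d - δ) (d + δ), f ⁻¹' Icc d (d + δ)) :=
    levelMap Q (hQc (d + δ)) (hQm (d + δ) (by linarith))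
  let q : C(f ⁻¹' Icc d (d + δ), f ⁻¹' {d}) := levelMap P
    (hP.continuousOn.mono fun x hx => show f x ≤ d + ε from hx.2.trans (by linarith))
    (fun x hx => hP.level x hx.1 (hx.2.trans (by linarith)))
  obtain ⟨h4, hbij⟩ := hiso
  have h5 : Icc d (d + δ) ⊆ Icc d s := Icc_subset_Icc_right hs
  have eL : L.comp (inclMap (preimage_mono h1)) = ContinuousMap.id _ := by
    refine ContinuousMap.ext fun x => Subtype.ext ?_
    exact hQ.eq_self x x.2.1
  have el : L.comp (inclMap (preimage_mono h2)) = (inclMap (preimage_mono h5)).comp l := rfl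
  have eq1 : q.comp (inclMap (preimage_mono h4)) = ContinuousMap.id _ := by
    refine ContinuousMap.ext fun x => Subtype.ext ?_
    exact hP.eq_self x (le_of_eq x.2)
  have eq2 : q.comp l = r := ContinuousMap.ext fun x => Subtype.ext (hr x).symm
  obtain ⟨c, hc⟩ := (hbij n).2 (levelH k n l e)
  have hcr : levelH k n r e = c := by
    rw [← eq2, ← levelH_levelH, ← hc, inclH_eq_levelH, levelH_levelH, eq1, levelH_id]
  have hx : x = inclH k n f h5 (levelH k n l e) := by
    calc x = levelH k n L (inclH k n f h1 x) := by
            rw [inclH_eq_levelH, levelH_levelH, eL, levelH_id]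
      _ = _ := by rw [h, inclH_eq_levelH, levelH_levelH, el, ← levelH_levelH, inclH_eq_levelH]
  rw [hcr, hx, ← hc, inclH_inclH]

end Gluing

/-! ### Consequences of tameness -/

section Tame

variable (k : Type u) [Field k] {X : Type v} [TopologicalSpace X] {f : X → ℝ} {N : ℕ}
  {t : Fin (N + 1) → ℝ}

lemma IsTame.exists_hTrivialOn (hf : IsTame f t) {p : ℝ} (hp : p ∉ range t) :
    ∃ ε > 0, HTrivialOn k f (Ioo (p - ε) (p + ε)) := by
  obtain ⟨ε, hε, h⟩ := hf.regular p hp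
  exact ⟨ε, hε, hTrivialOn_of_fiberwise h hf.continuous⟩

lemma IsTame.hIso_regular (hf : IsTame f t) {a b : ℝ} (hab : a ≤ b)
    (h : ∀ i, t i ∉ Icc a b) : HIso k f {a} (Icc a b) ∧ HIso k f {b} (Icc a b) :=
  hIso_Icc_of_locally hf.continuous hab fun p hp => hf.exists_hTrivialOn k (by
    rintro ⟨i, rfl⟩
    exact h i hp)

/-- There are no critical values close to a given number, except possibly this number. -/
lemma exists_isolated (t : Fin (N + 1) → ℝ) (d : ℝ) :
    ∃ δ > 0, ∀ i, t i ≠ d → δ < |t i - d| := by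
  classical
  have hfin : (range fun i : {i // t i ≠ d} => |t i - d|).Finite := finite_range _
  rcases isEmpty_or_nonempty {i // t i ≠ d} with h | h
  · exact ⟨1, one_pos, fun i hi => (h.false ⟨i, hi⟩).elim⟩
  · obtain ⟨i₀, h₀⟩ := Finite.exists_min (fun i : {i // t i ≠ d} => |t i - d|)
    have : 0 < |t i₀ - d| := abs_pos.2 (sub_ne_zero.2 i₀.2)
    exact ⟨|t i₀ - d| / 2, by linarith, fun i hi => by
      have h1 : |t i₀ - d| ≤ |t i - d| := h₀ ⟨i, hi⟩
      linarith⟩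

lemma IsTame.exists_collapses (hf : IsTame f t) (i : Fin (N + 1)) :
    ∃ ε > 0, ∃ P Q, CollapsesAbove f (t i) ε P ∧ CollapsesBelow f (t i) ε Q := by
  obtain ⟨ε, hε, h1, h2⟩ := hf.critical i
  obtain ⟨P, hP⟩ := exists_collapsesAbove hf.continuous hε h1
  obtain ⟨Q, hQ⟩ := exists_collapsesBelow hf.continuous hε h2
  exact ⟨ε, hε, P, Q, hP, hQ⟩

lemma HIso.neg {S T : Set ℝ} (h : HIso k (fun x => -f x) S T) :
    HIso k f (Neg.neg ⁻¹' S) (Neg.neg ⁻¹' T) := by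
  obtain ⟨h1, h2⟩ := h
  exact ⟨preimage_mono h1, h2⟩

lemma HIso.neg' {S T : Set ℝ} (h : HIso k f (Neg.neg ⁻¹' S) (Neg.neg ⁻¹' T)) (hST : S ⊆ T) :
    HIso k (fun x => -f x) S T := by
  obtain ⟨h1, h2⟩ := h
  exact ⟨hST, h2⟩

/-- Just below a critical level the homology is that of the critical level. This is the mirror
image of `hIso_Icc_right`, obtained by replacing `f` with `-f`. -/
lemma hIso_Icc_left [CompactSpace X] (hX : IsANR X) (hf : Continuous f) {d ε δ : ℝ}
    {P Q : X → X} (hP : CollapsesAbove f d ε P) (hQ : CollapsesBelow f d ε Q) (hδ : 0 < δ)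
    (hδε : δ ≤ ε)
    (hreg : ∀ a b, d - δ ≤ a → a ≤ b → b < d →
      HIso k f {a} (Icc a b) ∧ HIso k f {b} (Icc a b)) :
    HIso k f {d} (Icc (d - δ) d) := by
  have e1 : ∀ c : ℝ, (Neg.neg ⁻¹' {c} : Set ℝ) = {-c} := fun c => by
    rw [Set.neg_preimage, Set.neg_singleton]
  have e2 : ∀ a b : ℝ, (Neg.neg ⁻¹' Icc a b : Set ℝ) = Icc (-b) (-a) := fun a b => by
    rw [Set.neg_preimage, Set.neg_Icc]
  have := hIso_Icc_right (k := k) hX hf.neg hQ.neg hP.neg' hδ hδε (fun a b h1 h2 h3 => by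
    have h4 := hreg (-b) (-a) (by linarith) (by linarith) (by linarith)
    refine ⟨HIso.neg' k ?_ (by simpa using h2), HIso.neg' k ?_ (by simpa using h2)⟩
    · rw [e1, e2]; exact h4.2
    · rw [e1, e2]; exact h4.1)
  have h5 := HIso.neg k this
  rw [e1, e2] at h5
  convert h5 using 2 <;> ring

lemma IsTame.hIso_right_small (hf : IsTame f t) (i : Fin (N + 1)) {ε δ : ℝ} {P Q : X → X}
    (hP : CollapsesAbove f (t i) ε P) (hQ : CollapsesBelow f (t i) ε Q)
    (hδ : 0 < δ) (hδε : δ ≤ ε) (hcrit : ∀ j, t j ∉ Ioc (t i) (t i + δ)) :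
    HIso k f {t i} (Icc (t i) (t i + δ)) := by
  have := hf.compact
  exact hIso_Icc_right hf.anr hf.continuous hP hQ hδ hδε fun a b h1 h2 h3 =>
    hf.hIso_regular k h2 fun j hj => hcrit j ⟨h1.trans_le hj.1, hj.2.trans h3⟩

lemma IsTame.hIso_left_small (hf : IsTame f t) (i : Fin (N + 1)) {ε δ : ℝ} {P Q : X → X}
    (hP : CollapsesAbove f (t i) ε P) (hQ : CollapsesBelow f (t i) ε Q)
    (hδ : 0 < δ) (hδε : δ ≤ ε) (hcrit : ∀ j, t j ∉ Ico (t i - δ) (t i)) :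
    HIso k f {t i} (Icc (t i - δ) (t i)) := by
  have := hf.compact
  exact hIso_Icc_left k hf.anr hf.continuous hP hQ hδ hδε fun a b h1 h2 h3 =>
    hf.hIso_regular k h2 fun j hj => hcrit j ⟨h1.trans hj.1, hj.2.trans_lt h3⟩

lemma hIso_refl (S : Set ℝ) : HIso k f S S :=
  ⟨subset_rfl, fun n => by
    have : ⇑(inclH k n f (subset_rfl : S ⊆ S)) = id := funext fun c => inclH_self k f n _ c
    rw [this]
    exact Function.bijective_id⟩

/-- If there are no critical values in `(s, s']`, the slab `[s, s']` has the homology of the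
level `s`. -/
lemma IsTame.hIso_up (hf : IsTame f t) {s s' : ℝ} (h : s ≤ s') (hc : ∀ i, t i ∉ Ioc s s') :
    HIso k f {s} (Icc s s') := by
  rcases h.eq_or_lt with rfl | hlt
  · rw [Icc_self]; exact hIso_refl k _
  by_cases hs : s ∈ range t
  · obtain ⟨i, rfl⟩ := hs
    obtain ⟨ε, hε, P, Q, hP, hQ⟩ := hf.exists_collapses i
    set δ := min ε (s' - t i) with hδ
    have hδ0 : 0 < δ := lt_min hε (by linarith)
    have hδs : t i + δ ≤ s' := by have := min_le_right ε (s' - t i); linarith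
    refine (hf.hIso_right_small k i hP hQ hδ0 (min_le_left _ _)
      fun j hj => hc j ⟨hj.1, hj.2.trans hδs⟩).trans ?_
    -- the remaining slab is regular and can be cut off by excision
    refine HIso.excision hf.continuous (B := Icc (t i + δ / 2) s') (isOpen_Iio (a := t i + δ))
      (isOpen_Ioi (a := t i + δ / 2)) (fun x _ => ?_)
      (fun x hx => ⟨hx.1.1, hx.2.le⟩) (fun x hx => ⟨hx.2.le, hx.1.2⟩) (Icc_subset_Icc_right hδs)
      (Icc_subset_Icc_left (by linarith)) ?_
    · rcases lt_or_ge x (t i + δ) with h | h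
      · exact Or.inl h
      · exact Or.inr (show t i + δ / 2 < x by linarith)
    · have : Icc (t i) (t i + δ) ∩ Icc (t i + δ / 2) s' = Icc (t i + δ / 2) (t i + δ) := by
        rw [Icc_inter_Icc, sup_of_le_right (by linarith), inf_of_le_left (by linarith)]
      rw [this]
      refine (hf.hIso_regular k (by linarith) fun j hj => hc j ⟨?_, ?_⟩).1.of_left
        (hf.hIso_regular k (by linarith) fun j hj => hc j ⟨?_, ?_⟩).1 (Icc_subset_Icc_right hδs)
      all_goals linarith [hj.1, hj.2]
  · refine (hf.hIso_regular k h fun i hi => ?_).1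
    exact hc i ⟨lt_of_le_of_ne hi.1 fun h => hs ⟨i, h.symm⟩, hi.2⟩

/-- If there are no critical values in `[s, s')`, the slab `[s, s']` has the homology of the
level `s'`. -/
lemma IsTame.hIso_down (hf : IsTame f t) {s s' : ℝ} (h : s ≤ s') (hc : ∀ i, t i ∉ Ico s s') :
    HIso k f {s'} (Icc s s') := by
  rcases h.eq_or_lt with rfl | hlt
  · rw [Icc_self]; exact hIso_refl k _
  by_cases hs : s' ∈ range t
  · obtain ⟨i, rfl⟩ := hs
    obtain ⟨ε, hε, P, Q, hP, hQ⟩ := hf.exists_collapses i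
    set δ := min ε (t i - s) with hδ
    have hδ0 : 0 < δ := lt_min hε (by linarith)
    have hδs : s ≤ t i - δ := by have := min_le_right ε (t i - s); linarith
    refine (hf.hIso_left_small k i hP hQ hδ0 (min_le_left _ _)
      fun j hj => hc j ⟨hδs.trans hj.1, hj.2⟩).trans ?_
    refine HIso.excision hf.continuous (B := Icc s (t i - δ / 2)) (isOpen_Ioi (a := t i - δ))
      (isOpen_Iio (a := t i - δ / 2)) (fun x _ => ?_)
      (fun x hx => ⟨hx.2.le, hx.1.2⟩) (fun x hx => ⟨hx.1.1, hx.2.le⟩) (Icc_subset_Icc_left hδs)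
      (Icc_subset_Icc_right (by linarith)) ?_
    · rcases lt_or_ge (t i - δ) x with h | h
      · exact Or.inl h
      · exact Or.inr (show x < t i - δ / 2 by linarith)
    · have : Icc (t i - δ) (t i) ∩ Icc s (t i - δ / 2) = Icc (t i - δ) (t i - δ / 2) := by
        rw [Icc_inter_Icc, sup_of_le_left (by linarith), inf_of_le_right (by linarith)]
      rw [this]
      refine (hf.hIso_regular k (by linarith) fun j hj => hc j ⟨?_, ?_⟩).2.of_left
        (hf.hIso_regular k (by linarith) fun j hj => hc j ⟨?_, ?_⟩).2 (Icc_subset_Icc_left hδs)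
      all_goals linarith [hj.1, hj.2]
  · refine (hf.hIso_regular k h fun i hi => ?_).2
    exact hc i ⟨hi.1, lt_of_le_of_ne hi.2 fun h => hs ⟨i, h⟩⟩

/-- Mayer-Vietoris exactness for a slab cut along a level. -/
lemma IsTame.exists_level (hf : IsTame f t) {s d s' : ℝ} (hsd : s ≤ d) (hds : d ≤ s') (n : ℕ)
    (x : H k n f (Icc s d)) (y : H k n f (Icc d s'))
    (hxy : inclH k n f (Icc_subset_Icc_right hds : Icc s d ⊆ Icc s s') x =
      inclH k n f (Icc_subset_Icc_left hsd : Icc d s' ⊆ Icc s s') y) :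
    ∃ e : H k n f {d}, down k n f hsd e = x ∧ up k n f hds e = y := by
  rcases hsd.eq_or_lt with rfl | hsd'
  · obtain ⟨h1, h2⟩ := hf.hIso_down k (le_refl s) (by simp)
    obtain ⟨e, rfl⟩ := (h2 n).2 x
    refine ⟨e, rfl, ?_⟩
    rw [inclH_inclH, inclH_self] at hxy
    exact hxy
  rcases hds.eq_or_lt with rfl | hds'
  · obtain ⟨h1, h2⟩ := hf.hIso_up k (le_refl d) (by simp)
    obtain ⟨e, rfl⟩ := (h2 n).2 y
    refine ⟨e, ?_, rfl⟩
    rw [inclH_inclH, inclH_self] at hxy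
    exact hxy.symm
  obtain ⟨δ₀, hδ₀, hiso⟩ := exists_isolated t d
  -- thicken the two slabs to an interior cover
  have cut : ∀ δ, 0 < δ → s ≤ d - δ → d + δ ≤ s' → ∃ e : H k n f (Icc (d - δ) (d + δ)),
      (∀ h1 h2, inclH k n f (S := Icc s d) (T := Icc s (d + δ)) h1 x = inclH k n f h2 e) ∧
      (∀ h1 h2, inclH k n f (S := Icc d s') (T := Icc (d - δ) s') h1 y = inclH k n f h2 e) := by
    intro δ hδ h1 h2
    obtain ⟨e, he1, he2⟩ := exists_of_inclH_eq hf.continuous (A := Icc s (d + δ))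
      (B := Icc (d - δ) s') (T := Icc s s') (isOpen_Iio (a := d + δ)) (isOpen_Ioi (a := d - δ))
      (fun x _ => by
        rcases lt_or_ge x (d + δ) with h | h
        · exact Or.inl h
        · exact Or.inr (show d - δ < x by linarith))
      (fun x hx => ⟨hx.1.1, hx.2.le⟩) (fun x hx => ⟨hx.2.le, hx.1.2⟩)
      (Icc_subset_Icc_right h2) (Icc_subset_Icc_left h1) n
      (inclH k n f (Icc_subset_Icc_right (by linarith)) x)
      (inclH k n f (Icc_subset_Icc_left (by linarith)) y) (by
        rw [inclH_inclH, inclH_inclH]; exact hxy)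
    have hint : Icc s (d + δ) ∩ Icc (d - δ) s' ⊆ Icc (d - δ) (d + δ) :=
      fun z hz => ⟨hz.2.1, hz.1.2⟩
    refine ⟨inclH k n f hint e, fun _ _ => ?_, fun _ _ => ?_⟩
    · rw [inclH_inclH]; exact he1.symm
    · rw [inclH_inclH]; exact he2.symm
  by_cases hd : d ∈ range t
  · obtain ⟨i, rfl⟩ := hd
    obtain ⟨ε, hε, P, Q, hP, hQ⟩ := hf.exists_collapses i
    obtain ⟨δ, hδ, hδ1, hδ2, hδ3, hδ4⟩ : ∃ δ > 0, δ ≤ ε ∧ δ ≤ δ₀ ∧ s ≤ t i - δ ∧ t i + δ ≤ s' := by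
      refine ⟨min (min ε δ₀) (min (t i - s) (s' - t i)), ?_, ?_, ?_, ?_, ?_⟩
      · exact lt_min (lt_min hε hδ₀) (lt_min (by linarith) (by linarith))
      · exact (min_le_left _ _).trans (min_le_left _ _)
      · exact (min_le_left _ _).trans (min_le_right _ _)
      · have := (min_le_right (min ε δ₀) (min (t i - s) (s' - t i))).trans (min_le_left _ _)
        linarith
      · have := (min_le_right (min ε δ₀) (min (t i - s) (s' - t i))).trans (min_le_right _ _)
        linarith
    obtain ⟨e, he1, he2⟩ := cut δ hδ hδ3 hδ4
    have isoU := hf.hIso_right_small k i hP hQ hδ hδ1 fun j hj => by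
      have h1 := hiso j hj.1.ne'
      rw [abs_of_pos (by linarith [hj.1])] at h1
      linarith [hj.2]
    have isoD := hf.hIso_left_small k i hP hQ hδ hδ1 fun j hj => by
      have h1 := hiso j hj.2.ne
      rw [abs_of_neg (by linarith [hj.2])] at h1
      linarith [hj.1]
    have hP1 : ∀ x, f x ∈ Icc (t i - δ) (t i + δ) → f (P x) ∈ Icc (t i - δ) (t i) := by
      intro x hx
      rcases le_total (f x) (t i) with hxd | hxd
      · rw [hP.eq_self x hxd]; exact ⟨hx.1, hxd⟩
      · rw [hP.level x hxd (hx.2.trans (by linarith))]; exact ⟨by linarith, le_rfl⟩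
    let r : C(f ⁻¹' Icc (t i - δ) (t i + δ), f ⁻¹' {t i}) := levelMap (Q ∘ P)
      (hQ.continuousOn.comp
        (hP.continuousOn.mono fun x hx => show f x ≤ t i + ε from hx.2.trans (by linarith))
        fun x hx => show t i - ε ≤ f (P x) from le_trans (by linarith) (hP1 x hx).1)
      (fun x hx => hQ.level _ (le_trans (by linarith) (hP1 x hx).1) (hP1 x hx).2)
    refine ⟨levelH k n r e, ?_, ?_⟩
    · exact inclH_collapse_below hP hQ hδ hδ1 hδ3 isoD r (fun _ => rfl) n x e _ _
        (he1 (Icc_subset_Icc_right (by linarith)) (Icc_subset_Icc_left hδ3)) _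
    · refine inclH_collapse_above hP hQ hδ hδ1 hδ4 isoU r (fun x => ?_) n y e _ _
        (he2 (Icc_subset_Icc_left (by linarith)) (Icc_subset_Icc_right hδ4)) _
      change Q (P x) = P (Q x)
      rcases le_total (f x) (t i) with hxd | hxd
      · rw [hP.eq_self x hxd, hP.eq_self _ (hQ.level x (by linarith [x.2.1]) hxd).le]
      · rw [hQ.eq_self x hxd, hQ.eq_self _ (hP.level x hxd (by linarith [x.2.2])).ge]
  · obtain ⟨δ, hδ, hδ2, hδ3, hδ4⟩ : ∃ δ > 0, δ ≤ δ₀ ∧ s ≤ d - δ ∧ d + δ ≤ s' := by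
      refine ⟨min δ₀ (min (d - s) (s' - d)), ?_, min_le_left _ _, ?_, ?_⟩
      · exact lt_min hδ₀ (lt_min (by linarith) (by linarith))
      · have := (min_le_right δ₀ (min (d - s) (s' - d))).trans (min_le_left _ _)
        linarith
      · have := (min_le_right δ₀ (min (d - s) (s' - d))).trans (min_le_right _ _)
        linarith
    obtain ⟨e, he1, he2⟩ := cut δ hδ hδ3 hδ4
    have hreg : ∀ j, t j ∉ Icc (d - δ) (d + δ) := fun j hj => by
      have h1 := hiso j fun h => hd ⟨j, h⟩
      have h2 : |t j - d| ≤ δ := abs_le.2 ⟨by linarith [hj.1], by linarith [hj.2]⟩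
      linarith
    have i1 : HIso k f {d} (Icc (d - δ) d) := hf.hIso_down k (by linarith) fun j hj =>
      hreg j ⟨hj.1, by linarith [hj.2]⟩
    have i2 : HIso k f {d} (Icc d (d + δ)) := hf.hIso_up k (by linarith) fun j hj =>
      hreg j ⟨by linarith [hj.1], hj.2⟩
    have i3 : HIso k f (Icc (d - δ) d) (Icc (d - δ) (d + δ)) :=
      (hf.hIso_up k (by linarith) fun j hj => hreg j ⟨hj.1.le, by linarith [hj.2]⟩).of_left
        (hf.hIso_up k (by linarith) fun j hj => hreg j ⟨hj.1.le, hj.2⟩)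
        (Icc_subset_Icc_right (by linarith))
    have i4 : HIso k f (Icc d (d + δ)) (Icc (d - δ) (d + δ)) :=
      (hf.hIso_down k (by linarith) fun j hj => hreg j ⟨by linarith [hj.1], hj.2.le⟩).of_left
        (hf.hIso_down k (by linarith) fun j hj => hreg j ⟨hj.1, hj.2.le⟩)
        (Icc_subset_Icc_left (by linarith))
    have i5 : HIso k f (Icc s d) (Icc s (d + δ)) := by
      refine HIso.excision hf.continuous (B := Icc (d - δ) (d + δ)) (isOpen_Iio (a := d))
        (isOpen_Ioi (a := d - δ)) (fun x _ => ?_) (fun x hx => ⟨hx.1.1, hx.2.le⟩)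
        (fun x hx => ⟨hx.2.le, hx.1.2⟩) (Icc_subset_Icc_right (by linarith))
        (Icc_subset_Icc_left hδ3) ?_
      · rcases lt_or_ge x d with h | h
        · exact Or.inl h
        · exact Or.inr (show d - δ < x by linarith)
      · rw [Icc_inter_Icc, sup_of_le_right hδ3, inf_of_le_left (by linarith)]
        exact i3
    have i6 : HIso k f (Icc d s') (Icc (d - δ) s') := by
      refine HIso.excision hf.continuous (B := Icc (d - δ) (d + δ)) (isOpen_Ioi (a := d))
        (isOpen_Iio (a := d + δ)) (fun x _ => ?_) (fun x hx => ⟨hx.2.le, hx.1.2⟩)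
        (fun x hx => ⟨hx.1.1, hx.2.le⟩) (Icc_subset_Icc_left (by linarith))
        (Icc_subset_Icc_right hδ4) ?_
      · rcases lt_or_ge d x with h | h
        · exact Or.inl h
        · exact Or.inr (show x < d + δ by linarith)
      · rw [Icc_inter_Icc, sup_of_le_left (by linarith), inf_of_le_right hδ4]
        exact i4
    obtain ⟨h7, h8⟩ := i1.trans i3
    obtain ⟨c, rfl⟩ := (h8 n).2 e
    obtain ⟨h9, h10⟩ := i5
    obtain ⟨h11, h12⟩ := i6
    refine ⟨c, (h10 n).1 ?_, (h12 n).1 ?_⟩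
    · rw [he1 h9 (Icc_subset_Icc_left hδ3), down, inclH_inclH, inclH_inclH]
    · rw [he2 h11 (Icc_subset_Icc_right hδ4), up, inclH_inclH, inclH_inclH]

/-- Levels outside the range of the function have no homology. -/
lemma IsTame.eq_zero_of_notMem (hf : IsTame f t) {s : ℝ} (hs : s ∉ Icc (t 0) (t (Fin.last N)))
    (n : ℕ) (c : H k n f {s}) : c = 0 := by
  obtain ⟨z, hz⟩ := exists_rep (A := f ⁻¹' {s}) c
  have hz0 : z = 0 := by
    refine map_mem_of_mem_chainsIn LinearMap.id (⊥ : Submodule k (Chain k n X))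
      (fun σ hσ a => ?_) hz.mem
    have p : stdSimplex ℝ (Fin (n + 1)) := Classical.arbitrary _
    have h : f (σ p) = s := hσ p
    exact (hs ⟨h ▸ hf.isLeast.2 (mem_range_self _), h ▸ hf.isGreatest.2 (mem_range_self _)⟩).elim
  exact hz.eq_zero_iff.2 ⟨0, zero_mem _, by rw [map_zero, hz0]⟩

end Tame

/-! ### Intervals as bars -/

namespace Bar

lemma mem_toSet_iff (J : Bar) (s : ℝ) : s ∈ J.toSet ↔
    (J.left < s ∨ J.LeftClosed ∧ J.left = s) ∧ (s < J.right ∨ J.RightClosed ∧ s = J.right) := by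
  cases J <;> simp [toSet, left, right, LeftClosed, RightClosed, le_iff_lt_or_eq]

lemma ordConnected_toSet (J : Bar) : J.toSet.OrdConnected := by
  cases J <;> simp only [toSet] <;> infer_instance

lemma left_le {J : Bar} {s : ℝ} (h : s ∈ J.toSet) : J.left ≤ s := by
  rcases ((J.mem_toSet_iff s).1 h).1 with h | h
  exacts [h.le, h.2.le]

lemma le_right {J : Bar} {s : ℝ} (h : s ∈ J.toSet) : s ≤ J.right := by
  rcases ((J.mem_toSet_iff s).1 h).2 with h | h
  exacts [h.le, h.2.le]

/-- The bar has an open right end at or below the level `s`. -/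
def EndsBy (J : Bar) (s : ℝ) : Prop := ¬ J.RightClosed ∧ J.right ≤ s

/-- The bar has an open left end at or above the level `s`. -/
def StartsAfter (J : Bar) (s : ℝ) : Prop := ¬ J.LeftClosed ∧ s ≤ J.left

lemma EndsBy.notMem {J : Bar} {s : ℝ} (h : J.EndsBy s) : s ∉ J.toSet := fun hs => by
  rcases ((J.mem_toSet_iff s).1 hs).2 with h1 | h1
  exacts [h.2.not_gt h1, h.1 h1.1]

end Bar

/-! ### Classes agreeing on a slab -/

section Glue

variable {k : Type u} [Field k] {X : Type v} [TopologicalSpace X] {f : X → ℝ}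
  {N : ℕ} {t : Fin (N + 1) → ℝ}

variable (k) in
lemma IsTame.up_injective (hf : IsTame f t) (r : ℕ) {s s' : ℝ} (h : s ≤ s')
    (hc : ∀ i, t i ∉ Ioc s s') : Function.Injective (up k r f h) := by
  obtain ⟨_, h2⟩ := hf.hIso_up k h hc
  exact (h2 r).1

variable (k) in
lemma IsTame.down_injective (hf : IsTame f t) (r : ℕ) {s s' : ℝ} (h : s ≤ s')
    (hc : ∀ i, t i ∉ Ico s s') : Function.Injective (down k r f h) := by
  obtain ⟨_, h2⟩ := hf.hIso_down k h hc
  exact (h2 r).1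

lemma up_eq_down_trans {r : ℕ} {s d s' : ℝ} (hsd : s ≤ d) (hds : d ≤ s') {x : H k r f {s}}
    {e : H k r f {d}} {y : H k r f {s'}} (h1 : up k r f hsd x = down k r f hsd e)
    (h2 : up k r f hds e = down k r f hds y) :
    up k r f (hsd.trans hds) x = down k r f (hsd.trans hds) y := by
  have h3 := congrArg (inclH k r f (Icc_subset_Icc_right hds : Icc s d ⊆ Icc s s')) h1
  have h4 := congrArg (inclH k r f (Icc_subset_Icc_left hsd : Icc d s' ⊆ Icc s s')) h2
  rw [up, down, inclH_inclH, inclH_inclH] at h3 h4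
  exact h3.trans h4

/-- Classes at two levels which agree on the slab between them factor through every level in
between. -/
lemma IsTame.exists_between (hf : IsTame f t) {r : ℕ} {s d s' : ℝ} (hsd : s ≤ d) (hds : d ≤ s')
    {x : H k r f {s}} {y : H k r f {s'}}
    (h : up k r f (hsd.trans hds) x = down k r f (hsd.trans hds) y) :
    ∃ e : H k r f {d}, up k r f hsd x = down k r f hsd e ∧
      up k r f hds e = down k r f hds y := by
  obtain ⟨e, h1, h2⟩ := hf.exists_level k hsd hds r (up k r f hsd x) (down k r f hds y) (by
    rw [up, down, inclH_inclH, inclH_inclH]; exact h)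
  exact ⟨e, h1.symm, h2⟩

/-- To prove a property of all pairs of levels `s ≤ s'` which can be concatenated, it is enough to
consider pairs without critical values in `(s, s']` and without critical values in `[s, s')`. -/
lemma level_induction (t : Fin (N + 1) → ℝ) {P : ∀ s s' : ℝ, s ≤ s' → Prop}
    (h1 : ∀ s s' h, (∀ i, t i ∉ Ioc s s') → P s s' h)
    (h2 : ∀ s s' h, (∀ i, t i ∉ Ico s s') → P s s' h)
    (h3 : ∀ s d s' hsd hds, P s d hsd → P d s' hds → P s s' (hsd.trans hds)) :
    ∀ s s' h, P s s' h := by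
  classical
  suffices H : ∀ n s s' h, (Finset.univ.filter fun i => t i ∈ Ioo s s').card = n → P s s' h from
    fun s s' h => H _ s s' h rfl
  intro n
  induction n using Nat.strong_induction_on with
  | _ n ih =>
    rintro s s' h rfl
    by_cases hex : ∃ i, t i ∈ Ioo s s'
    · obtain ⟨i, hi⟩ := hex
      refine h3 s (t i) s' hi.1.le hi.2.le (ih _ ?_ _ _ _ rfl) (ih _ ?_ _ _ _ rfl)
      · refine Finset.card_lt_card (Finset.ssubset_iff_subset_ne.2
          ⟨fun j hj => ?_, fun he => ?_⟩)
        · simp only [Finset.mem_filter, Finset.mem_univ, true_and] at hj ⊢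
          exact ⟨hj.1, hj.2.trans hi.2⟩
        · have : i ∈ Finset.univ.filter fun j => t j ∈ Ioo s (t i) := he ▸ by simpa using hi
          simp at this
      · refine Finset.card_lt_card (Finset.ssubset_iff_subset_ne.2
          ⟨fun j hj => ?_, fun he => ?_⟩)
        · simp only [Finset.mem_filter, Finset.mem_univ, true_and] at hj ⊢
          exact ⟨hi.1.trans hj.1, hj.2⟩
        · have : i ∈ Finset.univ.filter fun j => t j ∈ Ioo (t i) s' := he ▸ by simpa using hi
          simp at this
    · rcases h.eq_or_lt with rfl | hlt
      · exact h1 _ _ _ (by simp)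
      · refine h3 s ((s + s') / 2) s' (by linarith) (by linarith)
          (h1 _ _ _ fun i hi => hex ⟨i, hi.1, ?_⟩) (h2 _ _ _ fun i hi => hex ⟨i, ?_, hi.2⟩)
        · linarith [hi.2]
        · linarith [hi.1]

end Glue

/-! ### Families of classes along bars -/

/-- A system of bars carrying classes which form bases at all levels, agree along each bar and are
killed at the open ends. The remaining conditions on a system of bar codes follow from these for
tame maps. -/
structure PreBarcode (k : Type u) [Field k] (r : ℕ) {X : Type v} [TopologicalSpace X]
    (f : X → ℝ) {N : ℕ} (t : Fin (N + 1) → ℝ) (ι : Type w) where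
  bar : ι → Bar
  nonempty : ∀ b, (bar b).toSet.Nonempty
  left_mem : ∀ b, (bar b).left ∈ range t
  right_mem : ∀ b, (bar b).right ∈ range t
  cls : ι → ∀ s : ℝ, H k r f {s}
  linearIndependent : ∀ s : ℝ,
    LinearIndependent k (fun b : {b : ι // s ∈ (bar b).toSet} => cls b s)
  span_eq_top : ∀ s : ℝ,
    Submodule.span k (range (fun b : {b : ι // s ∈ (bar b).toSet} => cls b s)) = ⊤
  agree : ∀ (b : ι) (s s' : ℝ) (h : s ≤ s'), s ∈ (bar b).toSet → s' ∈ (bar b).toSet →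
    up k r f h (cls b s) = down k r f h (cls b s')
  killed_left : ∀ b, ¬ (bar b).LeftClosed → ∀ (s : ℝ) (h : (bar b).left ≤ s),
    s ∈ (bar b).toSet → down k r f h (cls b s) = 0
  killed_right : ∀ b, ¬ (bar b).RightClosed → ∀ (s : ℝ) (h : s ≤ (bar b).right),
    s ∈ (bar b).toSet → up k r f h (cls b s) = 0

namespace PreBarcode

variable {k : Type u} [Field k] {r : ℕ} {X : Type v} [TopologicalSpace X]
  {f : X → ℝ} {N : ℕ} {t : Fin (N + 1) → ℝ} {ι : Type w} (B : PreBarcode k r f t ι)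

/-- The bars which contain the level `s`. -/
def barsAt (s : ℝ) : Set ι := {b | s ∈ (B.bar b).toSet}

/-- The class at the level `s` with the given coefficients. -/
noncomputable def comb (s : ℝ) : (ι →₀ k) →ₗ[k] H k r f {s} :=
  Finsupp.linearCombination k fun b => B.cls b s

lemma comb_single (s : ℝ) (b : ι) : B.comb s (Finsupp.single b 1) = B.cls b s := by
  rw [comb, Finsupp.linearCombination_single, one_smul]

lemma comb_injOn (s : ℝ) {a a' : ι →₀ k} (ha : a ∈ Finsupp.supported k k (B.barsAt s))
    (ha' : a' ∈ Finsupp.supported k k (B.barsAt s)) (h : B.comb s a = B.comb s a') : a = a' := by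
  have h1 : LinearIndepOn k (fun b => B.cls b s) (B.barsAt s) := B.linearIndependent s
  exact linearIndepOn_iffₛ.1 h1 a ha a' ha' h

lemma exists_comb (s : ℝ) (c : H k r f {s}) :
    ∃ a ∈ Finsupp.supported k k (B.barsAt s), B.comb s a = c := by
  have h : c ∈ Submodule.span k ((fun b => B.cls b s) '' B.barsAt s) := by
    have h1 := B.span_eq_top s
    have h2 : range (fun b : {b : ι // s ∈ (B.bar b).toSet} => B.cls b s) =
        (fun b => B.cls b s) '' B.barsAt s := by
      rw [image_eq_range]; rfl
    rw [← h2, h1]; trivial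
  exact (Finsupp.mem_span_image_iff_linearCombination k).1 h

lemma up_eq_zero {s s' : ℝ} (h : s ≤ s') {b : ι} (hb : s ∈ (B.bar b).toSet)
    (he : (B.bar b).EndsBy s') : up k r f h (B.cls b s) = 0 := by
  have h1 : up k r f (Bar.le_right hb) (B.cls b s) = down k r f (Bar.le_right hb) 0 := by
    rw [B.killed_right b he.1 s _ hb, map_zero]
  rw [up_eq_down_trans (Bar.le_right hb) he.2 (y := 0) h1 (by rw [map_zero, map_zero]), map_zero]

lemma down_eq_zero {s s' : ℝ} (h : s ≤ s') {b : ι} (hb : s' ∈ (B.bar b).toSet)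
    (he : (B.bar b).StartsAfter s) : down k r f h (B.cls b s') = 0 := by
  have h1 : up k r f (Bar.left_le hb) 0 = down k r f (Bar.left_le hb) (B.cls b s') := by
    rw [B.killed_left b he.1 s' _ hb, map_zero]
  rw [← up_eq_down_trans he.2 (Bar.left_le hb) (x := 0) (by rw [map_zero, map_zero]) h1, map_zero]

/-- Classes at two levels which agree on the slab between the levels have the same coefficients
along the bars containing both levels, and other bars contribute only if they are killed at an
open end in the slab. -/
def Separates (s s' : ℝ) (h : s ≤ s') : Prop :=
  ∀ a ∈ Finsupp.supported k k (B.barsAt s), ∀ a' ∈ Finsupp.supported k k (B.barsAt s'),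
    up k r f h (B.comb s a) = down k r f h (B.comb s' a') → ∀ b,
      (s ∈ (B.bar b).toSet → s' ∈ (B.bar b).toSet → a b = a' b) ∧
      (a b ≠ 0 → s' ∉ (B.bar b).toSet → (B.bar b).EndsBy s') ∧
      (a' b ≠ 0 → s ∉ (B.bar b).toSet → (B.bar b).StartsAfter s)

lemma mem_of_supported {s : ℝ} {a : ι →₀ k} (ha : a ∈ Finsupp.supported k k (B.barsAt s)) {b : ι}
    (hb : a b ≠ 0) : s ∈ (B.bar b).toSet :=
  (Finsupp.mem_supported k a).1 ha (Finsupp.mem_support_iff.2 hb)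

lemma filter_mem_supported {s : ℝ} (p : ι → Prop) [DecidablePred p] {a : ι →₀ k}
    (h : ∀ b, p b → a b ≠ 0 → s ∈ (B.bar b).toSet) :
    a.filter p ∈ Finsupp.supported k k (B.barsAt s) := by
  refine (Finsupp.mem_supported k _).2 fun b hb => ?_
  rw [Finset.mem_coe, Finsupp.support_filter, Finset.mem_filter] at hb
  exact h b hb.2 (Finsupp.mem_support_iff.1 hb.1)

lemma comb_filter (s : ℝ) (p : ι → Prop) [DecidablePred p] (a : ι →₀ k) :
    B.comb s (a.filter p) = ∑ b ∈ a.support, if p b then a b • B.cls b s else 0 := by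
  rw [comb, Finsupp.linearCombination_apply, Finsupp.sum, Finsupp.support_filter,
    ← Finset.sum_filter]
  refine Finset.sum_congr rfl fun b hb => ?_
  rw [Finsupp.filter_apply_pos _ _ (Finset.mem_filter.1 hb).2]

lemma comb_eq_sum (s : ℝ) (a : ι →₀ k) : B.comb s a = ∑ b ∈ a.support, a b • B.cls b s := rfl

open Classical in
/-- Only the bars which contain `s'` contribute to the image of a class from the level `s`, provided
that all others end before `s'` with an open end. -/
lemma up_comb {s s' : ℝ} (h : s ≤ s') {a : ι →₀ k} (ha : a ∈ Finsupp.supported k k (B.barsAt s))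
    (he : ∀ b, a b ≠ 0 → s' ∉ (B.bar b).toSet → (B.bar b).EndsBy s') :
    up k r f h (B.comb s a) =
      down k r f h (B.comb s' (a.filter fun b => s' ∈ (B.bar b).toSet)) := by
  rw [comb_filter, comb_eq_sum, map_sum, map_sum]
  refine Finset.sum_congr rfl fun b hb => ?_
  have hb1 := Finsupp.mem_support_iff.1 hb
  have hb2 := B.mem_of_supported ha hb1
  split_ifs with h1
  · rw [map_smul, map_smul, B.agree b s s' h hb2 h1]
  · rw [map_smul, B.up_eq_zero h hb2 (he b hb1 h1), smul_zero, map_zero]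

open Classical in
/-- Only the bars which contain `s` contribute to the image of a class from the level `s'`, provided
that all others start after `s` with an open end. -/
lemma down_comb {s s' : ℝ} (h : s ≤ s') {a : ι →₀ k} (ha : a ∈ Finsupp.supported k k (B.barsAt s'))
    (he : ∀ b, a b ≠ 0 → s ∉ (B.bar b).toSet → (B.bar b).StartsAfter s) :
    down k r f h (B.comb s' a) =
      up k r f h (B.comb s (a.filter fun b => s ∈ (B.bar b).toSet)) := by
  rw [comb_filter, comb_eq_sum, map_sum, map_sum]
  refine Finset.sum_congr rfl fun b hb => ?_
  have hb1 := Finsupp.mem_support_iff.1 hb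
  have hb2 := B.mem_of_supported ha hb1
  split_ifs with h1
  · rw [map_smul, map_smul, B.agree b s s' h h1 hb2]
  · rw [map_smul, B.down_eq_zero h hb2 (he b hb1 h1), smul_zero, map_zero]

lemma separates_of_notMem_Ioc (hf : IsTame f t) (s s' : ℝ) (h : s ≤ s')
    (hc : ∀ i, t i ∉ Ioc s s') : B.Separates s s' h := by
  classical
  intro a ha a' ha' haa b
  have hst : ∀ b, s' ∈ (B.bar b).toSet → s ∉ (B.bar b).toSet → (B.bar b).StartsAfter s := by
    intro b hb hb'
    obtain ⟨i, hi⟩ := B.left_mem b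
    have h1 : (B.bar b).left ≤ s := not_lt.1 fun hlt =>
      hc i ⟨hi ▸ hlt, hi ▸ Bar.left_le hb⟩
    obtain ⟨h2, h3⟩ := (Bar.mem_toSet_iff _ _).1 hb
    have h4 : s < (B.bar b).right ∨ (B.bar b).RightClosed ∧ s = (B.bar b).right := by
      rcases h.eq_or_lt with rfl | hlt
      · exact h3
      · exact Or.inl (hlt.trans_le (Bar.le_right hb))
    have h5 : ¬ ((B.bar b).left < s ∨ (B.bar b).LeftClosed ∧ (B.bar b).left = s) := fun h5 =>
      hb' ((Bar.mem_toSet_iff _ _).2 ⟨h5, h4⟩)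
    push Not at h5
    exact ⟨fun hl => h5.2 hl (le_antisymm h1 h5.1), h5.1⟩
  rw [B.down_comb h ha' fun b hb => hst b (B.mem_of_supported ha' hb)] at haa
  have key := B.comb_injOn s ha (B.filter_mem_supported _ fun b hb _ => hb)
    (hf.up_injective k r h hc haa)
  have hab : s ∈ (B.bar b).toSet → a b = a' b := fun hb => by
    rw [key]; exact Finsupp.filter_apply_pos _ _ hb
  refine ⟨fun hb _ => hab hb, fun hb hb' => ?_, fun hb hb' => ?_⟩
  · rw [hab (B.mem_of_supported ha hb)] at hb
    exact (hb' (B.mem_of_supported ha' hb)).elim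
  · exact hst b (B.mem_of_supported ha' hb) hb'

lemma separates_of_notMem_Ico (hf : IsTame f t) (s s' : ℝ) (h : s ≤ s')
    (hc : ∀ i, t i ∉ Ico s s') : B.Separates s s' h := by
  classical
  intro a ha a' ha' haa b
  have hst : ∀ b, s ∈ (B.bar b).toSet → s' ∉ (B.bar b).toSet → (B.bar b).EndsBy s' := by
    intro b hb hb'
    obtain ⟨i, hi⟩ := B.right_mem b
    have h1 : s' ≤ (B.bar b).right := not_lt.1 fun hlt =>
      hc i ⟨hi ▸ Bar.le_right hb, hi ▸ hlt⟩
    obtain ⟨h2, h3⟩ := (Bar.mem_toSet_iff _ _).1 hb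
    have h4 : (B.bar b).left < s' ∨ (B.bar b).LeftClosed ∧ (B.bar b).left = s' := by
      rcases h.eq_or_lt with rfl | hlt
      · exact h2
      · exact Or.inl ((Bar.left_le hb).trans_lt hlt)
    have h5 : ¬ (s' < (B.bar b).right ∨ (B.bar b).RightClosed ∧ s' = (B.bar b).right) := fun h5 =>
      hb' ((Bar.mem_toSet_iff _ _).2 ⟨h4, h5⟩)
    push Not at h5
    exact ⟨fun hl => h5.2 hl (le_antisymm h1 h5.1), h5.1⟩
  rw [B.up_comb h ha fun b hb => hst b (B.mem_of_supported ha hb)] at haa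
  have key := B.comb_injOn s' (B.filter_mem_supported (a := a) _ fun b hb _ => hb) ha'
    (hf.down_injective k r h hc haa)
  have hab : s' ∈ (B.bar b).toSet → a b = a' b := fun hb => by
    rw [← key]; exact (Finsupp.filter_apply_pos _ a hb).symm
  refine ⟨fun _ hb => hab hb, fun hb hb' => ?_, fun hb hb' => ?_⟩
  · exact hst b (B.mem_of_supported ha hb) hb'
  · rw [← hab (B.mem_of_supported ha' hb)] at hb
    exact (hb' (B.mem_of_supported ha hb)).elim

/-- Separation of the bars holds on small slabs by injectivity of one of the two inclusions, and it
can be concatenated since classes agreeing on a slab factor through all levels in between. -/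
lemma separates (hf : IsTame f t) : ∀ s s' h, B.Separates s s' h := by
  refine level_induction t (B.separates_of_notMem_Ioc hf) (B.separates_of_notMem_Ico hf) ?_
  intro s d s' hsd hds h1 h2 a ha a' ha' haa b
  obtain ⟨e, he1, he2⟩ := hf.exists_between hsd hds haa
  obtain ⟨c, hc, rfl⟩ := B.exists_comb d e
  obtain ⟨h3, h4, h5⟩ := h1 a ha c hc he1 b
  obtain ⟨h6, h7, h8⟩ := h2 c hc a' ha' he2 b
  have hb := (B.bar b).ordConnected_toSet
  refine ⟨fun hs hs' => ?_, fun hs hs' => ?_, fun hs hs' => ?_⟩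
  · have hd := hb.out hs hs' ⟨hsd, hds⟩
    exact (h3 hs hd).trans (h6 hd hs')
  · by_cases hd : d ∈ (B.bar b).toSet
    · rw [h3 (B.mem_of_supported ha hs) hd] at hs
      exact h7 hs hs'
    · have h9 := h4 hs hd
      exact ⟨h9.1, h9.2.trans hds⟩
  · by_cases hd : d ∈ (B.bar b).toSet
    · rw [← h6 hd (B.mem_of_supported ha' hs)] at hs
      exact h5 hs hs'
    · have h9 := h8 hs hd
      exact ⟨h9.1, hsd.trans h9.2⟩

lemma single_mem_supported {s : ℝ} {b : ι} (hb : s ∈ (B.bar b).toSet) :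
    Finsupp.single b 1 ∈ Finsupp.supported k k (B.barsAt s) :=
  Finsupp.single_mem_supported k 1 hb

lemma up_ne_zero (hf : IsTame f t) {s s' : ℝ} (h : s ≤ s') {b : ι} (hb : s ∈ (B.bar b).toSet)
    (hb' : s' ∈ (B.bar b).toSet) : up k r f h (B.cls b s) ≠ 0 := fun h0 => by
  have := (B.separates hf s s' h _ (B.single_mem_supported hb) 0 (zero_mem _) (by
    rw [comb_single, h0, map_zero, map_zero]) b).1 hb hb'
  simp at this

lemma down_ne_zero (hf : IsTame f t) {s s' : ℝ} (h : s ≤ s') {b : ι} (hb : s ∈ (B.bar b).toSet)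
    (hb' : s' ∈ (B.bar b).toSet) : down k r f h (B.cls b s') ≠ 0 := by
  rw [← B.agree b s s' h hb hb']
  exact B.up_ne_zero hf h hb hb'

/-- For a tame map the conditions on death and detectability are automatic. -/
def toLevelBarcode (hf : IsTame f t) : LevelBarcode k r f t ι where
  bar := B.bar
  nonempty := B.nonempty
  left_mem := B.left_mem
  right_mem := B.right_mem
  cls := B.cls
  linearIndependent := B.linearIndependent
  span_eq_top := B.span_eq_top
  detect b s s' h hs hs' := ⟨B.agree b s s' h hs hs', B.up_ne_zero hf h hs hs'⟩
  dies_left b hb s hs := by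
    obtain ⟨h1, h2⟩ := (Bar.mem_toSet_iff _ _).1 hs
    have hlt : (B.bar b).left < s := h1.resolve_right fun h => hb h.1
    refine ⟨hlt, B.killed_left b hb s _ hs, fun q hq hlq => B.down_ne_zero hf _ ?_ hs⟩
    exact (Bar.mem_toSet_iff _ _).2 ⟨Or.inl hlq, Or.inl (hq.trans_le (Bar.le_right hs))⟩
  dies_right b hb s hs := by
    obtain ⟨h1, h2⟩ := (Bar.mem_toSet_iff _ _).1 hs
    have hlt : s < (B.bar b).right := h2.resolve_right fun h => hb h.1
    refine ⟨hlt, B.killed_right b hb s _ hs, fun q hq hlq => B.up_ne_zero hf _ hs ?_⟩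
    exact (Bar.mem_toSet_iff _ _).2 ⟨Or.inl ((Bar.left_le hs).trans_lt hq), Or.inl hlq⟩
  not_detectable_left b hb s hs s'' h hlt hd := by
    obtain ⟨-, x, hx⟩ := hd
    obtain ⟨a, ha, rfl⟩ := B.exists_comb s'' x
    refine ((B.separates hf s'' s h a ha _ (B.single_mem_supported hs) (by
      rw [hx, comb_single]) b).2.2 (by simp) fun hs'' => ?_).1 hb
    exact (Bar.left_le hs'').not_gt hlt
  not_detectable_right b hb s hs s' h hlt hd := by
    obtain ⟨-, y, hy⟩ := hd
    obtain ⟨a, ha, rfl⟩ := B.exists_comb s' y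
    refine ((B.separates hf s s' h _ (B.single_mem_supported hs) a ha (by
      rw [hy, comb_single]) b).2.1 (by simp) fun hs' => ?_).1 hb
    exact (Bar.le_right hs').not_gt hlt

end PreBarcode

/-- The underlying system of bars and classes. -/
def LevelBarcode.toPreBarcode {k : Type u} [Field k] {r : ℕ} {X : Type v} [TopologicalSpace X]
    {f : X → ℝ} {N : ℕ} {t : Fin (N + 1) → ℝ} {ι : Type w} (B : LevelBarcode k r f t ι) :
    PreBarcode k r f t ι where
  bar := B.bar
  nonempty := B.nonempty
  left_mem := B.left_mem
  right_mem := B.right_mem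
  cls := B.cls
  linearIndependent := B.linearIndependent
  span_eq_top := B.span_eq_top
  agree b s s' h hs hs' := (B.detect b s s' h hs hs').1
  killed_left b hb s _ hs := (B.dies_left b hb s hs).2.1
  killed_right b hb s _ hs := (B.dies_right b hb s hs).2.1

/-! ### Counting bars -/

section Counting

lemma dim_span_range {k : Type u} [Field k] {V : Type w} [AddCommGroup V] [Module k V]
    {κ : Type*} {v : κ → V} (hv : LinearIndependent k v) :
    dim k (Submodule.span k (range v)) = ENat.card κ := by
  rw [dim, rank_span hv]
  exact ENat.card_congr (Equiv.ofInjective v hv.injective).symm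

lemma dim_eq_encard {k : Type u} [Field k] {V : Type w} [AddCommGroup V] [Module k V]
    {ι : Type*} {v : ι → V} {S : Set ι} (hv : LinearIndepOn k v S) {W : Submodule k V}
    (hW : Submodule.span k (v '' S) = W) : dim k W = S.encard := by
  subst hW
  rw [image_eq_range]
  exact dim_span_range hv

/-- Counting the bars equal to one of finitely many distinct intervals. -/
lemma encard_eq_sum {ι α β : Type*} (bar : ι → β) (F : Finset α) (J : α → β)
    (hJ : Function.Injective J) :
    {b | ∃ p ∈ F, bar b = J p}.encard = ∑ p ∈ F, ENat.card {b // bar b = J p} := by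
  classical
  induction F using Finset.induction_on with
  | empty => simp
  | insert p F hp ih =>
    rw [Finset.sum_insert hp, ← ih]
    have h : {b | ∃ q ∈ insert p F, bar b = J q} =
        {b | bar b = J p} ∪ {b | ∃ q ∈ F, bar b = J q} := by
      ext b; simp
    rw [h, encard_union_eq]
    · rfl
    · refine Set.disjoint_left.2 fun b hb hb' => ?_
      obtain ⟨q, hq, hbq⟩ := hb'
      exact hp (hJ (hb.symm.trans hbq) ▸ hq)

end Counting

namespace PreBarcode

variable {k : Type u} [Field k] {r : ℕ} {X : Type v} [TopologicalSpace X]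
  {f : X → ℝ} {N : ℕ} {t : Fin (N + 1) → ℝ} {ι : Type w} (B : PreBarcode k r f t ι)

lemma linearIndepOn (s : ℝ) : LinearIndepOn k (fun b => B.cls b s) (B.barsAt s) :=
  B.linearIndependent s

/-- A subspace of the homology of a level which contains, together with each class, the classes of
the bars involved in it is spanned by the classes of bars it contains. -/
lemma dim_eq_encard_of {s : ℝ} (S : Set ι) (hS : S ⊆ B.barsAt s)
    (W : Submodule k (H k r f {s})) (hW : ∀ b ∈ S, B.cls b s ∈ W)
    (h : ∀ a ∈ Finsupp.supported k k (B.barsAt s), B.comb s a ∈ W → ∀ b, a b ≠ 0 → b ∈ S) :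
    dim k W = S.encard := by
  refine dim_eq_encard ((B.linearIndepOn s).mono hS) (le_antisymm ?_ fun c hc => ?_)
  · rw [Submodule.span_le]
    rintro _ ⟨b, hb, rfl⟩
    exact hW b hb
  · obtain ⟨a, ha, rfl⟩ := B.exists_comb s c
    refine (Finsupp.mem_span_image_iff_linearCombination k).2 ⟨a, ?_, rfl⟩
    exact (Finsupp.mem_supported k a).2 fun b hb => h a ha hc b (Finsupp.mem_support_iff.1 hb)

lemma lNum_eq (s : ℝ) : lNum k r f s = {b | s ∈ (B.bar b).toSet}.encard := by
  have h := B.dim_eq_encard_of (s := s) _ subset_rfl ⊤ (fun _ _ => trivial)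
    fun a ha _ b hb => B.mem_of_supported ha hb
  refine Eq.trans ?_ h
  rw [lNum, dim, dim, rank_top]

lemma endsBy_of_up_eq_zero (hf : IsTame f t) {s s' : ℝ} (h : s ≤ s') {a : ι →₀ k}
    (ha : a ∈ Finsupp.supported k k (B.barsAt s)) (h0 : up k r f h (B.comb s a) = 0) {b : ι}
    (hb : a b ≠ 0) : (B.bar b).EndsBy s' := by
  have key := B.separates hf s s' h a ha 0 (zero_mem _) (by rw [h0, map_zero, map_zero]) b
  refine key.2.1 hb fun hs' => hb ?_
  exact key.1 (B.mem_of_supported ha hb) hs'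

lemma startsAfter_of_down_eq_zero (hf : IsTame f t) {s s' : ℝ} (h : s ≤ s') {a : ι →₀ k}
    (ha : a ∈ Finsupp.supported k k (B.barsAt s')) (h0 : down k r f h (B.comb s' a) = 0) {b : ι}
    (hb : a b ≠ 0) : (B.bar b).StartsAfter s := by
  have key := B.separates hf s s' h 0 (zero_mem _) a ha (by rw [h0, map_zero, map_zero]) b
  refine key.2.2 hb fun hs => hb ?_
  exact (key.1 hs (B.mem_of_supported ha hb)).symm

lemma lPlusNum_eq (hf : IsTame f t) {s s' : ℝ} (h : s ≤ s') : lPlusNum k r f h =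
    {b | s ∈ (B.bar b).toSet ∧ (B.bar b).EndsBy s'}.encard :=
  B.dim_eq_encard_of _ (fun _ hb => hb.1) (Lplus k r f h) (fun _ hb => B.up_eq_zero h hb.1 hb.2)
    fun _ ha ha' _ hb => ⟨B.mem_of_supported ha hb, B.endsBy_of_up_eq_zero hf h ha ha' hb⟩

lemma lMinusNum_eq (hf : IsTame f t) {s s' : ℝ} (h : s ≤ s') : lMinusNum k r f h =
    {b | s' ∈ (B.bar b).toSet ∧ (B.bar b).StartsAfter s}.encard :=
  B.dim_eq_encard_of _ (fun _ hb => hb.1) (Lminus k r f h)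
    (fun _ hb => B.down_eq_zero h hb.1 hb.2)
    fun _ ha ha' _ hb => ⟨B.mem_of_supported ha hb, B.startsAfter_of_down_eq_zero hf h ha ha' hb⟩

lemma eNum_eq (hf : IsTame f t) {s'' s s' : ℝ} (h' : s'' ≤ s) (h : s ≤ s') : eNum k r f h' h =
    {b | s ∈ (B.bar b).toSet ∧ (B.bar b).StartsAfter s'' ∧ (B.bar b).EndsBy s'}.encard :=
  B.dim_eq_encard_of _ (fun _ hb => hb.1) (Lplus k r f h ⊓ Lminus k r f h')
    (fun _ hb => ⟨B.up_eq_zero h hb.1 hb.2.2, B.down_eq_zero h' hb.1 hb.2.1⟩)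
    fun _ ha ha' _ hb => ⟨B.mem_of_supported ha hb,
      B.startsAfter_of_down_eq_zero hf h' ha ha'.2 hb, B.endsBy_of_up_eq_zero hf h ha ha'.1 hb⟩

lemma iNum_eq (hf : IsTame f t) {s s' : ℝ} (h : s ≤ s') : iNum k r f h =
    {b | s ∈ (B.bar b).toSet ∧ s' ∈ (B.bar b).toSet}.encard := by
  classical
  refine dim_eq_encard (v := fun b => up k r f h (B.cls b s)) ?_ (le_antisymm ?_ ?_)
  · refine linearIndepOn_iff.2 fun a ha h0 => ?_
    have ha1 : a ∈ Finsupp.supported k k (B.barsAt s) :=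
      Finsupp.supported_mono (fun _ hb => hb.1) ha
    have h1 : up k r f h (B.comb s a) = 0 := by
      rw [← h0, comb_eq_sum, map_sum]
      exact Finset.sum_congr rfl fun b _ => map_smul _ _ _
    ext b
    by_contra hb
    exact (B.endsBy_of_up_eq_zero hf h ha1 h1 hb).notMem
      ((Finsupp.mem_supported k a).1 ha (Finsupp.mem_support_iff.2 hb)).2
  · rw [Submodule.span_le]
    rintro _ ⟨b, hb, rfl⟩
    exact ⟨⟨_, rfl⟩, ⟨B.cls b s', (B.agree b s s' h hb.1 hb.2).symm⟩⟩
  · rintro _ ⟨⟨x, rfl⟩, ⟨y, hy⟩⟩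
    obtain ⟨a, ha, rfl⟩ := B.exists_comb s x
    obtain ⟨a', ha', rfl⟩ := B.exists_comb s' y
    rw [comb_eq_sum, map_sum]
    refine Submodule.sum_mem _ fun b hb => ?_
    have hb1 := Finsupp.mem_support_iff.1 hb
    have hbs := B.mem_of_supported ha hb1
    rw [map_smul]
    refine Submodule.smul_mem _ _ ?_
    by_cases hbs' : s' ∈ (B.bar b).toSet
    · exact Submodule.subset_span ⟨b, ⟨hbs, hbs'⟩, rfl⟩
    · rw [B.up_eq_zero h hbs ((B.separates hf s s' h a ha a' ha' hy.symm b).2.1 hb1 hbs')]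
      exact zero_mem _

end PreBarcode

namespace LevelBarcode

variable {k : Type u} [Field k] {r : ℕ} {X : Type v} [TopologicalSpace X]
  {f : X → ℝ} {N : ℕ} {t : Fin (N + 1) → ℝ} {ι : Type w} (B : LevelBarcode k r f t ι)

lemma numContaining_Icc {s s' : ℝ} (h : s ≤ s') : B.numContaining (Icc s s') =
    {b | s ∈ (B.bar b).toSet ∧ s' ∈ (B.bar b).toSet}.encard := by
  refine congrArg Set.encard (Set.ext fun b => ⟨fun hb => ?_, fun hb => ?_⟩)
  · exact ⟨hb (left_mem_Icc.2 h), hb (right_mem_Icc.2 h)⟩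
  · exact (B.bar b).ordConnected_toSet.out hb.1 hb.2

lemma numContaining_singleton (s : ℝ) : B.numContaining {s} =
    {b | s ∈ (B.bar b).toSet}.encard :=
  congrArg Set.encard (Set.ext fun _ => singleton_subset_iff)

/-- The number of bars of one of the four types whose end points satisfy a given condition. -/
lemma sum_mult (ht : StrictMono t) (J : ℝ → ℝ → Bar) (hl : ∀ x y, (J x y).left = x)
    (hr : ∀ x y, (J x y).right = y) (P : ℝ → ℝ → Prop)
    [DecidablePred fun p : Fin (N + 1) × Fin (N + 1) => P (t p.1) (t p.2)] :
    ∑ p : Fin (N + 1) × Fin (N + 1) with P (t p.1) (t p.2), B.mult (J (t p.1) (t p.2)) =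
      {b | ∃ x y, B.bar b = J x y ∧ P x y}.encard := by
  refine (encard_eq_sum B.bar _ (fun p : Fin (N + 1) × Fin (N + 1) => J (t p.1) (t p.2))
    fun p q hpq => ?_).symm.trans (congrArg Set.encard (Set.ext fun b => ⟨?_, ?_⟩))
  · refine Prod.ext (ht.injective ?_) (ht.injective ?_)
    · simpa only [hl] using congrArg Bar.left hpq
    · simpa only [hr] using congrArg Bar.right hpq
  · rintro ⟨p, hp, hb⟩
    exact ⟨_, _, hb, (Finset.mem_filter.1 hp).2⟩
  · rintro ⟨x, y, hb, hP⟩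
    obtain ⟨i, hi⟩ := B.left_mem b
    obtain ⟨j, hj⟩ := B.right_mem b
    rw [hb, hl] at hi
    rw [hb, hr] at hj
    subst hi hj
    exact ⟨(i, j), Finset.mem_filter.2 ⟨Finset.mem_univ _, hP⟩, hb⟩

open scoped Classical in
lemma lPlusNum_eq_sum (hf : IsTame f t) {s s' : ℝ} (h : s ≤ s') : lPlusNum k r f h =
    (∑ p : Fin (N + 1) × Fin (N + 1) with t p.1 ≤ s ∧ s < t p.2 ∧ t p.2 ≤ s',
      B.mult (.co (t p.1) (t p.2))) +
    (∑ p : Fin (N + 1) × Fin (N + 1) with t p.1 < s ∧ s < t p.2 ∧ t p.2 ≤ s',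
      B.mult (.oo (t p.1) (t p.2))) := by
  rw [B.sum_mult hf.strictMono .co (fun _ _ => rfl) (fun _ _ => rfl)
      (fun x y => x ≤ s ∧ s < y ∧ y ≤ s'),
    B.sum_mult hf.strictMono .oo (fun _ _ => rfl) (fun _ _ => rfl)
      (fun x y => x < s ∧ s < y ∧ y ≤ s'), ← encard_union_eq, B.toPreBarcode.lPlusNum_eq hf h]
  · refine congrArg Set.encard (Set.ext fun b => ?_)
    simp only [toPreBarcode, mem_ofPred_eq, mem_union]
    generalize B.bar b = J
    cases J <;> simp [Bar.toSet, Bar.EndsBy, Bar.right, Bar.RightClosed, and_assoc]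
  · refine Set.disjoint_left.2 ?_
    rintro b ⟨x, y, hb, -⟩ ⟨x', y', hb', -⟩
    exact Bar.noConfusion (hb.symm.trans hb')

open scoped Classical in
lemma lMinusNum_eq_sum (hf : IsTame f t) {s'' s : ℝ} (h : s'' ≤ s) : lMinusNum k r f h =
    (∑ p : Fin (N + 1) × Fin (N + 1) with s'' ≤ t p.1 ∧ t p.1 < s ∧ s ≤ t p.2,
      B.mult (.oc (t p.1) (t p.2))) +
    (∑ p : Fin (N + 1) × Fin (N + 1) with s'' ≤ t p.1 ∧ t p.1 < s ∧ s < t p.2,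
      B.mult (.oo (t p.1) (t p.2))) := by
  rw [B.sum_mult hf.strictMono .oc (fun _ _ => rfl) (fun _ _ => rfl)
      (fun x y => s'' ≤ x ∧ x < s ∧ s ≤ y),
    B.sum_mult hf.strictMono .oo (fun _ _ => rfl) (fun _ _ => rfl)
      (fun x y => s'' ≤ x ∧ x < s ∧ s < y), ← encard_union_eq, B.toPreBarcode.lMinusNum_eq hf h]
  · refine congrArg Set.encard (Set.ext fun b => ?_)
    simp only [toPreBarcode, mem_ofPred_eq, mem_union]
    generalize B.bar b = J
    cases J <;> simp [Bar.toSet, Bar.StartsAfter, Bar.left, Bar.LeftClosed, and_comm, and_assoc]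
  · refine Set.disjoint_left.2 ?_
    rintro b ⟨x, y, hb, -⟩ ⟨x', y', hb', -⟩
    exact Bar.noConfusion (hb.symm.trans hb')

open scoped Classical in
lemma eNum_eq_sum (hf : IsTame f t) {s'' s s' : ℝ} (h' : s'' ≤ s) (h : s ≤ s') :
    eNum k r f h' h =
      ∑ p : Fin (N + 1) × Fin (N + 1) with s'' ≤ t p.1 ∧ t p.1 < s ∧ s < t p.2 ∧ t p.2 ≤ s',
        B.mult (.oo (t p.1) (t p.2)) := by
  rw [B.sum_mult hf.strictMono .oo (fun _ _ => rfl) (fun _ _ => rfl)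
      (fun x y => s'' ≤ x ∧ x < s ∧ s < y ∧ y ≤ s'), B.toPreBarcode.eNum_eq hf h' h]
  refine congrArg Set.encard (Set.ext fun b => ?_)
  simp only [toPreBarcode, mem_ofPred_eq]
  generalize B.bar b = J
  cases J <;> simp [Bar.toSet, Bar.StartsAfter, Bar.EndsBy, Bar.left, Bar.LeftClosed, Bar.right,
    Bar.RightClosed]
  tauto

end LevelBarcode

/-! ### Interval decomposition of sequences of linear relations -/

section Zigzag

open Submodule

variable {k : Type u} [Field k]

/-- The preimage of a subspace under a linear relation. -/
def relPreimage {V W : Type*} [AddCommGroup V] [Module k V] [AddCommGroup W] [Module k W]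
    (R : Submodule k (V × W)) (G : Submodule k W) : Submodule k V :=
  (R ⊓ G.comap (LinearMap.snd k V W)).map (LinearMap.fst k V W)

section OneStep

variable {V W : Type*} [AddCommGroup V] [Module k V] [AddCommGroup W] [Module k W]

lemma mem_relPreimage {R : Submodule k (V × W)} {G : Submodule k W} {x : V} :
    x ∈ relPreimage R G ↔ ∃ y ∈ G, (x, y) ∈ R := by
  constructor
  · rintro ⟨⟨x', y⟩, ⟨h1, h2⟩, rfl⟩
    exact ⟨y, h2, h1⟩
  · rintro ⟨y, hy, h⟩
    exact ⟨(x, y), ⟨h, hy⟩, rfl⟩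

lemma relPreimage_mono (R : Submodule k (V × W)) {G G' : Submodule k W} (h : G ≤ G') :
    relPreimage R G ≤ relPreimage R G' := fun x hx => by
  obtain ⟨y, hy, hxy⟩ := mem_relPreimage.1 hx
  exact mem_relPreimage.2 ⟨y, h hy, hxy⟩

lemma exists_least_of_pairwise {α : Type*} [Preorder α] {L : List α} (hL : L.Pairwise (· ≤ ·))
    (p : α → Prop) (h : ∃ G ∈ L, p G) : ∃ G ∈ L, p G ∧ ∀ G' ∈ L, p G' → G ≤ G' := by
  induction L with
  | nil => obtain ⟨G, hG, -⟩ := h; simp at hG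
  | cons G L ih =>
    rw [List.pairwise_cons] at hL
    by_cases hp : p G
    · refine ⟨G, by simp, hp, fun G' hG' _ => ?_⟩
      rcases List.mem_cons.1 hG' with rfl | hG'
      exacts [le_rfl, hL.1 G' hG']
    · obtain ⟨G₁, hG₁, hp₁⟩ := h
      rcases List.mem_cons.1 hG₁ with rfl | hG₁
      · exact (hp hp₁).elim
      · obtain ⟨G₂, h2, h3, h4⟩ := ih hL.2 ⟨G₁, hG₁, hp₁⟩
        refine ⟨G₂, List.mem_cons_of_mem _ h2, h3, fun G' hG' hp' => ?_⟩
        rcases List.mem_cons.1 hG' with rfl | hG'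
        exacts [(hp hp').elim, h4 G' hG' hp']

lemma disjoint_span_of_linearIndepOn_id {S P Q : Set W} (hS : LinearIndepOn k id S) (hP : P ⊆ S)
    (hQ : Q ⊆ S) (hPQ : Disjoint P Q) : Disjoint (span k P) (span k Q) := by
  have h := LinearIndependent.disjoint_span_image hS (hPQ.preimage ((↑) : S → W))
  have himg : ∀ T ⊆ S, (fun x : S => id (x : W)) '' ((↑) ⁻¹' T) = T := fun T hT => by
    simp only [id]
    exact Subtype.image_preimage_coe S T |>.trans (inter_eq_self_of_subset_right hT)
  rwa [himg P hP, himg Q hQ] at h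

/-- If a subspace is spanned by members of a linearly independent family, a linear combination of
the family in the subspace involves only members in the subspace. -/
lemma mem_of_linearCombination_mem {ι : Type*} {v : ι → V} {S : Set ι} (hv : LinearIndepOn k v S)
    {G : Submodule k V} (hG : G ≤ span k (v '' {b | b ∈ S ∧ v b ∈ G})) {a : ι →₀ k}
    (ha : a ∈ Finsupp.supported k k S) (h : Finsupp.linearCombination k v a ∈ G) {b : ι}
    (hb : a b ≠ 0) : v b ∈ G := by
  obtain ⟨a', ha', h'⟩ := (Finsupp.mem_span_image_iff_linearCombination k).1 (hG h)
  have : a' = a :=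
    linearIndepOn_iffₛ.1 hv a' (Finsupp.supported_mono (fun _ hb => hb.1) ha') a ha h'
  subst this
  exact ((Finsupp.mem_supported k a').1 ha' (Finsupp.mem_support_iff.2 hb)).2

/-- A linearly independent set which is compatible with a flag extends to a basis adapted to the
flag. -/
lemma exists_adapted_extension (L : List (Submodule k W)) (hL : L.Pairwise (· ≤ ·)) (Y : Set W)
    (hY : LinearIndepOn k id Y) (h : ∀ G ∈ L, span k Y ⊓ G ≤ span k (Y ∩ G)) :
    ∃ Z, Y ⊆ Z ∧ LinearIndepOn k id Z ∧ ∀ G ∈ L, G ≤ span k (Z ∩ G) := by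
  induction L generalizing Y with
  | nil => exact ⟨Y, subset_rfl, hY, by simp⟩
  | cons G L ih =>
    rw [List.pairwise_cons] at hL
    obtain ⟨B, hB1, hB2, hB3, hB4⟩ := exists_linearIndepOn_id_extension (s := Y ∩ G)
      (t := (G : Set W)) (K := k) (hY.mono inter_subset_left) inter_subset_right
    have hBG : span k B = G := le_antisymm (span_le.2 hB1) hB3
    have hYB : Y ∪ B = (Y \ G) ∪ B := by
      ext x
      have := @hB2 x
      simp only [mem_union, mem_sdiff, mem_inter_iff] at *
      tauto
    have hli : LinearIndepOn k id (Y ∪ B) := by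
      rw [hYB]
      refine LinearIndepOn.union (hY.mono sdiff_subset) hB4 ?_
      rw [image_id, image_id, hBG]
      refine Submodule.disjoint_def.2 fun x hx hxG => ?_
      have h1 := h G (by simp) ⟨span_mono sdiff_subset hx, hxG⟩
      exact Submodule.disjoint_def.1 (disjoint_span_of_linearIndepOn_id hY sdiff_subset
        inter_subset_left disjoint_sdiff_inter) x hx h1
    obtain ⟨Z, hZ1, hZ2, hZ3⟩ := ih hL.2 (Y ∪ B) hli fun G' hG' x hx => by
      obtain ⟨hx1, hx2⟩ := hx
      rw [SetLike.mem_coe, span_union, mem_sup] at hx1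
      obtain ⟨y, hy, b, hb, rfl⟩ := hx1
      have hbG' : b ∈ G' := hL.1 G' hG' (hBG ▸ hb)
      have hyG' : y ∈ G' := by
        have := sub_mem hx2 hbG'
        rwa [add_sub_cancel_right] at this
      refine add_mem ?_ ?_
      · exact span_mono (inter_subset_inter_left _ subset_union_left)
          (h G' (List.mem_cons_of_mem _ hG') ⟨hy, hyG'⟩)
      · have hBG' : B ⊆ (Y ∪ B) ∩ G' := fun z hz => ⟨Or.inr hz, hL.1 G' hG' (hB1 hz)⟩
        exact span_mono hBG' hb
    refine ⟨Z, subset_union_left.trans hZ1, hZ2, fun G' hG' => ?_⟩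
    rcases List.mem_cons.1 hG' with rfl | hG'
    · have hBZ : B ⊆ Z ∩ G' := fun b hb => ⟨hZ1 (Or.inr hb), hB1 hb⟩
      exact hBG.ge.trans (span_mono hBZ)
    · exact hZ3 G' hG'

/-- One step of the decomposition. A basis `v` of the source which is adapted to the preimages of
the members of a flag is continued along the relation as far as possible, and the images are
completed to a basis adapted to the flag. The new basis elements are either related to zero or not
in the range of the relation. -/
lemma exists_adapted_step (R : Submodule k (V × W)) (L : List (Submodule k W))
    (hL : L.Pairwise (· ≤ ·)) (hbot : ⊥ ∈ L) (htop : ⊤ ∈ L) {ι : Type*} {v : ι → V}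
    (hv : LinearIndepOn k v {b | v b ≠ 0})
    (hvL : ∀ G ∈ L, relPreimage R G ≤ span k (v '' {b | v b ≠ 0 ∧ v b ∈ relPreimage R G})) :
    ∃ (y : ι → W) (Z : Set W), (∀ b, v b = 0 → y b = 0) ∧
      (∀ b, (v b, y b) ∈ R ∨ (y b = 0 ∧ ∀ w, (v b, w) ∉ R)) ∧
      (∀ z ∈ Z, (0, z) ∈ R ∨ ∀ x, (x, z) ∉ R) ∧
      LinearIndepOn k (Sum.elim y ((↑) : Z → W)) {c | Sum.elim y ((↑) : Z → W) c ≠ 0} ∧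
      ∀ G ∈ L, G ≤ span k (Sum.elim y ((↑) : Z → W) ''
        {c | Sum.elim y ((↑) : Z → W) c ≠ 0 ∧ Sum.elim y ((↑) : Z → W) c ∈ G}) := by
  classical
  -- continue each basis element within the smallest possible member of the flag
  have hy : ∀ b, ∃ w, ((v b, 0) ∈ R → w = 0) ∧ ((v b, w) ∈ R ∨ (w = 0 ∧ ∀ w, (v b, w) ∉ R)) ∧
      ∀ G ∈ L, v b ∈ relPreimage R G → w ∈ G := fun b => by
    by_cases h0 : (v b, 0) ∈ R
    · exact ⟨0, fun _ => rfl, Or.inl h0, fun _ _ _ => zero_mem _⟩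
    by_cases hd : ∃ w, (v b, w) ∈ R
    · obtain ⟨w, hw⟩ := hd
      obtain ⟨G, hG, hG1, hG2⟩ := exists_least_of_pairwise hL (fun G => v b ∈ relPreimage R G)
        ⟨⊤, htop, mem_relPreimage.2 ⟨w, trivial, hw⟩⟩
      obtain ⟨w', hw1, hw2⟩ := mem_relPreimage.1 hG1
      exact ⟨w', fun h => (h0 h).elim, Or.inl hw2, fun G' hG' h => hG2 G' hG' h hw1⟩
    · push Not at hd
      exact ⟨0, fun _ => rfl, Or.inr ⟨rfl, hd⟩, fun _ _ _ => zero_mem _⟩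
  choose y hy1 hy2 hy3 using hy
  have hy0 : ∀ b, v b = 0 → y b = 0 := fun b hb => hy1 b (hb ▸ R.zero_mem)
  have hyR : ∀ b, y b ≠ 0 → (v b, y b) ∈ R := fun b hb => (hy2 b).resolve_right fun h => hb h.1
  set T : Set ι := {b | y b ≠ 0} with hT
  have hTv : T ⊆ {b | v b ≠ 0} := fun b hb hv0 => hb (hy0 b hv0)
  -- the elements related to zero
  let K : Submodule k W := R.comap (LinearMap.inr k V W)
  have hK : ∀ {w}, w ∈ K ↔ ((0 : V), w) ∈ R := Iff.rfl
  have hlin : ∀ a : ι →₀ k, (∀ b, a b ≠ 0 → (v b, y b) ∈ R) →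
      (Finsupp.linearCombination k v a, Finsupp.linearCombination k y a) ∈ R := fun a ha => by
    have : (Finsupp.linearCombination k v a, Finsupp.linearCombination k y a) =
        ∑ b ∈ a.support, a b • (v b, y b) := by
      rw [Prod.ext_iff, Prod.fst_sum, Prod.snd_sum]
      exact ⟨rfl, rfl⟩
    rw [this]
    exact sum_mem fun b hb => R.smul_mem _ (ha b (Finsupp.mem_support_iff.1 hb))
  have key : ∀ G ∈ L, ∀ a ∈ Finsupp.supported k k T,
      Finsupp.linearCombination k y a ∈ G ⊔ K → ∀ b, a b ≠ 0 → y b ∈ G := by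
    intro G hG a ha h b hb
    obtain ⟨g, hg, z, hz, hgz⟩ := Submodule.mem_sup.1 h
    have h1 := R.sub_mem (hlin a fun b hb => hyR b
      ((Finsupp.mem_supported k a).1 ha (Finsupp.mem_support_iff.2 hb))) (hK.1 hz)
    rw [← hgz, Prod.mk_sub_mk, sub_zero, add_sub_cancel_right] at h1
    exact hy3 b G hG (mem_of_linearCombination_mem hv (hvL G hG)
      (Finsupp.supported_mono hTv ha) (mem_relPreimage.2 ⟨g, hg, h1⟩) hb)
  have hyLI : LinearIndepOn k y T := linearIndepOn_iff.2 fun a ha h => by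
    ext b
    by_contra hb
    exact (Finsupp.mem_supported k a).1 ha (Finsupp.mem_support_iff.2 hb)
      (key ⊥ hbot a ha (h ▸ zero_mem _) b hb)
  set Y : Set W := y '' T with hY
  have hYG : ∀ G ∈ L, span k Y ⊓ (G ⊔ K) ≤ span k (Y ∩ G) := by
    rintro G hG w ⟨hw1, hw2⟩
    obtain ⟨a, ha, rfl⟩ := (Finsupp.mem_span_image_iff_linearCombination k).1 hw1
    refine sum_mem fun b hb => Submodule.smul_mem _ _ (subset_span ⟨⟨b, ?_, rfl⟩, ?_⟩)
    · exact (Finsupp.mem_supported k a).1 ha hb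
    · exact key G hG a ha hw2 b (Finsupp.mem_support_iff.1 hb)
  -- a basis of the elements related to zero
  obtain ⟨D', -, hD1, hD2⟩ := exists_adapted_extension (L.map (· ⊓ K))
    (List.pairwise_map.2 (hL.imp fun h => inf_le_inf_right K h)) (∅ : Set W)
    (linearIndepOn_empty k id) (by simp)
  set D : Set W := D' ∩ K with hD
  have hDspan : ∀ G ∈ L, G ⊓ K ≤ span k (D ∩ G) := fun G hG =>
    (hD2 _ (List.mem_map_of_mem hG)).trans (span_mono fun z hz => ⟨⟨hz.1, hz.2.2⟩, hz.2.1⟩)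
  have hDK : span k D = K := le_antisymm (span_le.2 inter_subset_right) (by
    have := hDspan ⊤ htop
    rw [top_inf_eq] at this
    exact this.trans (span_mono inter_subset_left))
  have hYD : LinearIndepOn k id (Y ∪ D) := by
    refine LinearIndepOn.union hyLI.id_image (hD1.mono inter_subset_left) ?_
    rw [image_id, image_id, hDK]
    refine Submodule.disjoint_def.2 fun w hw hwK => ?_
    have h1 := hYG ⊥ hbot ⟨hw, mem_sup_right hwK⟩
    have h2 : span k (Y ∩ (⊥ : Submodule k W)) ≤ ⊥ := span_le.2 inter_subset_right
    exact h2 h1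
  obtain ⟨Z, hZ1, hZ2, hZ3⟩ := exists_adapted_extension L hL (Y ∪ D) hYD fun G hG w hw => by
    obtain ⟨hw1, hw2⟩ := hw
    rw [SetLike.mem_coe, span_union, Submodule.mem_sup] at hw1
    obtain ⟨w1, h1, w2, h2, rfl⟩ := hw1
    rw [hDK] at h2
    have h3 : w1 ∈ G ⊔ K := by
      have := sub_mem (mem_sup_left hw2 : w1 + w2 ∈ G ⊔ K) (mem_sup_right h2)
      rwa [add_sub_cancel_right] at this
    have h4 := hYG G hG ⟨h1, h3⟩
    have h5 : w1 ∈ G := (span_le.2 inter_subset_right : span k (Y ∩ G) ≤ G) h4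
    have h6 : w2 ∈ G := by
      have := sub_mem hw2 h5
      rwa [add_sub_cancel_left] at this
    exact add_mem (span_mono (inter_subset_inter_left _ subset_union_left) h4)
      (span_mono (inter_subset_inter_left _ subset_union_right) (hDspan G hG ⟨h6, h2⟩))
  -- the range of the relation is already spanned, so further basis elements are not in it
  have hran : ∀ x w, (x, w) ∈ R → w ∈ span k (Y ∪ D) := by
    intro x w hxw
    obtain ⟨a, ha, rfl⟩ := (Finsupp.mem_span_image_iff_linearCombination k).1
      (hvL ⊤ htop (mem_relPreimage.2 ⟨w, trivial, hxw⟩))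
    have h1 := hlin a fun b hb => (hy2 b).resolve_right fun h => by
      obtain ⟨w', -, hw'⟩ := mem_relPreimage.1
        ((Finsupp.mem_supported k a).1 ha (Finsupp.mem_support_iff.2 hb)).2
      exact h.2 w' hw'
    have h2 := R.sub_mem hxw h1
    rw [Prod.mk_sub_mk, sub_self] at h2
    rw [span_union, hDK, ← sub_add_cancel w (Finsupp.linearCombination k y a), add_comm]
    refine add_mem (mem_sup_left ?_) (mem_sup_right h2)
    refine sum_mem fun b _ => Submodule.smul_mem _ _ ?_
    by_cases hb : y b = 0
    · rw [hb]; exact zero_mem _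
    · exact subset_span ⟨b, hb, rfl⟩
  have hZ0 : (0 : W) ∉ Z := by simpa using hZ2.zero_notMem_image
  refine ⟨y, Z \ Y, hy0, hy2, fun z hz => ?_, ?_, fun G hG => ?_⟩
  · by_cases hzD : z ∈ D
    · exact Or.inl (hK.1 hzD.2)
    · refine Or.inr fun x hx => ?_
      have h1 : z ∉ Y ∪ D := fun h => h.elim hz.2 hzD
      have h2 := hZ2.mono (insert_subset hz.1 hZ1) |>.notMem_span_of_insert h1
      rw [image_id] at h2
      exact h2 (hran x z hx)
  · have himg : Sum.elim y ((↑) : ↥(Z \ Y) → W) ''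
        {c | Sum.elim y ((↑) : ↥(Z \ Y) → W) c ≠ 0} ⊆ Z := by
      rintro _ ⟨b | z, hc, rfl⟩
      · exact hZ1 (Or.inl ⟨b, hc, rfl⟩)
      · exact z.2.1
    refine (linearIndepOn_iff_image ?_).2 (hZ2.mono himg)
    rintro (b | z) hc (b' | z') hc' h
    · exact congrArg Sum.inl (hyLI.injOn hc hc' h)
    · exact (z'.2.2 ⟨b, hc, h⟩).elim
    · exact (z.2.2 ⟨b', hc', h.symm⟩).elim
    · exact congrArg Sum.inr (Subtype.ext h)
  · refine (hZ3 G hG).trans (span_mono ?_)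
    rintro z ⟨hz, hzG⟩
    have hz0 : z ≠ 0 := fun h => hZ0 (h ▸ hz)
    by_cases hzY : z ∈ Y
    · obtain ⟨b, hb, rfl⟩ := hzY
      exact ⟨Sum.inl b, ⟨hb, hzG⟩, rfl⟩
    · exact ⟨Sum.inr ⟨z, hz, hzY⟩, ⟨hz0, hzG⟩, rfl⟩

end OneStep

section Sequence

variable {M : ℕ → Type w} [∀ n, AddCommGroup (M n)] [∀ n, Module k (M n)]
  (R : ∀ n, Submodule k (M n × M (n + 1)))

/-- The flag formed by the iterated preimages in `M n` of `⊥` and `⊤` under at most `d` relations: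
the vectors which can be related to zero within a given number of steps, followed by the vectors
from which a given number of steps is possible. -/
def relFlag : ℕ → ∀ n : ℕ, List (Submodule k (M n))
  | 0, _ => [⊥, ⊤]
  | d + 1, n => ⊥ :: ((relFlag d (n + 1)).map (relPreimage (R n)) ++ [⊤])

lemma pairwise_relFlag (d n : ℕ) : (relFlag R d n).Pairwise (· ≤ ·) := by
  induction d generalizing n with
  | zero => simp [relFlag]
  | succ d ih =>
    rw [relFlag, List.pairwise_cons, List.pairwise_append]
    refine ⟨fun _ _ => bot_le, List.pairwise_map.2 ((ih (n + 1)).imp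
      fun h => relPreimage_mono (R n) h), List.pairwise_singleton _ _, fun _ _ G hG => ?_⟩
    rw [List.mem_singleton.1 hG]
    exact le_top

lemma bot_mem_relFlag (d n : ℕ) : ⊥ ∈ relFlag R d n := by cases d <;> simp [relFlag]

lemma top_mem_relFlag (d n : ℕ) : ⊤ ∈ relFlag R d n := by cases d <;> simp [relFlag]

lemma relPreimage_mem_relFlag {d n : ℕ} {G : Submodule k (M (n + 1))}
    (hG : G ∈ relFlag R d (n + 1)) : relPreimage (R n) G ∈ relFlag R (d + 1) n := by
  rw [relFlag]
  exact List.mem_cons_of_mem _ (List.mem_append_left _ (List.mem_map_of_mem hG))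

/-- A family of sequences of vectors, linearly independent in each `M i` for `i ≤ n` where they do
not vanish and spanning, with connected supports, which follow the relations as far as possible in
both directions. -/
structure IsStrandBasis (n : ℕ) {ι : Type*} (S : ι → ∀ i, M i) : Prop where
  linearIndepOn : ∀ i ≤ n, LinearIndepOn k (fun b => S b i) {b | S b i ≠ 0}
  span_eq_top : ∀ i ≤ n, span k ((fun b => S b i) '' {b | S b i ≠ 0}) = ⊤
  connected : ∀ b i l j, i ≤ l → l ≤ j → j ≤ n → S b i ≠ 0 → S b j ≠ 0 → S b l ≠ 0
  step : ∀ b, ∀ i < n, (S b i, S b (i + 1)) ∈ R i ∨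
    (S b (i + 1) = 0 ∧ ∀ w, (S b i, w) ∉ R i) ∨ (S b i = 0 ∧ ∀ x, (x, S b (i + 1)) ∉ R i)

lemma exists_isStrandBasis_adapted (n : ℕ) : ∀ d, ∃ (ι : Type w) (S : ι → ∀ i, M i),
    IsStrandBasis R n S ∧
      ∀ G ∈ relFlag R d n, G ≤ span k ((fun b => S b n) '' {b | S b n ≠ 0 ∧ S b n ∈ G}) := by
  classical
  induction n with
  | zero =>
    intro d
    obtain ⟨Z, -, hZ, hZG⟩ := exists_adapted_extension (relFlag R d 0) (pairwise_relFlag R d 0) ∅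
      (linearIndepOn_empty k id) (by simp)
    have hZ0 : (0 : M 0) ∉ Z := by simpa using hZ.zero_notMem_image
    have hG : ∀ G ∈ relFlag R d 0, G ≤ span k ((fun b : Z => (Pi.single 0 b.1 : ∀ i, M i) 0) ''
        {b | (Pi.single 0 b.1 : ∀ i, M i) 0 ≠ 0 ∧ (Pi.single 0 b.1 : ∀ i, M i) 0 ∈ G}) :=
      fun G hG => (hZG G hG).trans (span_mono fun z hz => ⟨⟨z, hz.1⟩, by
        simpa using ⟨fun h => hZ0 (h ▸ hz.1), hz.2⟩, by simp⟩)
    refine ⟨Z, fun z => Pi.single 0 z.1, ⟨fun i hi => ?_, fun i hi => ?_, ?_, by simp⟩, hG⟩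
    · obtain rfl := Nat.le_zero.1 hi
      simp only [Pi.single_eq_same]
      exact LinearIndependent.linearIndepOn hZ _
    · obtain rfl := Nat.le_zero.1 hi
      exact eq_top_iff.2 ((hG ⊤ (top_mem_relFlag R d 0)).trans
        (span_mono (image_mono fun _ hb => hb.1)))
    · intro b i l j hil hlj hj hi _
      obtain rfl : j = 0 := by omega
      obtain rfl : l = 0 := by omega
      obtain rfl : i = 0 := by omega
      exact hi
  | succ n ih =>
    intro d
    obtain ⟨ι, S, hS, hG⟩ := ih (d + 1)
    obtain ⟨y, Z, h1, h2, h3, h4, h5⟩ := exists_adapted_step (R n) (relFlag R d (n + 1))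
      (pairwise_relFlag R d _) (bot_mem_relFlag R d _) (top_mem_relFlag R d _)
      (hS.linearIndepOn n le_rfl) (fun G hG' => hG _ (relPreimage_mem_relFlag R hG'))
    let S' : ι ⊕ Z → ∀ i, M i := Sum.elim (fun b => Function.update (S b) (n + 1) (y b))
      (fun z => Pi.single (n + 1) z.1)
    have hnew : ∀ c, S' c (n + 1) = Sum.elim y ((↑) : Z → M (n + 1)) c := by
      rintro (b | z) <;> simp [S']
    have hl : ∀ b, ∀ i ≤ n, S' (Sum.inl b) i = S b i := fun b i hi => by
      simp only [S', Sum.elim_inl]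
      exact Function.update_of_ne (by omega) _ _
    have hr : ∀ z, ∀ i ≤ n, S' (Sum.inr z) i = 0 := fun z i hi => by
      simp only [S', Sum.elim_inr]
      exact Pi.single_eq_of_ne (by omega) _
    have hset : ∀ i ≤ n, {c | S' c i ≠ 0} = Sum.inl '' {b | S b i ≠ 0} := fun i hi => by
      ext (b | z)
      · simp [hl b i hi]
      · simp [hr z i hi]
    refine ⟨ι ⊕ Z, S', ⟨fun i hi => ?_, fun i hi => ?_, ?_, ?_⟩, fun G hG' => ?_⟩
    · rcases Nat.lt_or_ge n i with hn | hn
      · obtain rfl : i = n + 1 := by omega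
        simpa only [hnew] using h4
      · have h6 := hS.linearIndepOn i hn
        rw [hset i hn, linearIndepOn_iff_image, image_image]
        · rw [image_congr (g := fun b => S b i) fun b _ => hl b i hn]
          exact h6.id_image
        · rintro _ ⟨b, hb, rfl⟩ _ ⟨b', hb', rfl⟩ h
          simp only [hl _ i hn] at h
          exact congrArg Sum.inl (h6.injOn hb hb' h)
    · rcases Nat.lt_or_ge n i with hn | hn
      · obtain rfl : i = n + 1 := by omega
        have := h5 ⊤ (top_mem_relFlag R d _)
        simp only [hnew]
        exact eq_top_iff.2 (this.trans (span_mono (image_mono fun _ hb => hb.1)))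
      · rw [hset i hn, image_image, ← hS.span_eq_top i hn]
        refine congrArg (span k) (image_congr fun b _ => hl b i hn)
    · rintro (b | z) i l j hil hlj hj hi hj'
      · rcases Nat.lt_or_ge n j with hn | hn
        · obtain rfl : j = n + 1 := by omega
          rcases Nat.lt_or_ge n l with hnl | hnl
          · obtain rfl : l = n + 1 := by omega
            exact hj'
          · rw [hl b _ (hil.trans hnl)] at hi
            rw [hl b _ hnl]
            refine hS.connected b i l n hil hnl le_rfl hi fun h0 => hj' ?_
            rw [hnew]
            exact h1 b h0
        · rw [hl b _ (hil.trans (hlj.trans hn))] at hi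
          rw [hl b _ hn] at hj'
          rw [hl b _ (hlj.trans hn)]
          exact hS.connected b i l j hil hlj hn hi hj'
      · have : ¬ i ≤ n := fun h => hi (hr z i h)
        obtain rfl : l = j := by omega
        exact hj'
    · rintro (b | z) i hi
      · rcases Nat.lt_or_ge i n with hn | hn
        · rw [hl b _ hn.le, hl b _ hn]
          exact hS.step b i hn
        · obtain rfl : i = n := by omega
          rw [hl b _ le_rfl, hnew]
          exact (h2 b).imp_right Or.inl
      · rcases Nat.lt_or_ge i n with hn | hn
        · rw [hr z _ hn.le, hr z _ hn]
          exact Or.inl (R i).zero_mem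
        · obtain rfl : i = n := by omega
          rw [hr z _ le_rfl, hnew]
          exact (h3 z z.2).imp_right fun h => Or.inr ⟨rfl, h⟩
    · simpa only [hnew] using h5 G hG'

/-- The interval decomposition of a finite sequence of linear relations. -/
lemma exists_isStrandBasis (n : ℕ) : ∃ (ι : Type w) (S : ι → ∀ i, M i), IsStrandBasis R n S :=
  let ⟨ι, S, h, _⟩ := exists_isStrandBasis_adapted R n 0
  ⟨ι, S, h⟩

end Sequence

end Zigzag

/-! ### Cells of the line cut at the critical values -/

section Cells

variable {N : ℕ} {t : Fin (N + 1) → ℝ}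

open Classical in
/-- The critical values cut the line into cells, numbered from left to right: the critical value
`t j` is the cell number `2 * j + 1`, and the open intervals between the critical values have even
numbers. -/
noncomputable def cell (t : Fin (N + 1) → ℝ) (s : ℝ) : ℕ :=
  (Finset.univ.filter fun i => t i ≤ s).card + (Finset.univ.filter fun i => t i < s).card

lemma cell_mono {s s' : ℝ} (h : s ≤ s') : cell t s ≤ cell t s' := by
  classical
  refine Nat.add_le_add (Finset.card_le_card fun i hi => ?_) (Finset.card_le_card fun i hi => ?_)
  · simp only [Finset.mem_filter, Finset.mem_univ, true_and] at hi ⊢; exact hi.trans h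
  · simp only [Finset.mem_filter, Finset.mem_univ, true_and] at hi ⊢; exact hi.trans_le h

lemma lt_of_cell_lt {s s' : ℝ} (h : cell t s < cell t s') : s < s' :=
  lt_of_not_ge fun h' => (cell_mono h').not_gt h

lemma cell_le (s : ℝ) : cell t s ≤ 2 * N + 2 := by
  classical
  have h1 := Finset.card_filter_le Finset.univ fun i => t i ≤ s
  have h2 := Finset.card_filter_le Finset.univ fun i => t i < s
  rw [Finset.card_univ, Fintype.card_fin] at h1 h2
  unfold cell
  omega

lemma le_cell_iff (ht : StrictMono t) (s : ℝ) (j : Fin (N + 1)) :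
    2 * (j : ℕ) + 1 ≤ cell t s ↔ t j ≤ s := by
  classical
  have c1 : (Finset.univ.filter fun i => i ≤ j).card = j + 1 := by
    rw [Finset.filter_ge_eq_Iic, Fin.card_Iic]
  have c2 : (Finset.univ.filter fun i => i < j).card = j := by
    rw [Finset.filter_gt_eq_Iio, Fin.card_Iio]
  constructor
  · intro h
    by_contra hlt
    have h1 : (Finset.univ.filter fun i => t i ≤ s).card ≤ j := c2 ▸
      Finset.card_le_card (Finset.monotone_filter_right _ fun i _ hi =>
        ht.lt_iff_lt.1 (lt_of_le_of_lt hi (not_le.1 hlt)))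
    have h2 : (Finset.univ.filter fun i => t i < s).card ≤ j := c2 ▸
      Finset.card_le_card (Finset.monotone_filter_right _ fun i _ hi =>
        ht.lt_iff_lt.1 (lt_trans hi (not_le.1 hlt)))
    unfold cell at h
    omega
  · intro h
    have h1 : j + 1 ≤ (Finset.univ.filter fun i => t i ≤ s).card := c1 ▸
      Finset.card_le_card (Finset.monotone_filter_right _ fun i _ hi =>
        (ht.monotone hi).trans h)
    have h2 : j ≤ (Finset.univ.filter fun i => t i < s).card := c2 ▸
      Finset.card_le_card (Finset.monotone_filter_right _ fun i _ hi =>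
        (ht hi).trans_le h)
    unfold cell
    omega

lemma lt_cell_iff (ht : StrictMono t) (s : ℝ) (j : Fin (N + 1)) :
    2 * (j : ℕ) + 2 ≤ cell t s ↔ t j < s := by
  classical
  have c1 : (Finset.univ.filter fun i => i ≤ j).card = j + 1 := by
    rw [Finset.filter_ge_eq_Iic, Fin.card_Iic]
  have c2 : (Finset.univ.filter fun i => i < j).card = j := by
    rw [Finset.filter_gt_eq_Iio, Fin.card_Iio]
  constructor
  · intro h
    by_contra hlt
    have h1 : (Finset.univ.filter fun i => t i ≤ s).card ≤ j + 1 := c1 ▸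
      Finset.card_le_card (Finset.monotone_filter_right _ fun i _ hi =>
        ht.le_iff_le.1 (le_trans hi (not_lt.1 hlt)))
    have h2 : (Finset.univ.filter fun i => t i < s).card ≤ j := c2 ▸
      Finset.card_le_card (Finset.monotone_filter_right _ fun i _ hi =>
        ht.lt_iff_lt.1 (lt_of_lt_of_le hi (not_lt.1 hlt)))
    unfold cell at h
    omega
  · intro h
    have h1 : j + 1 ≤ (Finset.univ.filter fun i => t i ≤ s).card := c1 ▸
      Finset.card_le_card (Finset.monotone_filter_right _ fun i _ hi =>
        (ht.monotone hi).trans h.le)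
    have h2 : j + 1 ≤ (Finset.univ.filter fun i => t i < s).card := c1 ▸
      Finset.card_le_card (Finset.monotone_filter_right _ fun i _ hi =>
        (ht.monotone hi).trans_lt h)
    unfold cell
    omega

lemma cell_critical (ht : StrictMono t) (j : Fin (N + 1)) : cell t (t j) = 2 * j + 1 := by
  have h1 := (le_cell_iff ht (t j) j).2 le_rfl
  have h2 := mt (lt_cell_iff ht (t j) j).1 (lt_irrefl _)
  omega

lemma exists_cell_eq (ht : StrictMono t) {n : ℕ} (hn : n ≤ 2 * N + 2) : ∃ s, cell t s = n := by
  rcases Nat.even_or_odd' n with ⟨j, rfl | rfl⟩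
  · rcases Nat.eq_zero_or_pos j with rfl | hj
    · refine ⟨t 0 - 1, ?_⟩
      have := mt (le_cell_iff ht (t 0 - 1) 0).1 (by linarith)
      simp only [Fin.coe_ofNat_eq_mod, Nat.zero_mod] at this
      omega
    · obtain ⟨j, rfl⟩ := Nat.exists_eq_succ_of_ne_zero hj.ne'
      rcases Nat.lt_or_ge j N with hj | hj
      · have h0 : t ⟨j, by omega⟩ < t ⟨j + 1, by omega⟩ := ht (by simp [Fin.lt_def])
        set s := (t ⟨j, by omega⟩ + t ⟨j + 1, by omega⟩) / 2 with hs
        refine ⟨s, ?_⟩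
        have h1 := (lt_cell_iff ht s ⟨j, by omega⟩).2 (by linarith)
        have h2 := mt (le_cell_iff ht s ⟨j + 1, by omega⟩).1 (by linarith)
        simp only at h1 h2
        omega
      · refine ⟨t (Fin.last N) + 1, ?_⟩
        have h1 := (lt_cell_iff ht (t (Fin.last N) + 1) (Fin.last N)).2 (by linarith)
        have h2 := cell_le (t := t) (t (Fin.last N) + 1)
        simp only [Fin.val_last] at h1
        omega
  · exact ⟨t ⟨j, by omega⟩, cell_critical ht _⟩

lemma eq_of_cell_odd (ht : StrictMono t) {s s' : ℝ} (h : cell t s = cell t s')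
    (ho : cell t s % 2 = 1) : s = s' := by
  have hle := cell_le (t := t) s
  obtain ⟨j, hj⟩ : ∃ j : Fin (N + 1), cell t s = 2 * j + 1 :=
    ⟨⟨cell t s / 2, by omega⟩, by simp only; omega⟩
  have key : ∀ q, cell t q = 2 * j + 1 → q = t j := fun q hq => by
    refine le_antisymm (not_lt.1 fun hlt => ?_) ((le_cell_iff ht q j).1 hq.ge)
    have := (lt_cell_iff ht q j).2 hlt
    omega
  rw [key s hj, key s' (h ▸ hj)]

lemma notMem_Ioc_of_cell (ht : StrictMono t) {s s' : ℝ}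
    (h : cell t s' = cell t s ∨ cell t s' = cell t s + 1 ∧ cell t s % 2 = 1) (i : Fin (N + 1)) :
    t i ∉ Ioc s s' := fun hi => by
  have h1 := mt (le_cell_iff ht s i).1 hi.1.not_ge
  have h2 := (le_cell_iff ht s' i).2 hi.2
  omega

lemma notMem_Ico_of_cell (ht : StrictMono t) {s s' : ℝ}
    (h : cell t s' = cell t s ∨ cell t s' = cell t s + 1 ∧ cell t s % 2 = 0) (i : Fin (N + 1)) :
    t i ∉ Ico s s' := fun hi => by
  have h1 := mt (lt_cell_iff ht s i).1 hi.1.not_gt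
  have h2 := (lt_cell_iff ht s' i).2 hi.2
  omega

lemma cell_le_of_notMem_Ioc (ht : StrictMono t) {s s' : ℝ} (hc : ∀ i, t i ∉ Ioc s s') :
    cell t s' ≤ cell t s + 1 := by
  by_contra hlt
  have hle := cell_le (t := t) s'
  let j : Fin (N + 1) := ⟨(cell t s + 1) / 2, by omega⟩
  have hj : (j : ℕ) = (cell t s + 1) / 2 := rfl
  refine hc j ⟨not_le.1 fun h => ?_, (le_cell_iff ht s' j).1 (by omega)⟩
  have := (le_cell_iff ht s j).2 h
  omega

lemma cell_le_of_notMem_Ico (ht : StrictMono t) {s s' : ℝ} (hc : ∀ i, t i ∉ Ico s s') :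
    cell t s' ≤ cell t s + 1 := by
  by_contra hlt
  have hle := cell_le (t := t) s'
  let j : Fin (N + 1) := ⟨cell t s / 2, by omega⟩
  have hj : (j : ℕ) = cell t s / 2 := rfl
  refine hc j ⟨not_lt.1 fun h => ?_, (lt_cell_iff ht s' j).1 (by omega)⟩
  have := (lt_cell_iff ht s j).2 h
  omega

/-- The bars are the unions of consecutive cells which do not contain the two unbounded cells. -/
lemma exists_bar (ht : StrictMono t) {lo hi : ℕ} (h1 : 1 ≤ lo) (h2 : lo ≤ hi)
    (h3 : hi ≤ 2 * N + 1) : ∃ J : Bar, J.left ∈ range t ∧ J.right ∈ range t ∧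
      (∀ s, s ∈ J.toSet ↔ lo ≤ cell t s ∧ cell t s ≤ hi) ∧
      (¬ J.LeftClosed → lo % 2 = 0 ∧ cell t J.left + 1 = lo) ∧
      (¬ J.RightClosed → hi % 2 = 0 ∧ cell t J.right = hi + 1) := by
  have hl : ∀ j : Fin (N + 1), ∀ s, 2 * (j : ℕ) + 1 ≤ cell t s ↔ t j ≤ s := fun j s =>
    le_cell_iff ht s j
  have hl' : ∀ j : Fin (N + 1), ∀ s, 2 * (j : ℕ) + 2 ≤ cell t s ↔ t j < s := fun j s =>
    lt_cell_iff ht s j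
  have hr : ∀ j : Fin (N + 1), ∀ s, cell t s ≤ 2 * (j : ℕ) + 1 ↔ s ≤ t j := fun j s => by
    rw [← not_lt, ← not_lt (a := t j), ← hl' j s]; rfl
  have hr' : ∀ j : Fin (N + 1), ∀ s, cell t s ≤ 2 * (j : ℕ) ↔ s < t j := fun j s => by
    rw [← not_lt, ← not_le (a := t j), ← hl j s]; rfl
  have hc := cell_critical ht
  let j : Fin (N + 1) := ⟨(lo - 1) / 2, by omega⟩
  have hj : (j : ℕ) = (lo - 1) / 2 := rfl
  let l : Fin (N + 1) := ⟨hi / 2, by omega⟩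
  have hl0 : (l : ℕ) = hi / 2 := rfl
  rcases Nat.mod_two_eq_zero_or_one lo with ho | ho <;>
    rcases Nat.mod_two_eq_zero_or_one hi with ho' | ho'
  · refine ⟨.oo (t j) (t l), ⟨j, rfl⟩, ⟨l, rfl⟩, fun s => ?_, fun _ => ⟨ho, ?_⟩,
      fun _ => ⟨ho', ?_⟩⟩
    · rw [Bar.toSet, mem_Ioo, ← hl', ← hr', show 2 * (j : ℕ) + 2 = lo by omega,
        show 2 * (l : ℕ) = hi by omega]
    · rw [Bar.left, hc]; omega
    · rw [Bar.right, hc]; omega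
  · refine ⟨.oc (t j) (t l), ⟨j, rfl⟩, ⟨l, rfl⟩, fun s => ?_, fun _ => ⟨ho, ?_⟩,
      fun h => (h trivial).elim⟩
    · rw [Bar.toSet, mem_Ioc, ← hl', ← hr, show 2 * (j : ℕ) + 2 = lo by omega,
        show 2 * (l : ℕ) + 1 = hi by omega]
    · rw [Bar.left, hc]; omega
  · refine ⟨.co (t j) (t l), ⟨j, rfl⟩, ⟨l, rfl⟩, fun s => ?_, fun h => (h trivial).elim,
      fun _ => ⟨ho', ?_⟩⟩
    · rw [Bar.toSet, mem_Ico, ← hl, ← hr', show 2 * (j : ℕ) + 1 = lo by omega,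
        show 2 * (l : ℕ) = hi by omega]
    · rw [Bar.right, hc]; omega
  · refine ⟨.cc (t j) (t l), ⟨j, rfl⟩, ⟨l, rfl⟩, fun s => ?_, fun h => (h trivial).elim,
      fun h => (h trivial).elim⟩
    rw [Bar.toSet, mem_Icc, ← hl, ← hr, show 2 * (j : ℕ) + 1 = lo by omega,
      show 2 * (l : ℕ) + 1 = hi by omega]

/-- A nonempty bounded set of natural numbers without gaps is an interval. -/
lemma exists_interval {p : ℕ → Prop} {m : ℕ} (hex : ∃ n ≤ m, p n)
    (hc : ∀ i l j, i ≤ l → l ≤ j → j ≤ m → p i → p j → p l) :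
    ∃ lo hi, lo ≤ hi ∧ hi ≤ m ∧ ∀ n ≤ m, p n ↔ lo ≤ n ∧ n ≤ hi := by
  classical
  let F := (Finset.range (m + 1)).filter p
  have hF : ∀ n, n ∈ F ↔ n ≤ m ∧ p n := fun n => by simp [F]
  have hne : F.Nonempty := let ⟨n, hn, hp⟩ := hex; ⟨n, (hF n).2 ⟨hn, hp⟩⟩
  have h1 := (hF _).1 (F.min'_mem hne)
  have h2 := (hF _).1 (F.max'_mem hne)
  refine ⟨F.min' hne, F.max' hne, F.min'_le_max' hne, h2.1, fun n hn => ⟨fun hp => ?_, fun h => ?_⟩⟩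
  · exact ⟨F.min'_le _ ((hF n).2 ⟨hn, hp⟩), F.le_max' _ ((hF n).2 ⟨hn, hp⟩)⟩
  · exact hc _ _ _ h.1 h.2 h2.1 h1.2 h2.2

end Cells

/-! ### Existence of bar codes -/

section Existence

variable {k : Type u} [Field k] {X : Type v} [TopologicalSpace X] {f : X → ℝ}
  {N : ℕ} {t : Fin (N + 1) → ℝ}

/-- Classes at two levels have the same image over `T`. -/
def AgreeOn {r : ℕ} (T : Set ℝ) {s s' : ℝ} (x : H k r f {s}) (y : H k r f {s'}) : Prop :=
  ∃ (h : ({s} : Set ℝ) ⊆ T) (h' : ({s'} : Set ℝ) ⊆ T),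
    inclH k r f (S := {s}) (T := T) h x = inclH k r f (S := {s'}) (T := T) h' y

namespace AgreeOn

variable {r : ℕ} {T T' : Set ℝ} {s d s' : ℝ} {x : H k r f {s}} {e : H k r f {d}}
  {y : H k r f {s'}}

lemma symm (h : AgreeOn T x y) : AgreeOn T y x := by
  obtain ⟨h1, h2, h3⟩ := h
  exact ⟨h2, h1, h3.symm⟩

lemma trans (h : AgreeOn T x e) (h' : AgreeOn T e y) : AgreeOn T x y := by
  obtain ⟨h1, h2, h3⟩ := h
  obtain ⟨h4, h5, h6⟩ := h'
  exact ⟨h1, h5, h3.trans h6⟩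

lemma mono (h : AgreeOn T x y) (hT : T ⊆ T') : AgreeOn T' x y := by
  obtain ⟨h1, h2, h3⟩ := h
  refine ⟨h1.trans hT, h2.trans hT, ?_⟩
  rw [← inclH_inclH k f r h1 hT, h3, inclH_inclH]

lemma of_hIso (h : AgreeOn T' x y) (hT : HIso k f T T') (hs : s ∈ T) (hs' : s' ∈ T) :
    AgreeOn T x y := by
  obtain ⟨h1, h2, h3⟩ := h
  obtain ⟨h4, h5⟩ := hT
  refine ⟨singleton_subset_iff.2 hs, singleton_subset_iff.2 hs', (h5 r).1 ?_⟩
  rw [inclH_inclH, inclH_inclH]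
  exact h3

end AgreeOn

lemma agreeOn_Icc_iff {r : ℕ} {s s' : ℝ} (h : s ≤ s') {x : H k r f {s}} {y : H k r f {s'}} :
    AgreeOn (Icc s s') x y ↔ up k r f h x = down k r f h y :=
  ⟨fun ⟨_, _, h⟩ => h, fun h' => ⟨_, _, h'⟩⟩

variable (k) in
/-- Enlarging a slab within the cells of its two ends does not change its homology, provided that
these cells are equal or adjacent. -/
lemma IsTame.hIso_Icc_of_cell (hf : IsTame f t) {a s s' b : ℝ} (h1 : a ≤ s) (h2 : s ≤ s')
    (h3 : s' ≤ b) (h4 : cell t a = cell t s) (h5 : cell t s' = cell t b)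
    (h6 : cell t b ≤ cell t a + 1) : HIso k f (Icc s s') (Icc a b) := by
  have ht := hf.strictMono
  have h7 := cell_mono (t := t) h2
  have hsub : Icc s s' ⊆ Icc a b := Icc_subset_Icc h1 h3
  rcases Nat.lt_or_ge (cell t a) (cell t b) with hlt | hge
  · rcases Nat.mod_two_eq_zero_or_one (cell t a) with ho | ho
    · obtain rfl := eq_of_cell_odd ht h5 (by omega)
      exact (hf.hIso_down k h2 (notMem_Ico_of_cell ht (by omega))).of_left
        (hf.hIso_down k (h1.trans h2) (notMem_Ico_of_cell ht (by omega))) hsub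
    · obtain rfl := eq_of_cell_odd ht h4 (by omega)
      exact (hf.hIso_up k h2 (notMem_Ioc_of_cell ht (by omega))).of_left
        (hf.hIso_up k (h2.trans h3) (notMem_Ioc_of_cell ht (by omega))) hsub
  · have h8 : HIso k f (Icc a s) (Icc a b) :=
      (hf.hIso_up k h1 (notMem_Ioc_of_cell ht (by omega))).of_left
        (hf.hIso_up k (h1.trans (h2.trans h3)) (notMem_Ioc_of_cell ht (by omega)))
        (Icc_subset_Icc_right (h2.trans h3))
    exact (hf.hIso_up k h2 (notMem_Ioc_of_cell ht (by omega))).of_left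
      ((hf.hIso_down k h1 (notMem_Ico_of_cell ht (by omega))).trans h8) hsub

/-- Agreement of classes at two levels in equal or adjacent cells can be tested at any other two
levels in these cells. -/
lemma IsTame.agreeOn_of_cell (hf : IsTame f t) {r : ℕ} {s s' q q' : ℝ} (hs : s ≤ s') (hq : q ≤ q')
    (h1 : cell t s = cell t q) (h2 : cell t s' = cell t q') (h3 : cell t s' ≤ cell t s + 1)
    {x : H k r f {s}} {x' : H k r f {s'}} {y : H k r f {q}} {y' : H k r f {q'}}
    (hxy : AgreeOn (uIcc s q) x y) (hxy' : AgreeOn (uIcc s' q') x' y')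
    (hy : AgreeOn (Icc q q') y y') : AgreeOn (Icc s s') x x' := by
  have hiso : HIso k f (Icc s s') (Icc (min s q) (max s' q')) := by
    refine hf.hIso_Icc_of_cell k (min_le_left _ _) hs (le_max_left _ _) ?_ ?_ ?_
    · rcases min_choice s q with h | h <;> rw [h]
      exact h1.symm
    · rcases max_choice s' q' with h | h <;> rw [h]
      exact h2
    · rcases min_choice s q with h | h <;> rcases max_choice s' q' with h' | h' <;>
        rw [h, h'] <;> omega
  refine AgreeOn.of_hIso ?_ hiso (left_mem_Icc.2 hs) (right_mem_Icc.2 hs)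
  refine (hxy.mono ?_).trans ((hy.mono ?_).trans (hxy'.symm.mono ?_))
  · exact Icc_subset_Icc_right (max_le (hs.trans (le_max_left _ _)) (hq.trans (le_max_right _ _)))
  · exact Icc_subset_Icc (min_le_right _ _) (le_max_right _ _)
  · exact Icc_subset_Icc_left (le_min ((min_le_left _ _).trans hs) ((min_le_right _ _).trans hq))

variable (k) in
/-- The homologies of two levels in the same cell are identified by agreement. -/
lemma IsTame.exists_transport (hf : IsTame f t) (r : ℕ) {q s : ℝ} (h : cell t q = cell t s) :
    ∃ φ : H k r f {q} ≃ₗ[k] H k r f {s}, ∀ y, AgreeOn (uIcc s q) (φ y) y := by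
  have ht := hf.strictMono
  rcases le_total q s with hqs | hqs
  · obtain ⟨h1, h2⟩ := hf.hIso_up k hqs (notMem_Ioc_of_cell ht (Or.inl h.symm))
    obtain ⟨h3, h4⟩ := hf.hIso_down k hqs (notMem_Ico_of_cell ht (Or.inl h.symm))
    refine ⟨(LinearEquiv.ofBijective _ (h2 r)).trans (LinearEquiv.ofBijective _ (h4 r)).symm,
      fun y => ?_⟩
    rw [uIcc_of_ge hqs]
    refine ⟨h3, h1, ?_⟩
    exact (LinearEquiv.ofBijective _ (h4 r)).apply_symm_apply (LinearEquiv.ofBijective _ (h2 r) y)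
  · obtain ⟨h1, h2⟩ := hf.hIso_up k hqs (notMem_Ioc_of_cell ht (Or.inl h))
    obtain ⟨h3, h4⟩ := hf.hIso_down k hqs (notMem_Ico_of_cell ht (Or.inl h))
    refine ⟨(LinearEquiv.ofBijective _ (h4 r)).trans (LinearEquiv.ofBijective _ (h2 r)).symm,
      fun y => ?_⟩
    rw [uIcc_of_le hqs]
    refine ⟨h1, h3, ?_⟩
    exact (LinearEquiv.ofBijective _ (h2 r)).apply_symm_apply (LinearEquiv.ofBijective _ (h4 r) y)

variable (k f) in
/-- The linear relation between the homologies of two levels given by agreement on the slab between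
them. -/
noncomputable def levelRel (r : ℕ) (s s' : ℝ) : Submodule k (H k r f {s} × H k r f {s'}) :=
  LinearMap.eqLocus
    ((inclH k r f (T := uIcc s s') (singleton_subset_iff.2 left_mem_uIcc)) ∘ₗ LinearMap.fst k _ _)
    ((inclH k r f (T := uIcc s s') (singleton_subset_iff.2 right_mem_uIcc)) ∘ₗ LinearMap.snd k _ _)

lemma mem_levelRel {r : ℕ} {s s' : ℝ} {x : H k r f {s}} {y : H k r f {s'}} :
    (x, y) ∈ levelRel k f r s s' ↔ AgreeOn (uIcc s s') x y :=
  ⟨fun h => ⟨_, _, h⟩, fun ⟨_, _, h⟩ => h⟩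

/-- Decomposing the sequence of the homologies of one level in each cell, and transporting the
resulting strands within the cells, gives a system of bars. -/
lemma IsTame.exists_preBarcode (hf : IsTame f t) (r : ℕ) :
    ∃ ι : Type (max u v), Nonempty (PreBarcode k r f t ι) := by
  classical
  have ht := hf.strictMono
  -- a level in each cell
  have hex : ∀ n, ∃ s, n ≤ 2 * N + 2 → cell t s = n := fun n => by
    by_cases hn : n ≤ 2 * N + 2
    · obtain ⟨s, hs⟩ := exists_cell_eq ht hn
      exact ⟨s, fun _ => hs⟩
    · exact ⟨0, fun h => (hn h).elim⟩
  choose q hq using hex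
  obtain ⟨ι, S, hS⟩ := exists_isStrandBasis (k := k) (M := fun n => H k r f {q n})
    (fun n => levelRel k f r (q n) (q (n + 1))) (2 * N + 2)
  have hqlt : ∀ n < 2 * N + 2, q n ≤ q (n + 1) := fun n hn =>
    (lt_of_cell_lt (t := t) (by rw [hq n (by omega), hq (n + 1) (by omega)]; omega)).le
  have hrel : ∀ n < 2 * N + 2, ∀ x y, (x, y) ∈ levelRel k f r (q n) (q (n + 1)) ↔
      AgreeOn (Icc (q n) (q (n + 1))) x y := fun n hn x y => by
    rw [mem_levelRel, uIcc_of_le (hqlt n hn)]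
  -- every class in an open cell extends to the adjacent critical levels
  have hdown : ∀ n < 2 * N + 2, n % 2 = 0 → ∀ x, ∃ y,
      (x, y) ∈ levelRel k f r (q n) (q (n + 1)) := fun n hn ho x => by
    obtain ⟨h1, h2⟩ := hf.hIso_down k (hqlt n hn) (notMem_Ico_of_cell ht (Or.inr (by
      rw [hq n (by omega), hq (n + 1) (by omega)]; exact ⟨rfl, ho⟩)))
    obtain ⟨y, hy⟩ := (h2 r).2 (up k r f (hqlt n hn) x)
    exact ⟨y, (hrel n hn x y).2 ((agreeOn_Icc_iff (hqlt n hn)).2 hy.symm)⟩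
  have hup : ∀ n < 2 * N + 2, n % 2 = 1 → ∀ y, ∃ x,
      (x, y) ∈ levelRel k f r (q n) (q (n + 1)) := fun n hn ho y => by
    obtain ⟨h1, h2⟩ := hf.hIso_up k (hqlt n hn) (notMem_Ioc_of_cell ht (Or.inr (by
      rw [hq n (by omega), hq (n + 1) (by omega)]; exact ⟨rfl, ho⟩)))
    obtain ⟨x, hx⟩ := (h2 r).2 (down k r f (hqlt n hn) y)
    exact ⟨x, (hrel n hn x y).2 ((agreeOn_Icc_iff (hqlt n hn)).2 hx)⟩
  let ι' : Type (max u v) := {b : ι // ∃ n ≤ 2 * N + 2, S b n ≠ 0}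
  have hsupp : ∀ b : ι', ∃ lo hi, lo ≤ hi ∧ hi ≤ 2 * N + 2 ∧
      ∀ n ≤ 2 * N + 2, S b.1 n ≠ 0 ↔ lo ≤ n ∧ n ≤ hi := fun b =>
    exists_interval b.2 (hS.connected b.1)
  choose lo hi hlohi hhi hmem using hsupp
  have hlo1 : ∀ b, 1 ≤ lo b := fun b => by
    by_contra h
    refine ((hmem b 0 (by omega)).2 ⟨by omega, by omega⟩)
      (hf.eq_zero_of_notMem k (fun h0 => ?_) r _)
    have h1 := (le_cell_iff ht (q 0) 0).2 h0.1
    rw [hq 0 (by omega)] at h1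
    omega
  have hhi1 : ∀ b, hi b ≤ 2 * N + 1 := fun b => by
    by_contra h
    refine ((hmem b (2 * N + 2) le_rfl).2 ⟨(hlohi b).trans (hhi b), by omega⟩)
      (hf.eq_zero_of_notMem k (fun h0 => ?_) r _)
    have h1 := (lt_cell_iff ht (q (2 * N + 2)) (Fin.last N)).1 (by
      rw [hq (2 * N + 2) le_rfl, Fin.val_last])
    exact h0.2.not_gt h1
  choose bar hleft hright hbar hlc hrc using fun b =>
    exists_bar ht (hlo1 b) (hlohi b) (hhi1 b)
  choose φ hφ using fun s => hf.exists_transport k r (hq (cell t s) (cell_le s))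
  let cls : ι' → ∀ s, H k r f {s} := fun b s => φ s (S b.1 (cell t s))
  have hcls : ∀ b s n, cell t s = n → AgreeOn (uIcc s (q n)) (cls b s) (S b.1 n) := by
    rintro b s _ rfl
    exact hφ s _
  have hcls0 : ∀ b s, S b.1 (cell t s) = 0 → cls b s = 0 := fun b s h => by
    simp only [cls, h, map_zero]
  have hin : ∀ b s, s ∈ (bar b).toSet ↔ S b.1 (cell t s) ≠ 0 := fun b s =>
    (hbar b s).trans (hmem b _ (cell_le s)).symm
  -- classes in equal or adjacent cells agree as soon as the strand follows the relation
  have same : ∀ b s s' (h : s ≤ s'), cell t s' = cell t s →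
      up k r f h (cls b s) = down k r f h (cls b s') := fun b s s' h hc => by
    have hqc := hq _ (cell_le (t := t) s)
    exact (agreeOn_Icc_iff h).1 (hf.agreeOn_of_cell h le_rfl hqc.symm (hc.trans hqc.symm) (by omega)
      (hcls b s _ rfl) (hcls b s' _ hc) ⟨by simp, by simp, rfl⟩)
  have adj : ∀ b s s' (h : s ≤ s') n, n < 2 * N + 2 → cell t s = n → cell t s' = n + 1 →
      (S b.1 n, S b.1 (n + 1)) ∈ levelRel k f r (q n) (q (n + 1)) →
      up k r f h (cls b s) = down k r f h (cls b s') := fun b s s' h n hn hc hc' hR => by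
    exact (agreeOn_Icc_iff h).1 (hf.agreeOn_of_cell h (hqlt n hn) (hc.trans (hq n (by omega)).symm)
      (hc'.trans (hq (n + 1) (by omega)).symm) (by omega) (hcls b s _ hc) (hcls b s' _ hc')
      ((hrel n hn _ _).1 hR))
  have near : ∀ b s s' (h : s ≤ s'), cell t s' ≤ cell t s + 1 → s ∈ (bar b).toSet →
      s' ∈ (bar b).toSet → up k r f h (cls b s) = down k r f h (cls b s') := by
    intro b s s' h hc hs hs'
    have hm := cell_mono (t := t) h
    rcases hm.eq_or_lt with he | hlt
    · exact same b s s' h he.symm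
    · have hc' : cell t s' = cell t s + 1 := by omega
      have hle := cell_le (t := t) s'
      rw [hin] at hs hs'
      rw [hc'] at hs'
      refine adj b s s' h _ (by omega) rfl hc' ?_
      rcases hS.step b.1 (cell t s) (by omega) with h1 | h1 | h1
      exacts [h1, (hs' h1.1).elim, (hs h1.1).elim]
  have agree : ∀ s s' (h : s ≤ s'), ∀ b, s ∈ (bar b).toSet → s' ∈ (bar b).toSet →
      up k r f h (cls b s) = down k r f h (cls b s') := by
    refine level_induction t
      (fun s s' h hc b => near b s s' h (cell_le_of_notMem_Ioc ht hc))
      (fun s s' h hc b => near b s s' h (cell_le_of_notMem_Ico ht hc))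
      fun s d s' hsd hds h1 h2 b hs hs' => ?_
    have hd := (bar b).ordConnected_toSet.out hs hs' ⟨hsd, hds⟩
    exact up_eq_down_trans hsd hds (h1 b hs hd) (h2 b hd hs')
  refine ⟨ι', ⟨⟨bar, fun b => ?_, hleft, hright, cls, fun s => ?_, fun s => ?_,
    fun b s s' h => agree s s' h b, fun b hb s h hs => ?_, fun b hb s h hs => ?_⟩⟩⟩
  · refine ⟨q (lo b), (hbar b _).2 ?_⟩
    rw [hq _ ((hlohi b).trans (hhi b))]
    exact ⟨le_rfl, hlohi b⟩
  · have h1 := (hS.linearIndepOn _ (cell_le (t := t) s)).map' (φ s).toLinearMap (φ s).ker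
    let g : {b : ι' // s ∈ (bar b).toSet} → {b | S b (cell t s) ≠ 0} :=
      fun b => ⟨b.1.1, (hin b.1 s).1 b.2⟩
    exact h1.comp g fun b b' h => Subtype.ext (Subtype.ext (congrArg (fun x => x.1) h))
  · have h1 := congrArg (Submodule.map (φ s).toLinearMap)
      (hS.span_eq_top _ (cell_le (t := t) s))
    rw [Submodule.map_span, Submodule.map_top, LinearEquiv.range, image_image] at h1
    rw [← h1]
    congr 1
    ext c
    constructor
    · rintro ⟨b, rfl⟩
      exact ⟨b.1.1, (hin b.1 s).1 b.2, rfl⟩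
    · rintro ⟨b, hb, rfl⟩
      let b' : ι' := ⟨b, _, cell_le s, hb⟩
      exact ⟨⟨b', (hin b' s).2 hb⟩, rfl⟩
  -- at an open left end the strand starts with a class related to zero
  · obtain ⟨ho, hc⟩ := hlc b hb
    have hl1 := hlo1 b
    have hl2 := (hlohi b).trans (hhi1 b)
    have hn : cell t (bar b).left < 2 * N + 2 := by omega
    have h0 : S b.1 (cell t (bar b).left) = 0 := by
      by_contra h0
      have := ((hmem b _ hn.le).1 h0).1
      omega
    have hlo0 : S b.1 (cell t (bar b).left + 1) ≠ 0 :=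
      (hmem b _ (by omega)).2 ⟨by omega, by have := hlohi b; omega⟩
    have hR := hS.step b.1 (cell t (bar b).left) hn
    replace hR := hR.resolve_right (not_or.2 ⟨fun h => hlo0 h.1, fun h => by
      obtain ⟨x, hx⟩ := hup _ hn (by omega) (S b.1 (cell t (bar b).left + 1))
      exact h.2 x hx⟩)
    have hs1 := (hbar b s).1 hs
    have hstart : ∀ s' (h : (bar b).left ≤ s'), cell t s' = lo b →
        down k r f h (cls b s') = 0 := fun s' h hs' => by
      rw [← adj b _ s' h _ hn rfl (hs'.trans hc.symm) hR, hcls0 b _ h0, map_zero]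
    rcases hs1.1.eq_or_lt with he | hlt
    · exact hstart s h he.symm
    · have hql : cell t (q (lo b)) = lo b := hq _ (by omega)
      have h1 : (bar b).left ≤ q (lo b) := (lt_of_cell_lt (t := t) (by omega)).le
      have h2 : q (lo b) ≤ s := (lt_of_cell_lt (t := t) (by omega)).le
      have h3 := up_eq_down_trans h1 h2 (x := 0) (by rw [map_zero, hstart _ h1 hql])
        (agree _ _ h2 b ((hbar b _).2 ⟨hql.ge, by have := hlohi b; omega⟩) hs)
      rw [← h3, map_zero]
  -- at an open right end the strand ends with a class related to zero
  · obtain ⟨ho, hc⟩ := hrc b hb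
    have hn : hi b < 2 * N + 2 := by have := hhi1 b; omega
    have h0 : S b.1 (hi b + 1) = 0 := by
      by_contra h0
      have := ((hmem b _ (by omega)).1 h0).2
      omega
    have hhi0 : S b.1 (hi b) ≠ 0 := (hmem b _ hn.le).2 ⟨hlohi b, le_rfl⟩
    have hR := hS.step b.1 (hi b) hn
    replace hR := hR.resolve_right (not_or.2 ⟨fun h => by
      obtain ⟨y, hy⟩ := hdown _ hn ho (S b.1 (hi b))
      exact h.2 y hy, fun h => hhi0 h.1⟩)
    have hs1 := (hbar b s).1 hs
    have hend : ∀ s' (h : s' ≤ (bar b).right), cell t s' = hi b →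
        up k r f h (cls b s') = 0 := fun s' h hs' => by
      rw [adj b s' _ h _ hn hs' hc hR, hcls0 b _ (hc ▸ h0), map_zero]
    rcases hs1.2.eq_or_lt with he | hlt
    · exact hend s h he
    · have hqh : cell t (q (hi b)) = hi b := hq _ hn.le
      have h1 : q (hi b) ≤ (bar b).right := (lt_of_cell_lt (t := t) (by omega)).le
      have h2 : s ≤ q (hi b) := (lt_of_cell_lt (t := t) (by omega)).le
      have h3 := up_eq_down_trans h2 h1 (y := 0)
        (agree _ _ h2 b hs ((hbar b _).2 ⟨by have := hlohi b; omega, hqh.le⟩))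
        (by rw [map_zero, hend _ h1 hqh])
      rw [h3, map_zero]

end Existence

end LevelPersistence

open LevelPersistence in
open scoped Classical in
theorem mainTheorem4 (k : Type u) [Field k] {X : Type v} [TopologicalSpace X]
    (f : X → ℝ) {N : ℕ} (t : Fin (N + 1) → ℝ) (hf : IsTame f t) (r : ℕ) :
    (∃ ι : Type (max u v), Nonempty (LevelBarcode k r f t ι)) ∧
    ∀ (ι : Type w) (B : LevelBarcode k r f t ι) (s'' s s' : ℝ) (h' : s'' ≤ s) (h : s ≤ s'),
      iNum k r f h = B.numContaining (Set.Icc s s') ∧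
      lNum k r f s = B.numContaining {s} ∧
      lPlusNum k r f h =
        (∑ p : Fin (N + 1) × Fin (N + 1) with t p.1 ≤ s ∧ s < t p.2 ∧ t p.2 ≤ s',
          B.mult (.co (t p.1) (t p.2))) +
        (∑ p : Fin (N + 1) × Fin (N + 1) with t p.1 < s ∧ s < t p.2 ∧ t p.2 ≤ s',
          B.mult (.oo (t p.1) (t p.2))) ∧
      lMinusNum k r f h' =
        (∑ p : Fin (N + 1) × Fin (N + 1) with s'' ≤ t p.1 ∧ t p.1 < s ∧ s ≤ t p.2,
          B.mult (.oc (t p.1) (t p.2))) +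
        (∑ p : Fin (N + 1) × Fin (N + 1) with s'' ≤ t p.1 ∧ t p.1 < s ∧ s < t p.2,
          B.mult (.oo (t p.1) (t p.2))) ∧
      eNum k r f h' h =
        (∑ p : Fin (N + 1) × Fin (N + 1) with
            s'' ≤ t p.1 ∧ t p.1 < s ∧ s < t p.2 ∧ t p.2 ≤ s',
          B.mult (.oo (t p.1) (t p.2))) := by
  refine ⟨?_, fun ι B s'' s s' h' h => ⟨?_, ?_, B.lPlusNum_eq_sum hf h, B.lMinusNum_eq_sum hf h',
    B.eNum_eq_sum hf h' h⟩⟩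
  · obtain ⟨ι, ⟨B⟩⟩ := hf.exists_preBarcode (k := k) r
    exact ⟨ι, ⟨B.toLevelBarcode hf⟩⟩
  · rw [B.numContaining_Icc h]
    exact B.toPreBarcode.iNum_eq hf h
  · rw [B.numContaining_singleton]
    exact B.toPreBarcode.lNum_eq s
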